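/- **Conventions.** $\mathbb N=\{0,1,2,\dots\}$ and $\infty\pm r=\infty$ for $r\in\mathbb N$. For a complex valued function $f$ continuous near $t_0\in\mathbb R$, the multiplicity $m_{t_0}(f)\in\mathbb N\cup\{\infty\}$ is the supremum of all integers $k\ge 0$ such that $f(t)=(t-t_0)^k g(t)$ near $t_0$ for some $g$ continuous near $t_0$. Let $I\subseteq\mathbb R$ be an open interval. For $q\in\mathbb N\cup\{\infty\}$, a $C^q$-curve of normal matrices on $I$ is a map $A=(A_{ij})$ from $I$ to the complex $n\times n$ matrices with all $A_{ij}\in C^q(I,\mathbb C)$ and $A(t)A(t)^*=A(t)^*A(t)$ for all $t\in I$. **The tree $T(A,t_0)$.** To a germ $A$ at $t_0$ of a $C^q$-curve of normal $n\times n$ matrices associate a finite rooted tree with vertices labeled by pairs $(d,\varrho)$ as follows. The root has first label $d=n$. (I) If $A(t_0)$ has at least two distinct eigenvalues $\nu_1,\dots,\nu_l$, the root has label $(n,0)$. Choose disjoint small circles, the $i$-th one enclosing only $\nu_i$ among the eigenvalues of $A(t_0)$. For $t$ near $t_0$ the sums of the eigenspaces of $A(t)$ for the eigenvalues inside the $i$-th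 circle form a $C^q$ vector bundle of some rank $n_i$; let $A_i$ be the $n_i\times n_i$ normal matrix of the restriction of $A$ to it in a local orthonormal $C^q$-frame. The root has $l$ successors, and the subtree above the $i$-th one is the tree of the $C^q$-germ $A_i$. (II) If all eigenvalues of $A(t_0)$ coincide, let $B=A-\frac1n\operatorname{Trace}(A)\,\mathbb I_n$ and $r=\min_{i,j}m_{t_0}(B_{ij})$. If $r=\infty$, the root has label $(n,0)$ and has $n$ successors, all of them leaves with label $(1,0)$. If $r<\infty$, let $A_{(r)}$ be the continuous germ with $B(t)=(t-t_0)^rA_{(r)}(t)$. If $q<r$ or $A_{(r)}(t_0)=0$, the root is a leaf with label $(n,0)$. Otherwise $A_{(r)}$ is $C^{q-r}$ and $A_{(r)}(t_0)$ has at least two distinct eigenvalues; the root gets the label $(n,r)$, and its successors with their subtrees are those that (I) produces for the $C^{q-r}$-germ $A_{(r)}$. Up to the order of successors the tree does not depend on the choices. It is *admissible* if $d=1$ for every leaf with label $(d,0)$. Define recursively $\Theta_{t_0}(V)=\varrho(V)$ for a leaf $V$ and $\Theta_{t_0}(V)=\varrho(V)+\max_W\Theta_{t_0}(W)$ otherwise,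 where $W$ ranges over the successors of $V$ and $\varrho(V)$ is the second label of $V$. Let $\Theta_{t_0}(A)$ be the value at the root, and $\Theta(A)=\sup_{t\in I}\Theta_t(A)\in\mathbb N\cup\{\infty\}$. **The set $E^{(\infty)}(A)$.** Let $\lambda_1,\dots,\lambda_n$ be the eigenvalues of $A(t)$ with multiplicity, $s_i=\sum_j\lambda_j^i$, and $\Delta_k(t)=\det(s_{i+j-2})_{1\le i,j\le k}$. Then $E^{(\infty)}(A)$ is the set of all $t\in I$ such that $m_t(\Delta_s)=\infty$, where $s$ is the maximal integer for which the germ of $\Delta_s$ at $t$ is not zero. **Theorem.** Let $p,q\in\mathbb N\cup\{\infty\}$ and let $A$ be a $C^q$-curve of normal $n\times n$ matrices on $I$ that is also of class $C^{p+\Theta(A)}$, where the trees $T(A,t)$ and $\Theta(A)$ are formed for $A$ as a $C^q$-curve (for instance, $q=p+\Theta(A)$). Assume that $T(A,t)$ is admissible for every $t\in I$ and that $E^{(\infty)}(A)=\emptyset$. Then there are functions $\lambda_1,\dots,\lambda_n\in C^{p+\Theta(A)}(I,\mathbb C)$ with $\det(z\mathbb I_n-A(t))=\prod_{i=1}^n(z-\lambda_i(t))$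 for all $t\in I$ such that: 1. every $t_0\in I$ has an open neighborhood $U\subseteq I$ with $C^p$-maps $v_1,\dots,v_n:U\to\mathbb C^n$ such that, for each $t\in U$, the vectors $v_1(t),\dots,v_n(t)$ form an orthonormal basis of $\mathbb C^n$ and $A(t)v_i(t)=\lambda_i(t)v_i(t)$ for all $i$; 2. if $p\ge 1$, such $C^p$-maps $v_1,\dots,v_n$ exist on all of $I$. -/

import Mathlib

open Filter Topology Polynomial

/-- The multiplicity at `t₀` of a complex function `f` that is continuous near `t₀`: the supremum of
all `k` such that `f t = (t - t₀) ^ k * g t` near `t₀` for some `g` continuous near `t₀`. -/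
noncomputable def multiplicityAt (t₀ : ℝ) (f : ℝ → ℂ) : ℕ∞ :=
  ⨆ (k : ℕ) (_ : ∃ g : ℝ → ℂ, (∀ᶠ t in 𝓝 t₀, ContinuousAt g t) ∧
    ∀ᶠ t in 𝓝 t₀, f t = ((t - t₀ : ℝ) : ℂ) ^ k * g t), (k : ℕ∞)

/-- `A` is, on the set `I`, a curve of class `C^q` of normal `n × n` matrices. -/
def IsNormalCurve {n : ℕ} (q : ℕ∞) (A : ℝ → Matrix (Fin n) (Fin n) ℂ) (I : Set ℝ) : Prop :=
  (∀ i j, ContDiffOn ℝ q (fun t => A t i j) I) ∧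
    ∀ t ∈ I, A t * (A t).conjTranspose = (A t).conjTranspose * A t

/-! ### The set of points of infinite order of contact -/

/-- The Newton power sum `∑ λⱼ ^ i` of the roots of a complex polynomial. -/
noncomputable def newtonSum (P : ℂ[X]) (i : ℕ) : ℂ :=
  (P.roots.map fun z => z ^ i).sum

/-- The leading principal `k × k` minor of the Bezoutiant `(s_{i + j})_{i, j ≥ 0}`, where `sᵢ` are the
Newton power sums of the roots. -/
noncomputable def bezoutiantMinor (k : ℕ) (P : ℂ[X]) : ℂ :=
  (Matrix.of fun i j : Fin k => newtonSum P ((i : ℕ) + (j : ℕ))).det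

/-- The set `E^(∞)(P)` of a curve of polynomials: the points `t` of `I` at which the minor `Δ_s ∘ P`
has infinite multiplicity, where `s` is the largest integer for which the germ at `t` of `Δ_s ∘ P`
is not zero. -/
def infiniteContactSet (P : ℝ → ℂ[X]) (I : Set ℝ) : Set ℝ :=
  {t | t ∈ I ∧ ∃ s : ℕ,
    (¬ ∀ᶠ u in 𝓝 t, bezoutiantMinor s (P u) = 0) ∧
    (∀ k : ℕ, s < k → ∀ᶠ u in 𝓝 t, bezoutiantMinor k (P u) = 0) ∧
    multiplicityAt t (fun u => bezoutiantMinor s (P u)) = ⊤}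

/-! ### Labeled rooted trees -/

/-- Finite rooted trees whose vertices carry labels `(d, q)` of natural numbers;
`node d q k c` is the tree whose root has label `(d, q)` and the `k` successors `c i`. -/
inductive LabeledTree : Type
  | node (d q k : ℕ) (c : Fin k → LabeledTree) : LabeledTree

namespace LabeledTree

/-- The tree consisting of one vertex. -/
def leaf (d q : ℕ) : LabeledTree := node d q 0 Fin.elim0

/-- Every leaf with label `(d, 0)` satisfies `d = 1`. -/
def Admissible : LabeledTree → Prop
  | node d q k c => (k = 0 → q = 0 → d = 1) ∧ ∀ i, (c i).Admissible

/-- `Θ(V) = q(V)` at a leaf, and `Θ(V) = q(V) + max_W Θ(W)` over the successors `W` of `V` otherwise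
(the supremum over no successors is `0`). This is the value at the root. -/
def theta : LabeledTree → ℕ
  | node _ q _ c => q + Finset.univ.sup fun i => (c i).theta

end LabeledTree

/-! ### The local spectral decomposition of a curve of normal matrices -/

/-- The trace-free part `A - (1/n) Trace(A) 𝕀`. -/
noncomputable def traceFreePart {n : ℕ} (A : ℝ → Matrix (Fin n) (Fin n) ℂ) :
    ℝ → Matrix (Fin n) (Fin n) ℂ :=
  fun t => A t - ((n : ℂ)⁻¹ * (A t).trace) • (1 : Matrix (Fin n) (Fin n) ℂ)

/-- `r = min_{i,j} m_{t₀}(A_{ij})`. -/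
noncomputable def matrixOrder {n : ℕ} (t₀ : ℝ) (A : ℝ → Matrix (Fin n) (Fin n) ℂ) : ℕ∞ :=
  ⨅ (i : Fin n) (j : Fin n), multiplicityAt t₀ fun t => A t i j

/-- `C` is the continuous germ `(t - t₀) ^ (-r) A(t)` at `t₀`. -/
def IsQuotientGerm {n : ℕ} (t₀ : ℝ) (r : ℕ) (A C : ℝ → Matrix (Fin n) (Fin n) ℂ) : Prop :=
  (∀ᶠ t in 𝓝 t₀, ContinuousAt C t) ∧
    ∀ᶠ t in 𝓝 t₀, A t = ((t - t₀ : ℝ) : ℂ) ^ r • C t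

/-- The sum of the eigenspaces of the matrix `M` for the eigenvalues in the open disk with center `ν`
and radius `ε`. -/
noncomputable def spectralSubspace {n : ℕ} (M : Matrix (Fin n) (Fin n) ℂ) (ν : ℂ) (ε : ℝ) :
    Submodule ℂ (Fin n → ℂ) :=
  ⨆ z ∈ Metric.ball ν ε, Module.End.eigenspace (Matrix.toLin' M) z

/-- The columns of `F` are a local orthonormal frame, of class `C^q` near `t₀`, of the bundle with
fibers `spectralSubspace (A t) ν ε`. -/
def IsSpectralFrame {n m : ℕ} (t₀ : ℝ) (q : ℕ∞) (A : ℝ → Matrix (Fin n) (Fin n) ℂ) (ν : ℂ) (ε : ℝ)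
    (F : ℝ → Matrix (Fin n) (Fin m) ℂ) : Prop :=
  ∀ᶠ t in 𝓝 t₀,
    (∀ i j, ContDiffAt ℝ q (fun u => F u i j) t) ∧
    (F t).conjTranspose * F t = 1 ∧
    LinearMap.range (Matrix.toLin' (F t)) = spectralSubspace (A t) ν ε

/-- `IsSpectralTree t₀ q A T`: the local spectral decomposition of the germ at `t₀` of the `C^q`-curve
`A` of normal matrices produces the labeled rooted tree `T`. Frames are chosen and the successors of
a vertex are numbered arbitrarily; neither affects the tree up to the order of successors. -/
inductive IsSpectralTree (t₀ : ℝ) : {n : ℕ} → ℕ∞ → (ℝ → Matrix (Fin n) (Fin n) ℂ) →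
    LabeledTree → Prop
  /-- `A t₀` has the distinct eigenvalues `ν₁, …, ν_l`, `l ≥ 2`. Separate them by disjoint circles, and
  let `Aᵢ` be `A` restricted to the sum of the eigenspaces for the eigenvalues inside the `i`-th
  circle, written in a local orthonormal `C^q`-frame. The root has label `(n, 0)` and one successor
  for each `Aᵢ`. -/
  | split {n l : ℕ} {q : ℕ∞} {A : ℝ → Matrix (Fin n) (Fin n) ℂ}
      (ν : Fin l → ℂ) (ε : ℝ) (m : Fin l → ℕ)
      (F : (i : Fin l) → ℝ → Matrix (Fin n) (Fin (m i)) ℂ) (c : Fin l → LabeledTree) :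
      2 ≤ l → Function.Injective ν → Set.range ν = spectrum ℂ (A t₀) →
      0 < ε → (∀ i j, i ≠ j → 2 * ε < dist (ν i) (ν j)) →
      (∀ i, IsSpectralFrame t₀ q A (ν i) ε (F i)) →
      (∀ i, IsSpectralTree t₀ q (fun t => (F i t).conjTranspose * A t * F i t) (c i)) →
      IsSpectralTree t₀ q A (.node n 0 l c)
  /-- The eigenvalues of `A t₀` coincide and `r = ∞`: the root has label `(n, 0)` and `n` successors,
  which are leaves with label `(1, 0)`. -/
  | flat {n : ℕ} {q : ℕ∞} {A : ℝ → Matrix (Fin n) (Fin n) ℂ} :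
      (spectrum ℂ (A t₀)).Subsingleton → matrixOrder t₀ (traceFreePart A) = ⊤ →
      IsSpectralTree t₀ q A (.node n 0 n fun _ => .leaf 1 0)
  /-- The eigenvalues of `A t₀` coincide and `r < ∞`, but `q < r` or `A_(r)` vanishes at `t₀`:
  the root is a leaf with label `(n, 0)`. -/
  | terminate {n r : ℕ} {q : ℕ∞} {A : ℝ → Matrix (Fin n) (Fin n) ℂ}
      (C : ℝ → Matrix (Fin n) (Fin n) ℂ) :
      (spectrum ℂ (A t₀)).Subsingleton → matrixOrder t₀ (traceFreePart A) = r →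
      IsQuotientGerm t₀ r (traceFreePart A) C → (q < r ∨ C t₀ = 0) →
      IsSpectralTree t₀ q A (.leaf n 0)
  /-- The eigenvalues of `A t₀` coincide, `r < ∞`, `r ≤ q` and `A_(r)` does not vanish at `t₀`. The
  trace-free matrix `A_(r) t₀` has at least two eigenvalues, so the `C^(q - r)`-curve `A_(r)` is
  split; the root gets the label `(n, r)` instead of `(n, 0)`. -/
  | divide {n r l : ℕ} {q : ℕ∞} {A : ℝ → Matrix (Fin n) (Fin n) ℂ}
      (C : ℝ → Matrix (Fin n) (Fin n) ℂ) (c : Fin l → LabeledTree) :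
      (spectrum ℂ (A t₀)).Subsingleton → matrixOrder t₀ (traceFreePart A) = r →
      IsQuotientGerm t₀ r (traceFreePart A) C → (r : ℕ∞) ≤ q → C t₀ ≠ 0 →
      IsSpectralTree t₀ (q - r) C (.node n 0 l c) →
      IsSpectralTree t₀ q A (.node n r l c)

/-- The tree of the `C^q`-curve `A` at `t₀` is admissible. -/
def AdmissibleAt {n : ℕ} (q : ℕ∞) (A : ℝ → Matrix (Fin n) (Fin n) ℂ) (t₀ : ℝ) : Prop :=
  ∃ T : LabeledTree, IsSpectralTree t₀ q A T ∧ T.Admissible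

/-- `Θ(A) = sup_{t ∈ I} Θ_t(A)`, where `Θ_t(A)` is the value of `Θ` at the root of the tree at `t` (all
trees of `A` at `t` agree up to the order of successors, hence have the same value). -/
noncomputable def thetaSup {n : ℕ} (q : ℕ∞) (A : ℝ → Matrix (Fin n) (Fin n) ℂ) (I : Set ℝ) : ℕ∞ :=
  ⨆ (t : ℝ) (_ : t ∈ I) (T : LabeledTree) (_ : IsSpectralTree t q A T), (T.theta : ℕ∞)

/-! ### Parameterizations of eigenvalues and eigenvectors -/

/-- The functions `ev i` are of class `C^k` on `I` and parameterize there the eigenvalues of `A`,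
counted with multiplicity. -/
def ParameterizesEigenvalues {n : ℕ} (k : ℕ∞) (A : ℝ → Matrix (Fin n) (Fin n) ℂ) (I : Set ℝ)
    (ev : Fin n → ℝ → ℂ) : Prop :=
  (∀ i, ContDiffOn ℝ k (ev i) I) ∧
    ∀ t ∈ I, (A t).charpoly = ∏ i, (X - C (ev i t))

/-- The functions `v i` are of class `C^k` on `U` and, at every `t ∈ U`, form an orthonormal basis of
eigenvectors of `A t`, the vector `v i t` belonging to the eigenvalue `ev i t`. -/
def ParameterizesEigenvectors {n : ℕ} (k : ℕ∞) (A : ℝ → Matrix (Fin n) (Fin n) ℂ) (U : Set ℝ)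
    (ev : Fin n → ℝ → ℂ) (v : Fin n → ℝ → EuclideanSpace ℂ (Fin n)) : Prop :=
  (∀ i, ContDiffOn ℝ k (v i) U) ∧
    ∀ t ∈ U, Orthonormal ℂ (fun i => v i t) ∧
      ∀ i, (A t).mulVec (v i t).ofLp = ev i t • (v i t).ofLp

/-!
A unitary eigenvector matrix is first constructed near each point of `I`, and the local ones are then
joined to a global one.

**Local diagonalization.** Let `t₀ ∈ I`, with admissible tree `T`. In case (I) of the tree the curve
splits into blocks in a frame of the same class. In case (II) the division of the trace-free part by
`(t - t₀)^r` costs `r` derivatives. The eigenvalues nevertheless lose nothing: those of `A` are, up to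
the trace, `(t - t₀)^r` times those of `A_(r)`. To make this precise, a function is followed together
with its images under powers of the Euler operator: `EulerContDiff t₀ k r f` says that the first `r` of
them, and `f` itself, are of class `C^k`, which for continuous `f` means that `(t - t₀)^r f` is of class
`C^(k + r)`. This class is an algebra and is stable under composition with smooth maps
(`EulerContDiff.comp`), hence under the formation of spectral frames (`EulerContDiff.exists_frame`).
Division by `(t - t₀)^r` leads from `C^(k + r)` into it, and multiplication by `(t - t₀)^r` leads back.
By induction on the tree, a curve can be diagonalized so that the eigenvalues keep the regularity of
the curve and the eigenvectors lose
`Θ(T)` derivatives (`LosslessDiagonalizable`).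

The induction fails in one place: a curve that is scalar to infinite order at `t₀` need not be scalar
near `t₀`. `HasBranches` therefore also records the number `b` of branches that the tree separates,
and that any eigenvalues in excess of `b` coincide to infinite order. If there were such eigenvalues
at points arbitrarily close to `t₀`, then the last minor of the Bezoutiant with nonzero germ, which is
essentially a squared product of differences of distinct eigenvalues, would vanish to infinite order;
this is what `E^(∞)(A) = ∅` excludes (`HasBranches.ncard_le`).

**Gluing.** The same count shows that the number of distinct eigenvalues is constant near every point
of `I` off a discrete set. Near such a point two diagonalizations have, after a permutation, the same
eigenvalues, and their eigenvector matrices differ by a unitary matrix that commutes with the diagonal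
one. Up to a scalar this unitary matrix is the Cayley transform of a skew-Hermitian matrix `Y`, and the
Cayley transforms of `χ • Y`, with a cut-off function `χ`, join the two diagonalizations
(`IsDiagonalizationNear.exists_join`). As only one side of the point is changed, an exhaustion of `I`
by compact intervals yields a diagonalization over all of `I` (`exists_good_of_local`). It serves for
both assertions about the eigenvectors, with `U = I` in the local one.
-/

open scoped ContDiff Matrix.Norms.Operator Matrix

universe u

/-! ### Regularity near a point and division by powers -/

/-- `f` is of class `C^k` on a neighborhood of `t₀`. For `k = ∞` this is stronger than
`ContDiffAt ℝ ∞ f t₀`. -/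
def ContDiffNear {E : Type*} [NormedAddCommGroup E] [NormedSpace ℝ E] (t₀ : ℝ) (k : ℕ∞)
    (f : ℝ → E) : Prop :=
  ∀ᶠ t in 𝓝 t₀, ContDiffAt ℝ k f t

section Near

variable {E : Type*} [NormedAddCommGroup E] [NormedSpace ℝ E] {t₀ : ℝ} {k : ℕ∞} {f g : ℝ → E}

theorem ContDiffNear.congr (hf : ContDiffNear t₀ k f) (h : g =ᶠ[𝓝 t₀] f) :
    ContDiffNear t₀ k g := by
  filter_upwards [hf, h.eventually_nhds] with t ht h' using ht.congr_of_eventuallyEq h'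

theorem ContDiffNear.of_eq {k' : ℕ∞} (hf : ContDiffNear t₀ k f) (hk : k = k')
    (h : ∀ t, g t = f t) : ContDiffNear t₀ k' g :=
  hk ▸ hf.congr (Eventually.of_forall h)

theorem ContDiffNear.mono {k' : ℕ∞} (hf : ContDiffNear t₀ k f) (h : k' ≤ k) :
    ContDiffNear t₀ k' f := by
  filter_upwards [hf] with t ht using ht.of_le (by exact_mod_cast h)

theorem ContDiffNear.continuousAt (hf : ContDiffNear t₀ k f) :
    ∀ᶠ t in 𝓝 t₀, ContinuousAt f t := by
  filter_upwards [hf] with t ht using ht.continuousAt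

theorem ContDiffNear.self {k : ℕ∞} : ContDiffNear t₀ k (fun t : ℝ => t - t₀) :=
  Eventually.of_forall fun _ => contDiffAt_id.sub contDiffAt_const

theorem contDiffNear_succ_iff :
    ContDiffNear t₀ (k + 1) f ↔
      (∀ᶠ t in 𝓝 t₀, DifferentiableAt ℝ f t) ∧ ContDiffNear t₀ k (deriv f) := by
  have key : ∀ s : Set ℝ, IsOpen s → (ContDiffOn ℝ (k + 1 : ℕ∞) f s ↔
      DifferentiableOn ℝ f s ∧ ContDiffOn ℝ k (deriv f) s) := by
    intro s hs
    have : ((k + 1 : ℕ∞) : WithTop ℕ∞) = (k : WithTop ℕ∞) + 1 := by push_cast; rfl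
    rw [this, contDiffOn_succ_iff_deriv_of_isOpen hs]
    simp
  constructor
  · intro h
    obtain ⟨s, hs, hso, hst⟩ := eventually_nhds_iff.1 h
    obtain ⟨h1, h2⟩ := (key s hso).1 fun t ht => (hs t ht).contDiffWithinAt
    exact ⟨eventually_nhds_iff.2 ⟨s, fun t ht => (h1 t ht).differentiableAt (hso.mem_nhds ht), hso, hst⟩,
      eventually_nhds_iff.2 ⟨s, fun t ht => (h2 t ht).contDiffAt (hso.mem_nhds ht), hso, hst⟩⟩
  · rintro ⟨h1, h2⟩
    obtain ⟨s, hs, hso, hst⟩ := eventually_nhds_iff.1 (h1.and h2)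
    have := (key s hso).2 ⟨fun t ht => (hs t ht).1.differentiableWithinAt,
      fun t ht => (hs t ht).2.contDiffWithinAt⟩
    exact eventually_nhds_iff.2 ⟨s, fun t ht => (this t ht).contDiffAt (hso.mem_nhds ht), hso, hst⟩

theorem eventually_hasDerivAt_pow_smul {u : ℝ → E} (j : ℕ) {t : ℝ} {u' : E}
    (hu : HasDerivAt u u' t) :
    HasDerivAt (fun t => (t - t₀) ^ (j + 1) • u t)
      ((t - t₀) ^ (j + 1) • u' + ((j + 1 : ℝ) * (t - t₀) ^ j) • u t) t := by
  have h1 : HasDerivAt (fun t : ℝ => (t - t₀) ^ (j + 1)) ((j + 1 : ℝ) * (t - t₀) ^ j) t := by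
    simpa using ((hasDerivAt_id t).sub_const t₀).fun_pow (j + 1)
  exact h1.smul hu

theorem hasDerivAt_of_eventually_punctured {f g : ℝ → E}
    (hfg : ∀ᶠ t in 𝓝[≠] t₀, HasDerivAt f (g t) t) (hf : ContinuousAt f t₀)
    (hg : ContinuousAt g t₀) : HasDerivAt f (g t₀) t₀ := by
  have hgt : ∀ᶠ t in 𝓝[>] t₀, HasDerivAt f (g t) t := hfg.filter_mono (nhdsWithin_mono _ fun _ h => ne_of_gt h)
  have hlt : ∀ᶠ t in 𝓝[<] t₀, HasDerivAt f (g t) t := hfg.filter_mono (nhdsWithin_mono _ fun _ h => ne_of_lt h)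
  have A : HasDerivWithinAt f (g t₀) (Set.Ici t₀) t₀ := by
    refine hasDerivWithinAt_Ici_of_tendsto_deriv
      (fun y (hy : y ∈ {y | HasDerivAt f (g y) y}) => HasDerivAt.differentiableAt hy |>.differentiableWithinAt)
      hf.continuousWithinAt hgt ?_
    have : Tendsto g (𝓝[>] t₀) (𝓝 (g t₀)) := tendsto_inf_left hg
    exact this.congr' (hgt.mono fun y hy => hy.deriv.symm)
  have B : HasDerivWithinAt f (g t₀) (Set.Iic t₀) t₀ := by
    refine hasDerivWithinAt_Iic_of_tendsto_deriv
      (fun y (hy : y ∈ {y | HasDerivAt f (g y) y}) => HasDerivAt.differentiableAt hy |>.differentiableWithinAt)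
      hf.continuousWithinAt hlt ?_
    have : Tendsto g (𝓝[<] t₀) (𝓝 (g t₀)) := tendsto_inf_left hg
    exact this.congr' (hlt.mono fun y hy => hy.deriv.symm)
  simpa using B.union A

/-- A function vanishing at `t₀` whose derivative is `(t - t₀) ^ j • f` with `f` continuous is
`(t - t₀) ^ (j + 1) • (f t₀ / (j + 1)) + o((t - t₀) ^ (j + 1))`. -/
theorem tendsto_inv_pow_smul_of_hasDerivAt {W f : ℝ → E} (j : ℕ)
    (hf : ContinuousAt f t₀) (hW0 : W t₀ = 0)
    (hW : ∀ᶠ t in 𝓝 t₀, HasDerivAt W ((t - t₀) ^ j • f t) t) :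
    Tendsto (fun t => ((t - t₀) ^ (j + 1))⁻¹ • W t) (𝓝[≠] t₀)
      (𝓝 ((j + 1 : ℝ)⁻¹ • f t₀)) := by
  rw [Metric.tendsto_nhds]
  intro ε hε
  have h1 : ∀ᶠ t in 𝓝 t₀, dist (f t) (f t₀) < ε / 2 := Metric.tendsto_nhds.1 hf _ (half_pos hε)
  obtain ⟨δ, hδ, hb⟩ := Metric.eventually_nhds_iff_ball.1 (h1.and hW)
  have : ∀ᶠ t in 𝓝[≠] t₀, t ∈ Metric.ball t₀ δ ∧ t ≠ t₀ := by
    filter_upwards [nhdsWithin_le_nhds (Metric.ball_mem_nhds t₀ hδ), self_mem_nhdsWithin]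
      with t h h' using ⟨h, h'⟩
  filter_upwards [this] with t ht
  obtain ⟨htb, htne⟩ := ht
  have htne' : t - t₀ ≠ 0 := sub_ne_zero.2 htne
  have hj : (j + 1 : ℝ) ≠ 0 := by positivity
  set G : ℝ → E := fun s => W s - ((s - t₀) ^ (j + 1)) • ((j + 1 : ℝ)⁻¹ • f t₀) with hG
  have hder : ∀ s ∈ Metric.closedBall t₀ |t - t₀|,
      HasDerivWithinAt G ((s - t₀) ^ j • (f s - f t₀)) (Metric.closedBall t₀ |t - t₀|) s := by
    intro s hs
    have hs' : s ∈ Metric.ball t₀ δ := by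
      rw [Metric.mem_ball, Real.dist_eq] at htb ⊢
      rw [Metric.mem_closedBall, Real.dist_eq] at hs
      exact hs.trans_lt htb
    have h2 := (hb s hs').2.sub
      ((eventually_hasDerivAt_pow_smul (t₀ := t₀) j (hasDerivAt_const s ((j + 1 : ℝ)⁻¹ • f t₀))))
    refine (h2.congr_deriv ?_).hasDerivWithinAt
    rw [smul_zero, zero_add, smul_smul, smul_sub]
    congr 2
    field_simp
  have hbound : ∀ s ∈ Metric.closedBall t₀ |t - t₀|,
      ‖(s - t₀) ^ j • (f s - f t₀)‖ ≤ |t - t₀| ^ j * (ε / 2) := by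
    intro s hs
    have hs1 : |s - t₀| ≤ |t - t₀| := by simpa [Real.dist_eq] using hs
    have hs' : s ∈ Metric.ball t₀ δ := by
      rw [Metric.mem_ball, Real.dist_eq] at htb ⊢
      exact hs1.trans_lt htb
    rw [norm_smul, norm_pow, Real.norm_eq_abs, ← dist_eq_norm]
    have := (hb s hs').1.le
    gcongr
  have hmv := (convex_closedBall t₀ |t - t₀|).norm_image_sub_le_of_norm_hasDerivWithin_le hder hbound
    (Metric.mem_closedBall_self (abs_nonneg _)) (y := t) (by simp [Real.dist_eq])
  have hG0 : G t₀ = 0 := by simp [hG, hW0]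
  rw [hG0, sub_zero, Real.norm_eq_abs] at hmv
  have hpos : 0 < |t - t₀| ^ (j + 1) := by positivity
  have hGt : ((t - t₀) ^ (j + 1))⁻¹ • W t - (j + 1 : ℝ)⁻¹ • f t₀
      = ((t - t₀) ^ (j + 1))⁻¹ • G t := by
    rw [hG, smul_sub, smul_smul, inv_mul_cancel₀ (pow_ne_zero _ htne'), one_smul]
  rw [dist_eq_norm, hGt, norm_smul, norm_inv, norm_pow, Real.norm_eq_abs]
  rw [inv_mul_lt_iff₀ hpos]
  calc ‖G t‖ ≤ |t - t₀| ^ j * (ε / 2) * |t - t₀| := hmv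
    _ = |t - t₀| ^ (j + 1) * (ε / 2) := by ring
    _ < |t - t₀| ^ (j + 1) * ε := by gcongr; linarith

/-- The solution `u` of `((t - t₀) ^ (j + 1) u)' = (t - t₀) ^ j f` that is continuous at `t₀` is the
average `∫₀¹ s ^ j f (t₀ + s (t - t₀)) ds`, hence as regular as `f`: its derivative solves the same
equation with `j + 1` and `f'`. -/
theorem contDiffAt_of_hasDerivAt_pow_smul (m : ℕ) : ∀ (j : ℕ) {u f : ℝ → E},
    (∀ᶠ t in 𝓝 t₀, ContinuousAt u t) →
    (∀ᶠ t in 𝓝 t₀, HasDerivAt (fun t => (t - t₀) ^ (j + 1) • u t) ((t - t₀) ^ j • f t) t) →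
    ContDiffNear t₀ m f → ContDiffAt ℝ m u t₀ := by
  induction m with
  | zero =>
    intro j u f hu _ _
    obtain ⟨s, hs, hso, hst⟩ := eventually_nhds_iff.1 hu
    have : ContDiffOn ℝ (0 : ℕ) u s := by
      exact_mod_cast contDiffOn_zero.2 fun t ht => (hs t ht).continuousWithinAt
    exact (this t₀ hst).contDiffAt (hso.mem_nhds hst)
  | succ m ih =>
    intro j u f hu hd hf
    have hf' : (∀ᶠ t in 𝓝 t₀, DifferentiableAt ℝ f t) ∧ ContDiffNear t₀ m (deriv f) :=
      contDiffNear_succ_iff.1 (by exact_mod_cast hf)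
    obtain ⟨hf1, hf2⟩ := hf'
    -- off `t₀` the function `u` is differentiable and `(t - t₀) u' = f - (j + 1) u`
    have hu1 : ∀ᶠ t in 𝓝 t₀, t ≠ t₀ →
        HasDerivAt u ((t - t₀)⁻¹ • (f t - (j + 1 : ℝ) • u t)) t := by
      filter_upwards [hd] with t ht hne
      have hne' : t - t₀ ≠ 0 := sub_ne_zero.2 hne
      have hU : DifferentiableAt ℝ u t := by
        have h1 : DifferentiableAt ℝ (fun t => ((t - t₀) ^ (j + 1))⁻¹ • ((t - t₀) ^ (j + 1) • u t)) t :=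
          DifferentiableAt.smul (by
            refine DifferentiableAt.inv (by fun_prop) (pow_ne_zero _ hne')) ht.differentiableAt
        refine h1.congr_of_eventuallyEq ?_
        filter_upwards [isOpen_ne.mem_nhds hne] with s hs
        rw [smul_smul, inv_mul_cancel₀ (pow_ne_zero _ (sub_ne_zero.2 hs)), one_smul]
      have h2 := (eventually_hasDerivAt_pow_smul (t₀ := t₀) j hU.hasDerivAt).unique ht
      refine hU.hasDerivAt.congr_deriv ?_
      have h3 : (t - t₀) ^ (j + 1) • deriv u t
          = (t - t₀) ^ j • (f t - (j + 1 : ℝ) • u t) := by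
        rw [smul_sub, smul_smul, ← h2]
        rw [mul_comm ((t - t₀) ^ j)]
        abel
      have h4 : (t - t₀) • deriv u t = f t - (j + 1 : ℝ) • u t := by
        have := congrArg (fun x => ((t - t₀) ^ j)⁻¹ • x) h3
        simpa [smul_smul, pow_succ, ← mul_assoc, inv_mul_cancel₀ (pow_ne_zero j hne')] using this
      rw [← h4, smul_smul, inv_mul_cancel₀ hne', one_smul]
    -- `W = (t - t₀) ^ (j + 1) f - (j + 1) (t - t₀) ^ (j + 1) u` is `(t - t₀) ^ (j + 2) u'`
    set W : ℝ → E := fun t => (t - t₀) ^ (j + 1) • f t - (j + 1 : ℝ) • ((t - t₀) ^ (j + 1) • u t)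
      with hWdef
    have hWd : ∀ᶠ t in 𝓝 t₀, HasDerivAt W ((t - t₀) ^ (j + 1) • deriv f t) t := by
      filter_upwards [hd, hf1] with t ht hft
      refine ((eventually_hasDerivAt_pow_smul (t₀ := t₀) j hft.hasDerivAt).sub
        (ht.const_smul (j + 1 : ℝ))).congr_deriv ?_
      rw [smul_smul]
      abel
    have hlim := tendsto_inv_pow_smul_of_hasDerivAt (j + 1) hf2.continuousAt.self_of_nhds
      (by simp [hWdef]) hWd
    classical
    set w : ℝ → E := fun t => if t = t₀ then ((j + 1 : ℕ) + 1 : ℝ)⁻¹ • deriv f t₀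
      else (t - t₀)⁻¹ • (f t - (j + 1 : ℝ) • u t) with hw
    have hWw : ∀ t, (t - t₀) ^ (j + 1 + 1) • w t = W t := by
      intro t
      by_cases h : t = t₀
      · simp [h, hWdef]
      · have hne' : t - t₀ ≠ 0 := sub_ne_zero.2 h
        simp only [hw, h, if_false, hWdef]
        rw [smul_smul, pow_succ _ (j + 1), mul_assoc, mul_inv_cancel₀ hne', mul_one, smul_sub,
          smul_comm]
    have hwc : ContinuousAt w t₀ := by
      rw [continuousAt_iff_punctured_nhds]
      have : w t₀ = ((j + 1 : ℕ) + 1 : ℝ)⁻¹ • deriv f t₀ := by simp [hw]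
      rw [this]
      refine hlim.congr' ?_
      filter_upwards [self_mem_nhdsWithin] with t ht
      rw [← hWw, smul_smul, inv_mul_cancel₀ (pow_ne_zero _ (sub_ne_zero.2 ht)), one_smul]
    have hwe : ∀ t, t ≠ t₀ → w =ᶠ[𝓝 t] fun t => (t - t₀)⁻¹ • (f t - (j + 1 : ℝ) • u t) := by
      intro t ht
      filter_upwards [isOpen_ne.mem_nhds ht] with s hs
      simp [hw, show s ≠ t₀ from hs]
    have hwc' : ∀ᶠ t in 𝓝 t₀, ContinuousAt w t := by
      filter_upwards [hu, hf1] with t h1 h2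
      by_cases h : t = t₀
      · rw [h]; exact hwc
      · refine ContinuousAt.congr ?_ (hwe t h).symm
        refine ContinuousAt.smul ?_ (h2.continuousAt.sub (h1.const_smul _))
        exact ContinuousAt.inv₀ (by fun_prop) (sub_ne_zero.2 h)
    have hud : ∀ᶠ t in 𝓝 t₀, HasDerivAt u (w t) t := by
      obtain ⟨s, hs, hso, hst⟩ := eventually_nhds_iff.1 (hu1.and hu)
      refine eventually_nhds_iff.2 ⟨s, fun t ht => ?_, hso, hst⟩
      by_cases h : t = t₀
      · rw [h]
        refine hasDerivAt_of_eventually_punctured ?_ (hs t₀ hst).2 hwc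
        filter_upwards [nhdsWithin_le_nhds (hso.mem_nhds hst), self_mem_nhdsWithin] with y hy hne
        simpa [hw, show y ≠ t₀ from hne] using (hs y hy).1 hne
      · simpa [hw, h] using (hs t ht).1 h
    have hwm : ContDiffAt ℝ m w t₀ := by
      refine ih (j + 1) hwc' ?_ hf2
      have : (fun t => (t - t₀) ^ (j + 1 + 1) • w t) = W := funext hWw
      rw [this]
      exact hWd
    rw [show ((m + 1 : ℕ) : WithTop ℕ∞) = (m : WithTop ℕ∞) + 1 by push_cast; rfl,
      contDiffAt_succ_iff_hasFDerivAt]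
    refine ⟨fun t => ContinuousLinearMap.toSpanSingleton ℝ (w t), ?_, ?_⟩
    · exact ⟨_, hud, fun x hx => hx.hasFDerivAt⟩
    · exact (ContinuousLinearMap.toSpanSingletonCLE (𝕜 := ℝ) (E := E)).contDiff.contDiffAt.comp t₀ hwm

/-- Division by `t - t₀`: if `(t - t₀) h` is of class `C^(k + 1)` and `h` is continuous, then `h` is of
class `C^k`. -/
theorem ContDiffNear.of_sub_smul {h : ℝ → E} (hg : ContDiffNear t₀ (k + 1) fun t => (t - t₀) • h t)
    (hh : ContinuousAt h t₀) : ContDiffNear t₀ k h := by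
  obtain ⟨hg1, hg2⟩ := contDiffNear_succ_iff.1 hg
  have hoff : ∀ᶠ t in 𝓝 t₀, t ≠ t₀ → ContDiffAt ℝ k h t := by
    filter_upwards [hg.mono (k' := k) le_self_add] with t ht hne
    have h1 : ContDiffAt ℝ k (fun t => (t - t₀)⁻¹ • ((t - t₀) • h t)) t :=
      ContDiffAt.smul (ContDiffAt.inv (by fun_prop) (sub_ne_zero.2 hne)) ht
    refine h1.congr_of_eventuallyEq ?_
    filter_upwards [isOpen_ne.mem_nhds hne] with s hs
    rw [smul_smul, inv_mul_cancel₀ (sub_ne_zero.2 hs), one_smul]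
  have hc : ∀ᶠ t in 𝓝 t₀, ContinuousAt h t := by
    filter_upwards [hoff] with t ht
    by_cases hne : t = t₀
    · rwa [hne]
    · exact (ht hne).continuousAt
  have hat : ∀ m : ℕ, (m : ℕ∞) ≤ k → ContDiffAt ℝ m h t₀ := by
    intro m hm
    refine contDiffAt_of_hasDerivAt_pow_smul m 0 hc ?_ (hg2.mono hm)
    filter_upwards [hg1] with t ht
    simpa using ht.hasDerivAt
  have hat' : ContDiffAt ℝ k h t₀ := by
    rw [← contDiffWithinAt_univ, contDiffWithinAt_iff_forall_nat_le]
    exact fun m hm => (hat m (by exact_mod_cast hm)).contDiffWithinAt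
  filter_upwards [hoff] with t ht
  by_cases hne : t = t₀
  · rwa [hne]
  · exact ht hne

theorem ContDiffNear.of_pow_smul {h : ℝ → E} (r : ℕ)
    (hg : ContDiffNear t₀ (k + r) fun t => (t - t₀) ^ r • h t)
    (hh : ContinuousAt h t₀) : ContDiffNear t₀ k h := by
  induction r with
  | zero => simpa using hg
  | succ r ih =>
    refine ih (ContDiffNear.of_sub_smul ?_ ?_)
    · exact hg.of_eq (by push_cast; ring) fun t => by rw [smul_smul, pow_succ']
    · exact ContinuousAt.smul (by fun_prop) hh

theorem ContDiffNear.smul {φ : ℝ → ℝ} (hφ : ContDiffNear t₀ k φ) (hf : ContDiffNear t₀ k f) :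
    ContDiffNear t₀ k fun t => φ t • f t := by
  filter_upwards [hφ, hf] with t h1 h2 using h1.smul h2

theorem ContDiffNear.add (hf : ContDiffNear t₀ k f) (hg : ContDiffNear t₀ k g) :
    ContDiffNear t₀ k fun t => f t + g t := by
  filter_upwards [hf, hg] with t h1 h2 using h1.add h2

theorem ContDiffNear.sub (hf : ContDiffNear t₀ k f) (hg : ContDiffNear t₀ k g) :
    ContDiffNear t₀ k fun t => f t - g t := by
  filter_upwards [hf, hg] with t h1 h2 using h1.sub h2

theorem ContDiffNear.const (c : E) : ContDiffNear t₀ k fun _ => c :=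
  Eventually.of_forall fun _ => contDiffAt_const

end Near

/-! ### Functions that become regular after multiplication by a power -/

/-- The Euler operator `(t - t₀) d/dt`. -/
noncomputable def eulerOp {E : Type*} [NormedAddCommGroup E] [NormedSpace ℝ E] (t₀ : ℝ) (f : ℝ → E) :
    ℝ → E :=
  fun t => (t - t₀) • deriv f t

/-- The functions `f` such that `f` and its iterates under the Euler operator, up to the `r`-th one,
are of class `C^k` near `t₀`. By `eulerContDiff_iff` these are the continuous functions `f` with
`(t - t₀) ^ r • f` of class `C^(k + r)`. -/
def EulerContDiff {E : Type*} [NormedAddCommGroup E] [NormedSpace ℝ E] (t₀ : ℝ) (k : ℕ∞) :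
    ℕ → (ℝ → E) → Prop
  | 0, f => ContDiffNear t₀ k f
  | r + 1, f => EulerContDiff t₀ k r f ∧ (∀ᶠ t in 𝓝[≠] t₀, DifferentiableAt ℝ f t) ∧
      EulerContDiff t₀ k r (eulerOp t₀ f)

section Euler

variable {E : Type*} [NormedAddCommGroup E] [NormedSpace ℝ E] {t₀ : ℝ} {k : ℕ∞} {f g : ℝ → E}

theorem eulerOp_congr (h : g =ᶠ[𝓝 t₀] f) : eulerOp t₀ g =ᶠ[𝓝 t₀] eulerOp t₀ f := by
  filter_upwards [h.eventually_nhds] with t ht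
  rw [eulerOp, eulerOp, EventuallyEq.deriv_eq ht]

theorem EulerContDiff.congr {r : ℕ} : ∀ {f g : ℝ → E}, EulerContDiff t₀ k r f →
    g =ᶠ[𝓝 t₀] f → EulerContDiff t₀ k r g := by
  induction r with
  | zero => exact fun hf h => ContDiffNear.congr hf h
  | succ r ih =>
    intro f g hf h
    refine ⟨ih hf.1 h, ?_, ih hf.2.2 (eulerOp_congr h)⟩
    filter_upwards [hf.2.1, nhdsWithin_le_nhds h.eventually_nhds] with t h1 h2
    exact h1.congr_of_eventuallyEq h2

theorem EulerContDiff.mono {r r' : ℕ} {k' : ℕ∞} (hr : r' ≤ r) (hk : k' ≤ k) :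
    ∀ {f : ℝ → E}, EulerContDiff t₀ k r f → EulerContDiff t₀ k' r' f := by
  have key : ∀ (r : ℕ) {f : ℝ → E}, EulerContDiff t₀ k r f → EulerContDiff t₀ k' r f := by
    intro r
    induction r with
    | zero => exact fun hf => ContDiffNear.mono hf hk
    | succ r ih => exact fun hf => ⟨ih hf.1, hf.2.1, ih hf.2.2⟩
  intro f hf
  refine key r' ?_
  clear key
  induction r, hr using Nat.le_induction with
  | base => exact hf
  | succ n _ ih => exact ih hf.1

theorem EulerContDiff.contDiffNear {r : ℕ} (hf : EulerContDiff t₀ k r f) : ContDiffNear t₀ k f :=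
  hf.mono (r' := 0) (Nat.zero_le _) le_rfl

theorem EulerContDiff.continuousAt {r : ℕ} (hf : EulerContDiff t₀ k r f) :
    ∀ᶠ t in 𝓝 t₀, ContinuousAt f t :=
  hf.contDiffNear.continuousAt

theorem ContDiffNear.eulerContDiff {r : ℕ} (hf : ContDiffNear t₀ (k + r) f) :
    EulerContDiff t₀ k r f := by
  induction r generalizing f with
  | zero => simpa [EulerContDiff] using hf
  | succ r ih =>
    have h0 : ContDiffNear t₀ (k + r + 1) f := by convert hf using 1; push_cast; ring
    obtain ⟨h1, h2⟩ := contDiffNear_succ_iff.1 h0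
    exact ⟨ih (h0.mono le_self_add), h1.filter_mono nhdsWithin_le_nhds,
      ih (ContDiffNear.self.smul h2)⟩

theorem EulerContDiff.contDiffNear_pow_smul {r : ℕ} : ∀ {f : ℝ → E}, EulerContDiff t₀ k r f →
    ContDiffNear t₀ (k + r) fun t => (t - t₀) ^ r • f t := by
  induction r with
  | zero => intro f hf; simpa [EulerContDiff] using hf
  | succ r ih =>
    intro f hf
    have hd : ∀ᶠ t in 𝓝 t₀, HasDerivAt (fun t => (t - t₀) ^ (r + 1) • f t)
        ((t - t₀) ^ r • eulerOp t₀ f t + (r + 1 : ℝ) • ((t - t₀) ^ r • f t)) t := by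
      have hoff : ∀ᶠ t in 𝓝[≠] t₀, HasDerivAt (fun t => (t - t₀) ^ (r + 1) • f t)
          ((t - t₀) ^ r • eulerOp t₀ f t + (r + 1 : ℝ) • ((t - t₀) ^ r • f t)) t := by
        filter_upwards [hf.2.1] with t ht
        refine (eventually_hasDerivAt_pow_smul r ht.hasDerivAt).congr_deriv ?_
        rw [eulerOp, smul_smul, smul_smul, pow_succ]
      have hc1 := hf.1.continuousAt.self_of_nhds
      have hc2 := hf.2.2.continuousAt.self_of_nhds
      have hat := hasDerivAt_of_eventually_punctured hoff
        (ContinuousAt.smul (by fun_prop) hc1)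
        (((ContinuousAt.smul (by fun_prop) hc2)).add
          ((ContinuousAt.smul (by fun_prop) hc1).const_smul (r + 1 : ℝ)))
      rw [eventually_nhdsWithin_iff] at hoff
      filter_upwards [hoff] with t ht
      by_cases h : t = t₀
      · rw [h]; exact hat
      · exact ht h
    rw [show k + ((r + 1 : ℕ) : ℕ∞) = k + r + 1 by push_cast; ring, contDiffNear_succ_iff]
    refine ⟨hd.mono fun t ht => ht.differentiableAt, ?_⟩
    refine ((ih hf.2.2).add ((ContDiffNear.const (r + 1 : ℝ)).smul (ih hf.1))).congr ?_
    filter_upwards [hd] with t ht using ht.deriv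

theorem EulerContDiff.of_pow_smul {r : ℕ} : ∀ {f : ℝ → E}, (∀ᶠ t in 𝓝 t₀, ContinuousAt f t) →
    ContDiffNear t₀ (k + r) (fun t => (t - t₀) ^ r • f t) → EulerContDiff t₀ k r f := by
  induction r with
  | zero => intro f _ hf; simpa [EulerContDiff] using hf
  | succ r ih =>
    intro f hc hf
    have hc0 := hc.self_of_nhds
    have hf' : ContDiffNear t₀ (k + r + 1) (fun t => (t - t₀) ^ (r + 1) • f t) := by
      convert hf using 1; push_cast; ring
    -- divide by `t - t₀`, once and `r` times
    have h1 : ContDiffNear t₀ (k + r) (fun t => (t - t₀) ^ r • f t) := by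
      refine ContDiffNear.of_sub_smul ?_ (ContinuousAt.smul (by fun_prop) hc0)
      exact hf'.of_eq rfl fun t => by rw [smul_smul, pow_succ']
    have h2 : ContDiffNear t₀ (k + 1) (fun t => (t - t₀) • f t) := by
      refine ContDiffNear.of_pow_smul r ?_ (ContinuousAt.smul (by fun_prop) hc0)
      exact hf'.of_eq (by ring) fun t => by rw [smul_smul, pow_succ]
    obtain ⟨h3, h4⟩ := contDiffNear_succ_iff.1 h2
    have hd : ∀ᶠ t in 𝓝[≠] t₀, DifferentiableAt ℝ f t := by
      filter_upwards [nhdsWithin_le_nhds h3, self_mem_nhdsWithin] with t ht hne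
      have h5 : DifferentiableAt ℝ (fun t => (t - t₀)⁻¹ • ((t - t₀) • f t)) t :=
        DifferentiableAt.smul (DifferentiableAt.inv (by fun_prop) (sub_ne_zero.2 hne)) ht
      refine h5.congr_of_eventuallyEq ?_
      filter_upwards [isOpen_ne.mem_nhds hne] with s hs
      rw [smul_smul, inv_mul_cancel₀ (sub_ne_zero.2 hs), one_smul]
    -- `eulerOp f = ((t - t₀) f)' - f`
    have hE : eulerOp t₀ f =ᶠ[𝓝 t₀] fun t => deriv (fun t => (t - t₀) • f t) t - f t := by
      have hat : HasDerivAt (fun t => (t - t₀) • f t) (f t₀) t₀ := by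
        refine h3.self_of_nhds.hasDerivAt.congr_deriv ?_
        have h0 : Tendsto (slope (fun t => (t - t₀) • f t) t₀) (𝓝[≠] t₀) (𝓝 (f t₀)) := by
          refine (tendsto_inf_left hc0 : Tendsto f (𝓝[≠] t₀) _).congr' ?_
          filter_upwards [self_mem_nhdsWithin] with t ht
          simp [slope, smul_smul, inv_mul_cancel₀ (sub_ne_zero.2 ht)]
        exact (hasDerivAt_iff_tendsto_slope.2 h0).deriv
      rw [eventually_nhdsWithin_iff] at hd
      filter_upwards [hd] with t ht
      by_cases h : t = t₀
      · rw [h, hat.deriv]; simp [eulerOp]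
      · have := (((hasDerivAt_id t).sub_const t₀).smul (ht h).hasDerivAt).deriv
        simp only [id] at this
        simp only [eulerOp]
        have h6 : (fun t => (t - t₀) • f t) = (fun x => x - t₀) • f := rfl
        rw [h6, this]
        simp
    have hEc : ∀ᶠ t in 𝓝 t₀, ContinuousAt (eulerOp t₀ f) t := by
      filter_upwards [hE.eventually_nhds, h4.continuousAt, hc] with t e1 e2 e3
      exact (e2.sub e3).congr (EventuallyEq.symm e1)
    refine ⟨ih hc h1, hd, ih hEc ?_⟩
    refine ((contDiffNear_succ_iff.1 hf').2.sub ((ContDiffNear.const (r + 1 : ℝ)).smul h1)).congr ?_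
    rw [eventually_nhdsWithin_iff] at hd
    have hcl : ∀ᶠ t in 𝓝[≠] t₀, (t - t₀) ^ r • eulerOp t₀ f t =
        deriv (fun t => (t - t₀) ^ (r + 1) • f t) t - (r + 1 : ℝ) • (t - t₀) ^ r • f t := by
      filter_upwards [nhdsWithin_le_nhds hd, self_mem_nhdsWithin] with t ht hne
      rw [(eventually_hasDerivAt_pow_smul r (ht hne).hasDerivAt).deriv, eulerOp, smul_smul,
        smul_smul, pow_succ]
      abel
    -- both sides are continuous, so the identity extends to `t₀`
    have hL : ContinuousAt (fun t => (t - t₀) ^ r • eulerOp t₀ f t) t₀ :=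
      ContinuousAt.smul (by fun_prop) hEc.self_of_nhds
    have hR : ContinuousAt (fun t => deriv (fun t => (t - t₀) ^ (r + 1) • f t) t
        - (r + 1 : ℝ) • (t - t₀) ^ r • f t) t₀ :=
      (contDiffNear_succ_iff.1 hf').2.continuousAt.self_of_nhds.sub
        ((ContinuousAt.smul (by fun_prop) hc0).const_smul (r + 1 : ℝ))
    have := (ContinuousAt.eventuallyEq_nhds_iff_eventuallyEq_nhdsNE hL hR).1 hcl
    exact this

theorem eulerContDiff_iff {r : ℕ} : EulerContDiff t₀ k r f ↔
    (∀ᶠ t in 𝓝 t₀, ContinuousAt f t) ∧ ContDiffNear t₀ (k + r) fun t => (t - t₀) ^ r • f t :=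
  ⟨fun h => ⟨h.continuousAt, h.contDiffNear_pow_smul⟩, fun h => .of_pow_smul h.1 h.2⟩

/-- Multiplication by `(t - t₀) ^ s` turns `s` Euler derivatives into ordinary ones. -/
theorem EulerContDiff.pow_smul {r s : ℕ} (hf : EulerContDiff t₀ k (r + s) f) :
    EulerContDiff t₀ (k + s) r fun t => (t - t₀) ^ s • f t := by
  obtain ⟨h1, h2⟩ := eulerContDiff_iff.1 hf
  refine eulerContDiff_iff.2 ⟨?_, ?_⟩
  · filter_upwards [h1] with t ht using ContinuousAt.smul (by fun_prop) ht
  · exact h2.of_eq (by push_cast; ring) fun t => by rw [smul_smul, pow_add]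

/-- Division by `(t - t₀) ^ s` turns `s` ordinary derivatives into Euler derivatives. -/
theorem EulerContDiff.of_pow_smul_eulerContDiff {r s : ℕ} (hc : ∀ᶠ t in 𝓝 t₀, ContinuousAt f t)
    (hf : EulerContDiff t₀ (k + s) r fun t => (t - t₀) ^ s • f t) :
    EulerContDiff t₀ k (r + s) f := by
  obtain ⟨_, h2⟩ := eulerContDiff_iff.1 hf
  refine eulerContDiff_iff.2 ⟨hc, ?_⟩
  exact h2.of_eq (by push_cast; ring) fun t => by rw [smul_smul, pow_add]

theorem EulerContDiff.prodMk {F : Type*} [NormedAddCommGroup F] [NormedSpace ℝ F] {r : ℕ} :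
    ∀ {f : ℝ → E} {g : ℝ → F}, EulerContDiff t₀ k r f → EulerContDiff t₀ k r g →
      EulerContDiff t₀ k r fun t => (f t, g t) := by
  induction r with
  | zero =>
    intro f g hf hg
    simp only [EulerContDiff] at hf hg ⊢
    filter_upwards [hf, hg] with t h1 h2 using h1.prodMk h2
  | succ r ih =>
    intro f g hf hg
    refine ⟨ih hf.1 hg.1, ?_, (ih hf.2.2 hg.2.2).congr ?_⟩
    · filter_upwards [hf.2.1, hg.2.1] with t h1 h2 using h1.prodMk h2
    · have h1 := hf.2.1
      have h2 := hg.2.1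
      rw [eventually_nhdsWithin_iff] at h1 h2
      filter_upwards [h1, h2] with t h1 h2
      by_cases h : t = t₀
      · simp [eulerOp, h, Prod.zero_eq_mk]
      · simp only [eulerOp]
        rw [((h1 h).hasDerivAt.prodMk (h2 h).hasDerivAt).deriv]
        rfl

/-- Smooth functions preserve the class: the Euler operator is a derivation. -/
theorem EulerContDiff.comp (r : ℕ) : ∀ {E F : Type u} [NormedAddCommGroup E] [NormedSpace ℝ E]
    [NormedAddCommGroup F] [NormedSpace ℝ F] {φ : E → F} {f : ℝ → E},
    (∀ᶠ x in 𝓝 (f t₀), ContDiffAt ℝ ∞ φ x) → EulerContDiff t₀ k r f →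
      EulerContDiff t₀ k r fun t => φ (f t) := by
  induction r with
  | zero =>
    intro E F _ _ _ _ φ f hφ hf
    have hc := hf.continuousAt.self_of_nhds
    simp only [EulerContDiff] at hf ⊢
    filter_upwards [hf, hc.eventually hφ] with t h1 h2
    exact (h2.of_le (by exact_mod_cast le_top)).comp t h1
  | succ r ih =>
    intro E F _ _ _ _ φ f hφ hf
    have hc := hf.continuousAt.self_of_nhds
    have hφ' := hc.eventually hφ
    have hone : (∞ : WithTop ℕ∞) ≠ 0 := by simp
    refine ⟨ih hφ hf.1, ?_, ?_⟩
    · filter_upwards [hf.2.1, nhdsWithin_le_nhds hφ'] with t h1 h2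
      exact (h2.differentiableAt hone).comp t h1
    · have h0 : eulerOp t₀ f t₀ = 0 := by simp [eulerOp]
      have hΦ : ∀ᶠ x in 𝓝 (f t₀, eulerOp t₀ f t₀),
          ContDiffAt ℝ ∞ (fun x : E × E => fderiv ℝ φ x.1 x.2) x := by
        filter_upwards [continuousAt_fst.eventually hφ] with x hx
        have h3 : ContDiffAt ℝ ∞ (fderiv ℝ φ) x.1 := hx.fderiv_right (by simp)
        exact (h3.comp x contDiffAt_fst).clm_apply contDiffAt_snd
      refine (ih hΦ (hf.1.prodMk hf.2.2)).congr ?_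
      have h1 := hf.2.1
      rw [eventually_nhdsWithin_iff] at h1
      filter_upwards [h1, hφ'] with t h1 h2
      by_cases h : t = t₀
      · simp [eulerOp, h]
      · have := ((h2.differentiableAt hone).hasFDerivAt.comp_hasDerivAt t (h1 h).hasDerivAt).deriv
        simp only [eulerOp]
        rw [map_smul, ← this]
        rfl

theorem EulerContDiff.const (c : E) (r : ℕ) : EulerContDiff t₀ k r fun _ => c :=
  (ContDiffNear.const c).eulerContDiff

end Euler

section EulerAlgebra

variable {E F : Type u} [NormedAddCommGroup E] [NormedSpace ℝ E] [NormedAddCommGroup F]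
  [NormedSpace ℝ F] {t₀ : ℝ} {k : ℕ∞} {r : ℕ}

theorem EulerContDiff.comp_contDiff {φ : E → F} (hφ : ContDiff ℝ ∞ φ) {f : ℝ → E}
    (hf : EulerContDiff t₀ k r f) : EulerContDiff t₀ k r fun t => φ (f t) :=
  EulerContDiff.comp r (Eventually.of_forall fun _ => hφ.contDiffAt) hf

theorem EulerContDiff.clm (L : E →L[ℝ] F) {f : ℝ → E}
    (hf : EulerContDiff t₀ k r f) : EulerContDiff t₀ k r fun t => L (f t) :=
  hf.comp_contDiff L.contDiff

theorem EulerContDiff.add {f g : ℝ → E} (hf : EulerContDiff t₀ k r f)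
    (hg : EulerContDiff t₀ k r g) : EulerContDiff t₀ k r fun t => f t + g t :=
  (hf.prodMk hg).comp_contDiff (φ := fun x : E × E => x.1 + x.2) (by fun_prop)

theorem EulerContDiff.sub {f g : ℝ → E} (hf : EulerContDiff t₀ k r f)
    (hg : EulerContDiff t₀ k r g) : EulerContDiff t₀ k r fun t => f t - g t :=
  (hf.prodMk hg).comp_contDiff (φ := fun x : E × E => x.1 - x.2) (by fun_prop)

theorem EulerContDiff.sum {ι : Type*} (s : Finset ι) {f : ι → ℝ → E}
    (hf : ∀ i ∈ s, EulerContDiff t₀ k r (f i)) :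
    EulerContDiff t₀ k r fun t => ∑ i ∈ s, f i t := by
  classical
  induction s using Finset.induction_on with
  | empty => simpa using EulerContDiff.const (0 : E) r
  | insert a s ha ih =>
    simp only [Finset.sum_insert ha]
    exact (hf a (by simp)).add (ih fun i hi => hf i (by simp [hi]))

theorem EulerContDiff.mul {𝔸 : Type u} [NormedRing 𝔸] [NormedAlgebra ℝ 𝔸] {f g : ℝ → 𝔸}
    (hf : EulerContDiff t₀ k r f) (hg : EulerContDiff t₀ k r g) :
    EulerContDiff t₀ k r fun t => f t * g t :=
  (hf.prodMk hg).comp_contDiff (φ := fun x : 𝔸 × 𝔸 => x.1 * x.2) (contDiff_fst.mul contDiff_snd)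

end EulerAlgebra

/-! ### Regular curves of matrices -/

section EulerMatrix

variable {t₀ : ℝ} {k : ℕ∞} {r : ℕ} {m n l : ℕ}

theorem eulerContDiff_matrix_iff {A : ℝ → Matrix (Fin m) (Fin n) ℂ} :
    EulerContDiff t₀ k r A ↔ ∀ i j, EulerContDiff t₀ k r fun t => A t i j := by
  constructor
  · intro h i j
    exact h.clm (LinearMap.toContinuousLinearMap (Matrix.entryLinearMap ℝ ℂ i j))
  · intro h
    have : EulerContDiff t₀ k r fun t => ∑ i, ∑ j, Matrix.single i j (A t i j) := by
      refine EulerContDiff.sum _ fun i _ => EulerContDiff.sum _ fun j _ => ?_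
      exact (h i j).clm (LinearMap.toContinuousLinearMap (Matrix.singleLinearMap ℝ i j))
    refine this.congr (Eventually.of_forall fun t => ?_)
    exact Matrix.matrix_eq_sum_single (A t)

theorem EulerContDiff.matrix_mul {A : ℝ → Matrix (Fin m) (Fin n) ℂ}
    {B : ℝ → Matrix (Fin n) (Fin l) ℂ} (hA : EulerContDiff t₀ k r A)
    (hB : EulerContDiff t₀ k r B) : EulerContDiff t₀ k r fun t => A t * B t := by
  rw [eulerContDiff_matrix_iff] at hA hB ⊢
  intro i j
  simp only [Matrix.mul_apply]
  exact EulerContDiff.sum _ fun x _ => (hA i x).mul (hB x j)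

theorem EulerContDiff.conjTranspose {A : ℝ → Matrix (Fin m) (Fin n) ℂ}
    (hA : EulerContDiff t₀ k r A) : EulerContDiff t₀ k r fun t => (A t).conjTranspose := by
  rw [eulerContDiff_matrix_iff] at hA ⊢
  exact fun i j => (hA j i).clm (Complex.conjCLE : ℂ →L[ℝ] ℂ)

theorem EulerContDiff.trace {A : ℝ → Matrix (Fin n) (Fin n) ℂ}
    (hA : EulerContDiff t₀ k r A) : EulerContDiff t₀ k r fun t => (A t).trace := by
  rw [eulerContDiff_matrix_iff] at hA
  exact EulerContDiff.sum _ fun i _ => hA i i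

theorem continuousAt_matrix_iff {A : ℝ → Matrix (Fin m) (Fin n) ℂ} {t : ℝ} :
    ContinuousAt A t ↔ ∀ i j, ContinuousAt (fun t => A t i j) t := by
  exact (tendsto_pi_nhds (f := A)).trans
    (forall_congr' fun i => tendsto_pi_nhds (f := fun t => A t i))

end EulerMatrix

/-! ### Inverse square roots and idempotents near a given one -/

section SquareRoot

variable {𝔸 : Type*} [NormedRing 𝔸]

/-- The Sylvester operator `Y ↦ a Y + Y b` is injective for `a` and `b` close to `1`. -/
theorem eq_zero_of_mul_add_mul_eq_zero [NormedAlgebra ℝ 𝔸] {a b y : 𝔸} (ha : ‖a - 1‖ < 1)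
    (hb : ‖b - 1‖ < 1) (h : a * y + y * b = 0) : y = 0 := by
  have h1 : (2 : ℝ) • y = -((a - 1) * y + y * (b - 1)) := by
    rw [two_smul, eq_neg_iff_add_eq_zero, ← h]
    noncomm_ring
  have h2 : 2 * ‖y‖ ≤ (‖a - 1‖ + ‖b - 1‖) * ‖y‖ := by
    calc 2 * ‖y‖ = ‖(2 : ℝ) • y‖ := by rw [norm_smul]; norm_num
      _ = ‖(a - 1) * y + y * (b - 1)‖ := by rw [h1, norm_neg]
      _ ≤ ‖a - 1‖ * ‖y‖ + ‖y‖ * ‖b - 1‖ :=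
        (norm_add_le _ _).trans (add_le_add (norm_mul_le _ _) (norm_mul_le _ _))
      _ = _ := by ring
  by_contra hy
  have : 0 < ‖y‖ := norm_pos_iff.2 hy
  nlinarith

theorem eq_zero_of_mul_self_of_norm_lt_one {e : 𝔸} (he : e * e = e) (h : ‖e‖ < 1) : e = 0 := by
  by_contra hne
  have h0 : 0 < ‖e‖ := norm_pos_iff.2 hne
  have h1 : ‖e‖ ≤ ‖e‖ * ‖e‖ := by
    calc ‖e‖ = ‖e * e‖ := by rw [he]
      _ ≤ _ := norm_mul_le _ _
  nlinarith

theorem eq_of_commute_of_norm_sub_lt_one {e f : 𝔸} (he : e * e = e) (hf : f * f = f)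
    (hc : e * f = f * e) (h : ‖e - f‖ < 1) : e = f := by
  -- `(e - f) ^ 2` is idempotent
  set d := (e - f) with hd
  have h2 : d * d = e + f - (e * f + e * f) := by
    rw [hd, sub_mul, mul_sub, mul_sub, he, hf, ← hc]; abel
  have h3 : d * d * d = d := by
    rw [h2, hd]
    have e1 : e * f * e = e * f := by rw [mul_assoc, ← hc, ← mul_assoc, he]
    have e2 : e * f * f = e * f := by rw [mul_assoc, hf]
    rw [sub_mul, add_mul, add_mul, mul_sub, mul_sub, mul_sub, he, hf, ← hc, e1, e2]
    abel
  have h4 : d = 0 := by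
    by_contra hne
    have h0 : 0 < ‖d‖ := norm_pos_iff.2 hne
    have h1 : ‖d‖ ≤ ‖d‖ * ‖d‖ * ‖d‖ := by
      calc ‖d‖ = ‖d * d * d‖ := by rw [h3]
        _ ≤ ‖d * d‖ * ‖d‖ := norm_mul_le _ _
        _ ≤ _ := by gcongr; exact norm_mul_le _ _
    have h5 : ‖d‖ * ‖d‖ < 1 := by nlinarith
    nlinarith
  exact sub_eq_zero.1 h4

variable [NormedAlgebra ℝ 𝔸] [CompleteSpace 𝔸]

/-- A smooth square root near `1`, from the inverse function theorem. -/
theorem exists_contDiffAt_sqrt : ∃ R : 𝔸 → 𝔸, R 1 = 1 ∧ (∀ᶠ x in 𝓝 1, R x * R x = x) ∧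
    ContDiffAt ℝ ω R 1 := by
  have hs : ContDiffAt ℝ ω (fun x : 𝔸 => x * x) 1 := contDiffAt_id.mul contDiffAt_id
  let e : 𝔸 ≃L[ℝ] 𝔸 := ContinuousLinearEquiv.smulLeft (Units.mk0 (2 : ℝ) two_ne_zero)
  have hd : HasFDerivAt (fun x : 𝔸 => x * x) (e : 𝔸 →L[ℝ] 𝔸) 1 := by
    refine ((hasFDerivAt_id (𝕜 := ℝ) (1 : 𝔸)).mul' (hasFDerivAt_id (1 : 𝔸))).congr_fderiv ?_
    ext y
    simp [e, two_smul, Units.smul_def]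
  have hne : (ω : WithTop ℕ∞) ≠ 0 := by simp
  refine ⟨hs.localInverse hd hne, ?_, ?_, ?_⟩
  · have := hs.localInverse_apply_image hd hne
    simpa using this
  · have := (hs.hasStrictFDerivAt' hd hne).eventually_right_inverse
    rw [mul_one] at this
    exact this
  · have := hs.to_localInverse hd hne
    simpa using this

/-- A smooth inverse square root near `1` that commutes with everything its argument commutes
with. -/
theorem exists_contDiffAt_invSqrt : ∃ S : 𝔸 → 𝔸, S 1 = 1 ∧ (∀ᶠ x in 𝓝 1, ContDiffAt ℝ ∞ S x) ∧
    ∀ᶠ x in 𝓝 1, ‖S x - 1‖ < 1 ∧ S x * S x * x = 1 ∧ x * (S x * S x) = 1 ∧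
      ∀ z, z * x = x * z → z * S x = S x * z := by
  obtain ⟨R, hR1, hR2, hR3⟩ := exists_contDiffAt_sqrt (𝔸 := 𝔸)
  have hinv : ContDiffAt ℝ ω (Ring.inverse : 𝔸 → 𝔸) 1 := by
    simpa using contDiffAt_ringInverse ℝ (1 : 𝔸ˣ)
  have hS : ContDiffAt ℝ ω (fun x => R (Ring.inverse x)) (1 : 𝔸) := by
    refine ContDiffAt.comp (1 : 𝔸) ?_ hinv
    simpa using hR3
  have hI : Tendsto (Ring.inverse : 𝔸 → 𝔸) (𝓝 1) (𝓝 1) := by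
    have := hinv.continuousAt.tendsto
    simpa using this
  refine ⟨fun x => R (Ring.inverse x), by simpa using hR1, ?_, ?_⟩
  · filter_upwards [hS.eventually (by simp)] with x hx using hx.of_le le_top
  · have hn : ∀ᶠ x in 𝓝 (1 : 𝔸), ‖R (Ring.inverse x) - 1‖ < 1 := by
      have h1 : Tendsto (fun x : 𝔸 => R (Ring.inverse x)) (𝓝 1) (𝓝 1) := by
        have := hS.continuousAt.tendsto
        simpa [hR1] using this
      have := (h1.sub_const 1).norm
      simp only [sub_self, norm_zero] at this
      exact this.eventually (gt_mem_nhds one_pos)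
    have hu : ∀ᶠ x in 𝓝 (1 : 𝔸), IsUnit x := by
      exact Units.nhds (1 : 𝔸ˣ)
    filter_upwards [hn, hu, hI.eventually hR2] with x h1 h2 h3
    refine ⟨h1, ?_, ?_, ?_⟩
    · rw [h3, Ring.inverse_mul_cancel _ h2]
    · rw [h3, Ring.mul_inverse_cancel _ h2]
    · intro z hz
      have hz' : z * Ring.inverse x = Ring.inverse x * z := by
        calc z * Ring.inverse x = Ring.inverse x * x * z * Ring.inverse x := by
              rw [Ring.inverse_mul_cancel _ h2, one_mul]
          _ = Ring.inverse x * (z * x) * Ring.inverse x := by rw [hz]; noncomm_ring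
          _ = Ring.inverse x * z * (x * Ring.inverse x) := by noncomm_ring
          _ = _ := by rw [Ring.mul_inverse_cancel _ h2, mul_one]
      set s := R (Ring.inverse x)
      rw [← h3] at hz'
      refine sub_eq_zero.1 (eq_zero_of_mul_add_mul_eq_zero h1 h1 ?_)
      calc s * (z * s - s * z) + (z * s - s * z) * s = z * (s * s) - s * s * z := by noncomm_ring
        _ = 0 := by rw [hz', sub_self]

/-- A smooth retraction of a neighborhood of an idempotent onto idempotents, which commutes with
everything its argument commutes with: apply the sign function to `2 x - 1`. -/
theorem exists_contDiffAt_idempotent {e : 𝔸} (he : e * e = e) : ∃ φ : 𝔸 → 𝔸, φ e = e ∧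
    (∀ᶠ x in 𝓝 e, ContDiffAt ℝ ∞ φ x) ∧
    ∀ᶠ x in 𝓝 e, φ x * φ x = φ x ∧ ∀ z, z * x = x * z → z * φ x = φ x * z := by
  obtain ⟨S, hS1, hS2, hS3⟩ := exists_contDiffAt_invSqrt (𝔸 := 𝔸)
  let q : 𝔸 → 𝔸 := fun x => (2 : ℝ) • x - 1
  have hq : ContDiff ℝ ∞ q := by fun_prop
  have hqq : ContDiff ℝ ∞ fun x => q x * q x := hq.mul hq
  have hqe : q e * q e = 1 := by
    simp only [q, two_smul]
    have : (e + e - 1) * (e + e - 1) = 4 • (e * e) - 4 • e + 1 := by noncomm_ring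
    rw [this, he]; simp
  have ht : Tendsto (fun x => q x * q x) (𝓝 e) (𝓝 1) := by
    have := hqq.continuous.tendsto e
    rwa [hqe] at this
  refine ⟨fun x => (2 : ℝ)⁻¹ • (1 + q x * S (q x * q x)), ?_, ?_, ?_⟩
  · simp only [hqe, hS1, mul_one]
    simp only [q]
    rw [add_sub_cancel, smul_smul]
    norm_num
  · filter_upwards [ht.eventually hS2] with x hx
    have h1 : ContDiffAt ℝ ∞ (fun x => S (q x * q x)) x := hx.comp x hqq.contDiffAt
    exact (contDiffAt_const.add (hq.contDiffAt.mul h1)).const_smul _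
  · filter_upwards [ht.eventually hS3] with x hx
    obtain ⟨-, h1, -, h3⟩ := hx
    have hc : ∀ z, z * x = x * z → z * (q x * S (q x * q x)) = q x * S (q x * q x) * z := by
      intro z hz
      have hz1 : z * q x = q x * z := by
        simp only [q]
        rw [mul_sub, sub_mul, mul_smul_comm, smul_mul_assoc, hz, mul_one, one_mul]
      have hz2 : z * (q x * q x) = q x * q x * z := by
        rw [← mul_assoc, hz1, mul_assoc, hz1, mul_assoc]
      rw [← mul_assoc, hz1, mul_assoc, h3 z hz2, mul_assoc]
    constructor
    · have hqS : q x * S (q x * q x) = S (q x * q x) * q x := h3 _ (by rw [mul_assoc])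
      set s := S (q x * q x)
      have hsq : q x * s * (q x * s) = 1 := by
        calc q x * s * (q x * s) = s * (q x * s) * q x := by
              nth_rewrite 1 [hqS]; rw [mul_assoc, mul_assoc, mul_assoc, ← hqS]
          _ = s * s * (q x * q x) := by rw [hqS]; simp only [mul_assoc]
          _ = 1 := h1
      rw [smul_mul_smul_comm]
      have : (1 + q x * s) * (1 + q x * s) = (2 : ℝ) • (1 + q x * s) := by
        rw [add_mul, one_mul, mul_add, mul_one, hsq, two_smul, add_comm (q x * s) 1]
      rw [this, smul_smul]
      norm_num
    · intro z hz
      rw [mul_smul_comm, smul_mul_assoc, mul_add, add_mul, mul_one, one_mul, hc z hz]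

end SquareRoot

section Projections

variable {t₀ : ℝ} {k : ℕ∞} {r : ℕ} {m n : ℕ}

/-- A continuous family of idempotents commuting with `A` that is a polynomial in `A` at `t₀` is as
regular as `A`. -/
theorem EulerContDiff.of_idempotent {A P : ℝ → Matrix (Fin n) (Fin n) ℂ} (p : ℂ[X])
    (hA : EulerContDiff t₀ k r A) (hPc : ContinuousAt P t₀)
    (hP : ∀ᶠ t in 𝓝 t₀, P t * P t = P t) (hPA : ∀ᶠ t in 𝓝 t₀, P t * A t = A t * P t)
    (hp : P t₀ = aeval (A t₀) p) : EulerContDiff t₀ k r P := by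
  have hQc : ContDiff ℝ ∞ fun M : Matrix (Fin n) (Fin n) ℂ => aeval M p := by
    simp only [aeval_eq_sum_range]
    refine ContDiff.sum fun i _ => ?_
    have : ContDiff ℝ ∞ fun M : Matrix (Fin n) (Fin n) ℂ => M ^ i := contDiff_id.pow i
    exact this.const_smul (p.coeff i)
  have hQ : EulerContDiff t₀ k r fun t => aeval (A t) p := hA.comp_contDiff hQc
  obtain ⟨φ, h1, h2, h3⟩ := exists_contDiffAt_idempotent hP.self_of_nhds
  have hQt : Tendsto (fun t => aeval (A t) p) (𝓝 t₀) (𝓝 (P t₀)) := by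
    rw [hp]; exact hQ.continuousAt.self_of_nhds
  have hφ : EulerContDiff t₀ k r fun t => φ (aeval (A t) p) := by
    refine EulerContDiff.comp r ?_ hQ
    rw [← hp]; exact h2
  have hclose : ∀ᶠ t in 𝓝 t₀, ‖P t - φ (aeval (A t) p)‖ < 1 := by
    have : Tendsto (fun t => ‖P t - φ (aeval (A t) p)‖) (𝓝 t₀) (𝓝 ‖P t₀ - φ (aeval (A t₀) p)‖) :=
      (hPc.sub hφ.continuousAt.self_of_nhds).norm.tendsto
    rw [← hp, h1, sub_self, norm_zero] at this
    exact this.eventually (gt_mem_nhds one_pos)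
  refine hφ.congr ?_
  filter_upwards [hP, hPA, hQt.eventually h3, hclose] with t e1 e2 e3 e4
  refine eq_of_commute_of_norm_sub_lt_one e1 e3.1 (e3.2 _ ?_) e4
  rw [aeval_eq_sum_range, Finset.mul_sum, Finset.sum_mul]
  exact Finset.sum_congr rfl fun i _ => ((show Commute (P t) (A t) from e2).pow_right i).smul_right _

/-- An orthonormal frame, as regular as `P`, of the bundle of ranges of the orthogonal
projections `P`. -/
theorem EulerContDiff.exists_frame {P : ℝ → Matrix (Fin n) (Fin n) ℂ}
    (hP : EulerContDiff t₀ k r P) (hP2 : ∀ᶠ t in 𝓝 t₀, P t * P t = P t)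
    (hPs : ∀ᶠ t in 𝓝 t₀, (P t).conjTranspose = P t) (G : Matrix (Fin n) (Fin m) ℂ)
    (hG : G.conjTranspose * G = 1) (hPG : P t₀ * G = G) :
    ∃ F : ℝ → Matrix (Fin n) (Fin m) ℂ, EulerContDiff t₀ k r F ∧
      ∀ᶠ t in 𝓝 t₀, (F t).conjTranspose * F t = 1 ∧ P t * F t = F t := by
  obtain ⟨S, hS1, hS2, hS3⟩ := exists_contDiffAt_invSqrt (𝔸 := Matrix (Fin m) (Fin m) ℂ)
  have hGc : EulerContDiff t₀ k r fun _ => G := EulerContDiff.const G r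
  have hx : EulerContDiff t₀ k r fun t => G.conjTranspose * (P t * G) :=
    hGc.conjTranspose.matrix_mul (hP.matrix_mul hGc)
  have hx0 : G.conjTranspose * (P t₀ * G) = 1 := by rw [hPG, hG]
  have hxt : Tendsto (fun t => G.conjTranspose * (P t * G)) (𝓝 t₀) (𝓝 1) := by
    have := hx.continuousAt.self_of_nhds.tendsto
    rwa [hx0] at this
  have hSx : EulerContDiff t₀ k r fun t => S (G.conjTranspose * (P t * G)) := by
    refine EulerContDiff.comp r ?_ hx
    rw [hx0]; exact hS2
  have hclose : ∀ᶠ t in 𝓝 t₀, ‖(S (G.conjTranspose * (P t * G))).conjTranspose - 1‖ < 1 := by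
    have : Tendsto (fun t => ‖(S (G.conjTranspose * (P t * G))).conjTranspose - 1‖) (𝓝 t₀)
        (𝓝 ‖(S (G.conjTranspose * (P t₀ * G))).conjTranspose - 1‖) :=
      (hSx.conjTranspose.continuousAt.self_of_nhds.sub
        (continuousAt_const (y := (1 : Matrix (Fin m) (Fin m) ℂ)))).norm.tendsto
    rw [hx0, hS1, Matrix.conjTranspose_one, sub_self, norm_zero] at this
    exact this.eventually (gt_mem_nhds one_pos)
  refine ⟨fun t => P t * G * S (G.conjTranspose * (P t * G)),
    (hP.matrix_mul hGc).matrix_mul hSx, ?_⟩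
  filter_upwards [hP2, hPs, hxt.eventually hS3, hclose] with t h1 h2 h3 h4
  obtain ⟨h5, h6, h7, h8⟩ := h3
  set x := G.conjTranspose * (P t * G) with hxdef
  have hxs : x.conjTranspose = x := by
    rw [hxdef, Matrix.conjTranspose_mul, Matrix.conjTranspose_mul, h2,
      Matrix.conjTranspose_conjTranspose, Matrix.mul_assoc]
  set s := S x
  -- the inverse square root of a self-adjoint matrix is self-adjoint, by uniqueness
  have hss : s.conjTranspose = s := by
    have e1 : s.conjTranspose * s.conjTranspose = s * s := by
      have e2 : x * (s.conjTranspose * s.conjTranspose) = 1 := by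
        have := congrArg Matrix.conjTranspose h6
        rwa [Matrix.conjTranspose_mul (s * s) x, Matrix.conjTranspose_mul s s, hxs,
          Matrix.conjTranspose_one] at this
      calc s.conjTranspose * s.conjTranspose
          = s * s * x * (s.conjTranspose * s.conjTranspose) := by rw [h6, Matrix.one_mul]
        _ = s * s * (x * (s.conjTranspose * s.conjTranspose)) := by rw [Matrix.mul_assoc]
        _ = s * s := by rw [e2, Matrix.mul_one]
    refine sub_eq_zero.1 (eq_zero_of_mul_add_mul_eq_zero h4 h5 ?_)
    calc s.conjTranspose * (s.conjTranspose - s) + (s.conjTranspose - s) * s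
        = s.conjTranspose * s.conjTranspose - s * s := by noncomm_ring
      _ = 0 := by rw [e1, sub_self]
  have hsx : x * s = s * x := h8 x rfl
  constructor
  · calc (P t * G * s).conjTranspose * (P t * G * s)
        = s * (G.conjTranspose * ((P t * P t) * G)) * s := by
          rw [Matrix.conjTranspose_mul, Matrix.conjTranspose_mul, h2, hss]
          simp only [Matrix.mul_assoc]
      _ = s * x * s := by rw [h1]
      _ = s * s * x := by rw [Matrix.mul_assoc, hsx, Matrix.mul_assoc]
      _ = 1 := h6
  · rw [← Matrix.mul_assoc, ← Matrix.mul_assoc, h1]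

end Projections

/-! ### Normal matrices -/

section Normal

open scoped ComplexOrder

variable {m n : ℕ} {M : Matrix (Fin n) (Fin n) ℂ}

theorem mem_spectrum_iff_exists_mulVec {z : ℂ} :
    z ∈ spectrum ℂ M ↔ ∃ x : Fin n → ℂ, x ≠ 0 ∧ M *ᵥ x = z • x := by
  rw [← Matrix.spectrum_toLin', ← Module.End.hasEigenvalue_iff_mem_spectrum]
  constructor
  · intro h
    obtain ⟨x, hx⟩ := h.exists_hasEigenvector
    exact ⟨x, hx.2, by simpa using hx.apply_eq_smul⟩
  · rintro ⟨x, hx, h⟩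
    exact Module.End.hasEigenvalue_of_hasEigenvector
      (x := x) ⟨Module.End.mem_eigenspace_iff.2 (by simpa using h), hx⟩

/-- An eigenvector of a normal matrix is an eigenvector of the adjoint. -/
theorem conjTranspose_mulVec_of_normal (hM : M * Mᴴ = Mᴴ * M) {z : ℂ} {x : Fin n → ℂ}
    (hx : M *ᵥ x = z • x) : Mᴴ *ᵥ x = star z • x := by
  set N : Matrix (Fin n) (Fin n) ℂ := M - z • 1 with hN
  have hNs : Nᴴ = Mᴴ - star z • 1 := by
    rw [hN, Matrix.conjTranspose_sub, Matrix.conjTranspose_smul, Matrix.conjTranspose_one]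
  have hNN : N * Nᴴ = Nᴴ * N := by
    rw [hNs, hN]
    simp only [sub_mul, mul_sub, hM, smul_mul_assoc, mul_smul_comm, one_mul, mul_one, smul_sub]
    rw [smul_comm z (star z)]
    abel
  have h0 : N *ᵥ x = 0 := by
    rw [hN, Matrix.sub_mulVec, Matrix.smul_mulVec, Matrix.one_mulVec, hx, sub_self]
  have h1 : Nᴴ *ᵥ x = 0 := by
    rw [← dotProduct_star_self_eq_zero, Matrix.star_mulVec,
      Matrix.conjTranspose_conjTranspose, ← Matrix.dotProduct_mulVec, Matrix.mulVec_mulVec, hNN,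
      ← Matrix.mulVec_mulVec, h0, Matrix.mulVec_zero, dotProduct_zero]
  rw [hNs, Matrix.sub_mulVec, Matrix.smul_mulVec, Matrix.one_mulVec, sub_eq_zero] at h1
  exact h1

theorem star_dotProduct_eq_zero_of_normal (hM : M * Mᴴ = Mᴴ * M) {z w : ℂ} {x y : Fin n → ℂ}
    (hx : M *ᵥ x = z • x) (hy : M *ᵥ y = w • y) (hzw : z ≠ w) : star x ⬝ᵥ y = 0 := by
  have h1 : star x ⬝ᵥ (M *ᵥ y) = w * (star x ⬝ᵥ y) := by
    rw [hy, dotProduct_smul, smul_eq_mul]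
  have h2 : star x ⬝ᵥ (M *ᵥ y) = z * (star x ⬝ᵥ y) := by
    have h3 : star x ᵥ* M = z • star x := by
      have := congrArg star (conjTranspose_mulVec_of_normal hM hx)
      rw [Matrix.star_mulVec, Matrix.conjTranspose_conjTranspose] at this
      rw [this]
      ext i
      simp
    rw [Matrix.dotProduct_mulVec, h3, smul_dotProduct, smul_eq_mul]
  have h4 : (z - w) * (star x ⬝ᵥ y) = 0 := by rw [sub_mul, ← h1, ← h2, sub_self]
  exact (mul_eq_zero.1 h4).resolve_left (sub_ne_zero.2 hzw)

theorem star_dotProduct_comm_eq_zero {x y : Fin n → ℂ} (h : star x ⬝ᵥ y = 0) :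
    star y ⬝ᵥ x = 0 := by
  have := congrArg star h
  rwa [Matrix.star_dotProduct, star_star, star_zero] at this

theorem iSup_eigenspace_toEuclideanLin_of_normal (hM : M * Mᴴ = Mᴴ * M) :
    ⨆ z, Module.End.eigenspace (Matrix.toEuclideanLin M) z = ⊤ := by
  set H : Matrix (Fin n) (Fin n) ℂ := (1 / 2 : ℂ) • (M + Mᴴ) with hH
  set K : Matrix (Fin n) (Fin n) ℂ := (Complex.I / 2) • (Mᴴ - M) with hK
  have hHs : H.IsHermitian := by
    rw [Matrix.IsHermitian, hH, Matrix.conjTranspose_smul, Matrix.conjTranspose_add,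
      Matrix.conjTranspose_conjTranspose, add_comm]
    congr 1
    simp
  have hKs : K.IsHermitian := by
    rw [Matrix.IsHermitian, hK, Matrix.conjTranspose_smul, Matrix.conjTranspose_sub,
      Matrix.conjTranspose_conjTranspose, ← neg_sub Mᴴ M, smul_neg, ← neg_smul]
    congr 1
    simp [neg_div]
  have hMHK : M = H + Complex.I • K := by
    rw [hH, hK, smul_smul, show Complex.I * (Complex.I / 2) = -(1 / 2) by
      rw [← mul_div_assoc, Complex.I_mul_I]; ring]
    module
  have hcomm : H * K = K * H := by
    rw [hH, hK, smul_mul_smul_comm, smul_mul_smul_comm, mul_comm (1 / 2 : ℂ)]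
    congr 1
    simp only [add_mul, mul_add, sub_mul, mul_sub, hM]
    abel
  have h1 := Matrix.isSymmetric_toEuclideanLin_iff.2 hHs
  have h2 := Matrix.isSymmetric_toEuclideanLin_iff.2 hKs
  have hc : Commute (Matrix.toEuclideanLin H) (Matrix.toEuclideanLin K) := by
    refine LinearMap.ext fun x => ?_
    apply (WithLp.ofLp_injective 2)
    simp [Matrix.toLpLin_apply, hcomm]
  have h3 := LinearMap.IsSymmetric.iSup_iSup_eigenspace_inf_eigenspace_eq_top_of_commute h1 h2 hc
  rw [eq_top_iff, ← h3]
  refine iSup_le fun α => iSup_le fun γ => ?_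
  refine le_trans ?_ (le_iSup _ (α + Complex.I * γ))
  rintro x ⟨hx1, hx2⟩
  have e1 := Module.End.mem_eigenspace_iff.1 hx1
  have e2 := Module.End.mem_eigenspace_iff.1 hx2
  have e3 : Matrix.toEuclideanLin M = Matrix.toEuclideanLin H + Complex.I • Matrix.toEuclideanLin K := by
    rw [← map_smul, ← map_add, ← hMHK]
  rw [Module.End.mem_eigenspace_iff, e3, LinearMap.add_apply, LinearMap.smul_apply, e1, e2,
    smul_smul, add_smul]

/-- The spectral theorem for normal matrices. -/
theorem exists_unitary_diagonal_of_normal (hM : M * Mᴴ = Mᴴ * M) :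
    ∃ (W : Matrix (Fin n) (Fin n) ℂ) (d : Fin n → ℂ), Wᴴ * W = 1 ∧ W * Wᴴ = 1 ∧
      M * W = W * Matrix.diagonal d := by
  classical
  set T : Module.End ℂ (EuclideanSpace ℂ (Fin n)) := Matrix.toEuclideanLin M with hT
  have hTx : ∀ z x, x ∈ Module.End.eigenspace T z → M *ᵥ x.ofLp = z • x.ofLp := by
    intro z x hx
    have := congrArg WithLp.ofLp (Module.End.mem_eigenspace_iff.1 hx)
    simpa [hT, Matrix.toLpLin_apply] using this
  have horth : OrthogonalFamily ℂ (fun μ : T.Eigenvalues => Module.End.eigenspace T (μ : ℂ))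
      fun μ => (Module.End.eigenspace T (μ : ℂ)).subtypeₗᵢ := by
    intro μ μ' hne x y
    have h0 := star_dotProduct_eq_zero_of_normal hM (hTx _ _ x.2) (hTx _ _ y.2)
      (fun h => hne (Subtype.ext h))
    simpa [EuclideanSpace.inner_eq_star_dotProduct, dotProduct_comm] using h0
  have hint : DirectSum.IsInternal fun μ : T.Eigenvalues => Module.End.eigenspace T (μ : ℂ) := by
    rw [horth.isInternal_iff, Submodule.orthogonal_eq_bot_iff, eq_top_iff,
      ← iSup_eigenspace_toEuclideanLin_of_normal hM]
    refine iSup_le fun z => ?_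
    by_cases hz : T.HasEigenvalue z
    · exact le_iSup (fun μ : T.Eigenvalues => Module.End.eigenspace T (μ : ℂ)) ⟨z, hz⟩
    · have : Module.End.eigenspace T z = ⊥ := by
        by_contra h; exact hz (Module.End.hasEigenvalue_iff.2 h)
      rw [← hT, this]; exact bot_le
  have hn : Module.finrank ℂ (EuclideanSpace ℂ (Fin n)) = n := by simp
  set b := hint.subordinateOrthonormalBasis hn horth with hb
  set W : Matrix (Fin n) (Fin n) ℂ := Matrix.of fun i j => b j i with hW
  have hWW : Wᴴ * W = 1 := by
    ext i j
    have := orthonormal_iff_ite.1 b.orthonormal i j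
    rw [EuclideanSpace.inner_eq_star_dotProduct] at this
    rw [Matrix.mul_apply, Matrix.one_apply, ← this]
    simp [hW, dotProduct, mul_comm]
  let c : Fin n → T.Eigenvalues := fun a => hint.subordinateOrthonormalBasisIndex hn a horth
  refine ⟨W, fun a => (c a : ℂ), hWW, mul_eq_one_comm.1 hWW, ?_⟩
  ext i j
  have h1 := hTx _ _ (hint.subordinateOrthonormalBasis_subordinate hn j horth)
  have h2 := congrFun h1 i
  rw [Matrix.mul_diagonal, Matrix.mul_apply]
  simpa [Matrix.mulVec, dotProduct, hW, mul_comm] using h2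

theorem iSup_eigenspace_toLin'_of_normal (hM : M * Mᴴ = Mᴴ * M) :
    ⨆ z, Module.End.eigenspace (Matrix.toLin' M) z = ⊤ := by
  obtain ⟨W, d, h1, h2, h3⟩ := exists_unitary_diagonal_of_normal hM
  rw [eq_top_iff]
  intro x _
  have hx : x = ∑ j, (Wᴴ *ᵥ x) j • fun i => W i j := by
    have : x = W *ᵥ (Wᴴ *ᵥ x) := by rw [Matrix.mulVec_mulVec, h2, Matrix.one_mulVec]
    conv_lhs => rw [this]
    ext i
    simp [Matrix.mulVec, dotProduct, mul_comm]
  rw [hx]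
  refine Submodule.sum_mem _ fun j _ => Submodule.smul_mem _ _ ?_
  refine Submodule.mem_iSup_of_mem (d j) (Module.End.mem_eigenspace_iff.2 ?_)
  ext i
  have := congrFun (congrFun h3 i) j
  rw [Matrix.mul_diagonal, Matrix.mul_apply] at this
  simpa [Matrix.mulVec, dotProduct, mul_comm] using this

theorem eq_smul_one_of_normal_of_spectrum_subset (hM : M * Mᴴ = Mᴴ * M) {c : ℂ}
    (h : spectrum ℂ M ⊆ {c}) : M = c • 1 := by
  obtain ⟨W, d, h1, h2, h3⟩ := exists_unitary_diagonal_of_normal hM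
  have hd : d = fun _ => c := by
    ext j
    refine h (mem_spectrum_iff_exists_mulVec.2 ⟨fun i => W i j, ?_, ?_⟩)
    · intro h0
      have := congrFun (congrFun h1 j) j
      rw [Matrix.mul_apply, Matrix.one_apply_eq] at this
      simp [fun i => congrFun h0 i] at this
    · ext i
      have := congrFun (congrFun h3 i) j
      rw [Matrix.mul_diagonal, Matrix.mul_apply] at this
      simpa [Matrix.mulVec, dotProduct, mul_comm] using this
  calc M = M * (W * Wᴴ) := by rw [h2, Matrix.mul_one]
    _ = W * Matrix.diagonal d * Wᴴ := by rw [← Matrix.mul_assoc, h3]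
    _ = c • 1 := by
      rw [hd, ← Matrix.smul_one_eq_diagonal, Matrix.mul_smul, Matrix.mul_one, Matrix.smul_mul, h2]

theorem spectrum_subset_singleton_of_ncard_le_one (h : (spectrum ℂ M).ncard ≤ 1) :
    ∃ c, spectrum ℂ M ⊆ {c} := by
  have hf : (spectrum ℂ M).Finite := Matrix.finite_spectrum M
  exact (Set.ncard_le_one_iff_subset_singleton hf).1 h

end Normal

/-! ### Frames of spectral subspaces -/

section Frames

open scoped ComplexOrder

variable {m n : ℕ} {M : Matrix (Fin n) (Fin n) ℂ} {ν : ℂ} {ε : ℝ} {F : Matrix (Fin n) (Fin m) ℂ}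

theorem spectralSubspace_le_iff {S : Submodule ℂ (Fin n → ℂ)} :
    spectralSubspace M ν ε ≤ S ↔
      ∀ z ∈ Metric.ball ν ε, ∀ x : Fin n → ℂ, M *ᵥ x = z • x → x ∈ S := by
  simp only [spectralSubspace, iSup_le_iff]
  refine forall₂_congr fun z _ => ?_
  constructor
  · intro h x hx
    exact h (Module.End.mem_eigenspace_iff.2 (by simpa using hx))
  · intro h x hx
    exact h x (by simpa using Module.End.mem_eigenspace_iff.1 hx)

theorem mem_spectralSubspace {z : ℂ} (hz : z ∈ Metric.ball ν ε) {x : Fin n → ℂ}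
    (hx : M *ᵥ x = z • x) : x ∈ spectralSubspace M ν ε :=
  spectralSubspace_le_iff.1 le_rfl z hz x hx

/-- A matrix that leaves the range of an isometry `F` invariant. -/
theorem mul_frame_eq {N : Matrix (Fin n) (Fin n) ℂ} (hF : Fᴴ * F = 1)
    (h : ∀ x ∈ LinearMap.range (Matrix.toLin' F), N *ᵥ x ∈ LinearMap.range (Matrix.toLin' F)) :
    N * F = F * (Fᴴ * N * F) := by
  apply Matrix.mulVec_injective
  ext1 v
  obtain ⟨w, hw⟩ := h (F *ᵥ v) ⟨v, by simp⟩
  rw [Matrix.toLin'_apply, Matrix.mulVec_mulVec] at hw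
  have h2 : Fᴴ *ᵥ ((N * F) *ᵥ v) = w := by
    rw [← hw, Matrix.mulVec_mulVec, hF, Matrix.one_mulVec]
  rw [Matrix.mul_assoc, ← Matrix.mulVec_mulVec v F, ← Matrix.mulVec_mulVec v Fᴴ, h2, hw]

theorem mul_frame_of_normal (hM : M * Mᴴ = Mᴴ * M) (hF : Fᴴ * F = 1)
    (hr : LinearMap.range (Matrix.toLin' F) = spectralSubspace M ν ε) :
    M * F = F * (Fᴴ * M * F) ∧ Mᴴ * F = F * (Fᴴ * Mᴴ * F) := by
  constructor
  · refine mul_frame_eq hF ?_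
    rw [hr]
    have : spectralSubspace M ν ε ≤ (spectralSubspace M ν ε).comap (Matrix.toLin' M) := by
      refine spectralSubspace_le_iff.2 fun z hz x hx => ?_
      rw [Submodule.mem_comap, Matrix.toLin'_apply, hx]
      exact Submodule.smul_mem _ _ (mem_spectralSubspace hz hx)
    intro x hx
    simpa using this hx
  · refine mul_frame_eq hF ?_
    rw [hr]
    have : spectralSubspace M ν ε ≤ (spectralSubspace M ν ε).comap (Matrix.toLin' Mᴴ) := by
      refine spectralSubspace_le_iff.2 fun z hz x hx => ?_
      rw [Submodule.mem_comap, Matrix.toLin'_apply, conjTranspose_mulVec_of_normal hM hx]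
      exact Submodule.smul_mem _ _ (mem_spectralSubspace hz hx)
    intro x hx
    simpa using this hx

theorem conjTranspose_frame_mul (h : Mᴴ * F = F * (Fᴴ * Mᴴ * F)) :
    Fᴴ * M = (Fᴴ * M * F) * Fᴴ := by
  have := congrArg Matrix.conjTranspose h
  simpa [Matrix.conjTranspose_mul, Matrix.mul_assoc] using this

theorem star_dotProduct_eq_zero_of_spectralSubspace {y : Fin n → ℂ}
    (h : ∀ z ∈ Metric.ball ν ε, ∀ x : Fin n → ℂ, M *ᵥ x = z • x → star y ⬝ᵥ x = 0) :
    ∀ x ∈ spectralSubspace M ν ε, star y ⬝ᵥ x = 0 := by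
  have : spectralSubspace M ν ε ≤ LinearMap.ker (dotProductBilin ℂ ℂ (star y)) :=
    spectralSubspace_le_iff.2 fun z hz x hx => by simpa using h z hz x hx
  intro x hx
  simpa using this hx

theorem frame_orthogonal {m' : ℕ} {F' : Matrix (Fin n) (Fin m') ℂ} {ν' : ℂ}
    (hM : M * Mᴴ = Mᴴ * M)
    (hr : LinearMap.range (Matrix.toLin' F) = spectralSubspace M ν ε)
    (hr' : LinearMap.range (Matrix.toLin' F') = spectralSubspace M ν' ε)
    (hd : 2 * ε < dist ν ν') : Fᴴ * F' = 0 := by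
  have h1 : ∀ x ∈ spectralSubspace M ν ε, ∀ y ∈ spectralSubspace M ν' ε, star x ⬝ᵥ y = 0 := by
    intro x hx
    refine star_dotProduct_eq_zero_of_spectralSubspace fun w hw y hy => ?_
    refine star_dotProduct_comm_eq_zero ?_
    refine star_dotProduct_eq_zero_of_spectralSubspace (fun z hz x' hx' => ?_) x hx
    refine star_dotProduct_eq_zero_of_normal hM hy hx' ?_
    rintro rfl
    have e1 := Metric.mem_ball.1 hw
    have e2 := Metric.mem_ball.1 hz
    have := dist_triangle_left ν ν' w
    linarith
  ext i j
  have := h1 (F *ᵥ Pi.single i 1) (by rw [← hr]; exact ⟨_, Matrix.toLin'_apply _ _⟩)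
    (F' *ᵥ Pi.single j 1) (by rw [← hr']; exact ⟨_, Matrix.toLin'_apply _ _⟩)
  simpa [Matrix.mul_apply, dotProduct] using this

theorem spectrum_restrict_subset_ball (hM : M * Mᴴ = Mᴴ * M) (hF : Fᴴ * F = 1)
    (hr : LinearMap.range (Matrix.toLin' F) = spectralSubspace M ν ε) :
    spectrum ℂ (Fᴴ * M * F) ⊆ Metric.ball ν ε := by
  intro z hz
  obtain ⟨x, hx, h⟩ := mem_spectrum_iff_exists_mulVec.1 hz
  by_contra hzb
  have hMF := (mul_frame_of_normal hM hF hr).1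
  have hy : M *ᵥ (F *ᵥ x) = z • (F *ᵥ x) := by
    rw [Matrix.mulVec_mulVec, hMF, ← Matrix.mulVec_mulVec, h, Matrix.mulVec_smul]
  have h0 : star (F *ᵥ x) ⬝ᵥ (F *ᵥ x) = 0 := by
    refine star_dotProduct_eq_zero_of_spectralSubspace (fun w hw x' hx' => ?_) _
      (hr ▸ ⟨x, by simp⟩ : F *ᵥ x ∈ spectralSubspace M ν ε)
    refine star_dotProduct_eq_zero_of_normal hM hy hx' ?_
    rintro rfl
    exact hzb hw
  rw [dotProduct_star_self_eq_zero] at h0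
  apply hx
  calc x = (Fᴴ * F) *ᵥ x := by rw [hF, Matrix.one_mulVec]
    _ = 0 := by rw [← Matrix.mulVec_mulVec, h0, Matrix.mulVec_zero]

theorem spectrum_restrict_subset (hMF : M * F = F * (Fᴴ * M * F)) (hF : Fᴴ * F = 1) :
    spectrum ℂ (Fᴴ * M * F) ⊆ spectrum ℂ M := by
  intro z hz
  obtain ⟨x, hx, h⟩ := mem_spectrum_iff_exists_mulVec.1 hz
  refine mem_spectrum_iff_exists_mulVec.2 ⟨F *ᵥ x, ?_, ?_⟩
  · intro h0
    apply hx
    calc x = (Fᴴ * F) *ᵥ x := by rw [hF, Matrix.one_mulVec]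
      _ = 0 := by rw [← Matrix.mulVec_mulVec, h0, Matrix.mulVec_zero]
  · rw [Matrix.mulVec_mulVec, hMF, ← Matrix.mulVec_mulVec, h, Matrix.mulVec_smul]

variable {l : ℕ} {μ : Fin l → ℂ} {d : Fin l → ℕ} {G : (i : Fin l) → Matrix (Fin n) (Fin (d i)) ℂ}

theorem spectrum_eq_iUnion_restrict (h1 : ∑ i, G i * (G i)ᴴ = 1)
    (hG : ∀ i, (G i)ᴴ * G i = 1)
    (hMG : ∀ i, M * G i = G i * ((G i)ᴴ * M * G i))
    (hGM : ∀ i, (G i)ᴴ * M = ((G i)ᴴ * M * G i) * (G i)ᴴ) :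
    spectrum ℂ M = ⋃ i, spectrum ℂ ((G i)ᴴ * M * G i) := by
  refine Set.Subset.antisymm ?_ (Set.iUnion_subset fun i => spectrum_restrict_subset (hMG i) (hG i))
  intro z hz
  obtain ⟨x, hx, h⟩ := mem_spectrum_iff_exists_mulVec.1 hz
  have : ∃ i, (G i)ᴴ *ᵥ x ≠ 0 := by
    by_contra! hall
    apply hx
    calc x = (∑ i, G i * (G i)ᴴ) *ᵥ x := by rw [h1, Matrix.one_mulVec]
      _ = 0 := by
        rw [Matrix.sum_mulVec]
        exact Finset.sum_eq_zero fun i _ => by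
          rw [← Matrix.mulVec_mulVec, hall i, Matrix.mulVec_zero]
  obtain ⟨i, hi⟩ := this
  refine Set.mem_iUnion.2 ⟨i, mem_spectrum_iff_exists_mulVec.2 ⟨_, hi, ?_⟩⟩
  rw [Matrix.mulVec_mulVec, ← hGM i, ← Matrix.mulVec_mulVec, h, Matrix.mulVec_smul]

/-- If the disks contain one eigenvalue each and all eigenvalues, the frames diagonalize the
matrix. -/
theorem frames_of_spectrum_eq_range (hM : M * Mᴴ = Mᴴ * M) (hμ : Set.range μ = spectrum ℂ M)
    (hε : 0 < ε) (hd : ∀ i j, i ≠ j → 2 * ε < dist (μ i) (μ j))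
    (hG : ∀ i, (G i)ᴴ * G i = 1)
    (hr : ∀ i, LinearMap.range (Matrix.toLin' (G i)) = spectralSubspace M (μ i) ε) :
    (∑ i, G i * (G i)ᴴ = 1) ∧ ∀ i, M * G i = μ i • G i := by
  constructor
  · have hker : (⊤ : Submodule ℂ (Fin n → ℂ)) ≤
        LinearMap.ker (Matrix.toLin' (∑ i, G i * (G i)ᴴ - 1)) := by
      rw [← iSup_eigenspace_toLin'_of_normal hM]
      refine iSup_le fun z x hx => ?_
      have hx' : M *ᵥ x = z • x := by simpa using Module.End.mem_eigenspace_iff.1 hx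
      by_cases h0 : x = 0
      · rw [h0]; exact Submodule.zero_mem _
      have hz : z ∈ Set.range μ := hμ ▸ mem_spectrum_iff_exists_mulVec.2 ⟨x, h0, hx'⟩
      obtain ⟨j, rfl⟩ := hz
      have hxj : x ∈ LinearMap.range (Matrix.toLin' (G j)) := by
        rw [hr j]; exact mem_spectralSubspace (Metric.mem_ball_self hε) hx'
      obtain ⟨w, rfl⟩ := hxj
      rw [LinearMap.mem_ker, Matrix.toLin'_apply, Matrix.toLin'_apply, Matrix.mulVec_mulVec,
        Matrix.sub_mul, Matrix.one_mul, Matrix.sum_mul, Finset.sum_eq_single j]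
      · rw [Matrix.mul_assoc, hG j, Matrix.mul_one, sub_self, Matrix.zero_mulVec]
      · intro i _ hij
        rw [Matrix.mul_assoc, frame_orthogonal hM (hr i) (hr j) (hd i j hij), Matrix.mul_zero]
      · simp
    have : Matrix.toLin' (∑ i, G i * (G i)ᴴ - 1) = 0 := LinearMap.ker_eq_top.1 (top_le_iff.1 hker)
    exact sub_eq_zero.1 ((map_eq_zero_iff _ Matrix.toLin'.injective).1 this)
  · intro i
    have hle : spectralSubspace M (μ i) ε ≤ Module.End.eigenspace (Matrix.toLin' M) (μ i) := by
      refine spectralSubspace_le_iff.2 fun z hz x hx => ?_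
      by_cases h0 : x = 0
      · rw [h0]; exact Submodule.zero_mem _
      have hz' : z ∈ Set.range μ := hμ ▸ mem_spectrum_iff_exists_mulVec.2 ⟨x, h0, hx⟩
      obtain ⟨j, rfl⟩ := hz'
      have : j = i := by
        by_contra hne
        have := hd j i hne
        rw [Metric.mem_ball] at hz
        linarith
      subst this
      exact Module.End.mem_eigenspace_iff.2 (by simpa using hx)
    apply Matrix.mulVec_injective
    ext1 v
    have := Module.End.mem_eigenspace_iff.1 (hle (hr i ▸ ⟨v, rfl⟩ :
      Matrix.toLin' (G i) v ∈ spectralSubspace M (μ i) ε))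
    rw [← Matrix.mulVec_mulVec, Matrix.smul_mulVec]
    simpa using this

end Frames

/-! ### Orthogonal decompositions into blocks -/

/-- The matrices `G i` have orthonormal columns, which together form an orthonormal basis, and `M`
is block diagonal with respect to it. -/
structure IsBlockDecomposition {n l : ℕ} {m : Fin l → ℕ} (M : Matrix (Fin n) (Fin n) ℂ)
    (G : (i : Fin l) → Matrix (Fin n) (Fin (m i)) ℂ) : Prop where
  isometry : ∀ i, (G i)ᴴ * G i = 1
  orthogonal : ∀ i j, i ≠ j → (G i)ᴴ * G j = 0
  sum_eq_one : ∑ i, G i * (G i)ᴴ = 1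
  mul_frame : ∀ i, M * G i = G i * ((G i)ᴴ * M * G i)
  frame_mul : ∀ i, (G i)ᴴ * M = ((G i)ᴴ * M * G i) * (G i)ᴴ

section Blocks

variable {n l : ℕ} {m : Fin l → ℕ} {M : Matrix (Fin n) (Fin n) ℂ}
  {G : (i : Fin l) → Matrix (Fin n) (Fin (m i)) ℂ}

theorem IsBlockDecomposition.spectrum_eq (h : IsBlockDecomposition M G) :
    spectrum ℂ M = ⋃ i, spectrum ℂ ((G i)ᴴ * M * G i) :=
  spectrum_eq_iUnion_restrict h.sum_eq_one h.isometry h.mul_frame h.frame_mul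

theorem IsBlockDecomposition.sum_dim (h : IsBlockDecomposition M G) : ∑ i, m i = n := by
  have h1 := congrArg Matrix.trace h.sum_eq_one
  rw [Matrix.trace_sum, Matrix.trace_one, Fintype.card_fin] at h1
  have h2 : ∀ i, (G i * (G i)ᴴ).trace = m i := fun i => by
    rw [Matrix.trace_mul_comm, h.isometry, Matrix.trace_one, Fintype.card_fin]
  rw [Finset.sum_congr rfl fun i _ => h2 i] at h1
  exact_mod_cast h1

theorem IsBlockDecomposition.normal (h : IsBlockDecomposition M G) (hM : M * Mᴴ = Mᴴ * M)
    (i : Fin l) : ((G i)ᴴ * M * G i) * ((G i)ᴴ * M * G i)ᴴ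
      = ((G i)ᴴ * M * G i)ᴴ * ((G i)ᴴ * M * G i) := by
  have hs : ((G i)ᴴ * M * G i)ᴴ = (G i)ᴴ * Mᴴ * G i := by
    simp [Matrix.conjTranspose_mul, Matrix.mul_assoc]
  have h1 : Mᴴ * G i = G i * ((G i)ᴴ * Mᴴ * G i) := by
    have := congrArg Matrix.conjTranspose (h.frame_mul i)
    simpa [Matrix.conjTranspose_mul, Matrix.mul_assoc] using this
  rw [hs]
  calc (G i)ᴴ * M * G i * ((G i)ᴴ * Mᴴ * G i) = (G i)ᴴ * M * (G i * ((G i)ᴴ * Mᴴ * G i)) := by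
        rw [Matrix.mul_assoc ((G i)ᴴ * M)]
    _ = (G i)ᴴ * (M * Mᴴ) * G i := by rw [← h1]; simp only [Matrix.mul_assoc]
    _ = (G i)ᴴ * Mᴴ * (M * G i) := by rw [hM]; simp only [Matrix.mul_assoc]
    _ = (G i)ᴴ * Mᴴ * G i * ((G i)ᴴ * M * G i) := by
        rw [h.mul_frame i]; simp only [Matrix.mul_assoc]

theorem IsBlockDecomposition.conj (h : IsBlockDecomposition M G) {U : Matrix (Fin n) (Fin n) ℂ}
    (hU : Uᴴ * U = 1) : IsBlockDecomposition (Uᴴ * M * U) fun i => Uᴴ * G i := by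
  have hU' : U * Uᴴ = 1 := mul_eq_one_comm.1 hU
  have hc : ∀ {a b : ℕ} (X : Matrix (Fin a) (Fin n) ℂ) (Y : Matrix (Fin n) (Fin b) ℂ),
      X * U * (Uᴴ * Y) = X * Y := fun X Y => by
    rw [Matrix.mul_assoc, ← Matrix.mul_assoc U, hU', Matrix.one_mul]
  have hblock : ∀ i, (Uᴴ * G i)ᴴ * (Uᴴ * M * U) * (Uᴴ * G i) = (G i)ᴴ * M * G i := fun i => by
    rw [Matrix.conjTranspose_mul, Matrix.conjTranspose_conjTranspose, Matrix.mul_assoc Uᴴ M U, hc,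
      ← Matrix.mul_assoc (G i)ᴴ M U, hc]
  constructor
  · intro i
    rw [Matrix.conjTranspose_mul, Matrix.conjTranspose_conjTranspose, hc, h.isometry]
  · intro i j hij
    rw [Matrix.conjTranspose_mul, Matrix.conjTranspose_conjTranspose, hc, h.orthogonal i j hij]
  · calc ∑ i, Uᴴ * G i * (Uᴴ * G i)ᴴ = Uᴴ * (∑ i, G i * (G i)ᴴ) * U := by
          rw [Matrix.mul_sum, Matrix.sum_mul]
          refine Finset.sum_congr rfl fun i _ => ?_
          rw [Matrix.conjTranspose_mul, Matrix.conjTranspose_conjTranspose]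
          simp only [Matrix.mul_assoc]
      _ = 1 := by rw [h.sum_eq_one, Matrix.mul_one, hU]
  · intro i
    rw [hblock, hc, Matrix.mul_assoc, Matrix.mul_assoc Uᴴ (G i), ← h.mul_frame i]
  · intro i
    rw [hblock, Matrix.conjTranspose_mul, Matrix.conjTranspose_conjTranspose,
      Matrix.mul_assoc Uᴴ M U, hc, ← Matrix.mul_assoc, ← Matrix.mul_assoc _ (G i)ᴴ,
      ← h.frame_mul i]

theorem aeval_mul_eq_smul {d : ℕ} {F : Matrix (Fin n) (Fin d) ℂ} {z : ℂ} (h : M * F = z • F)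
    (p : ℂ[X]) : aeval M p * F = p.eval z • F := by
  have hpow : ∀ i : ℕ, M ^ i * F = z ^ i • F := by
    intro i
    induction i with
    | zero => simp
    | succ i ih => rw [pow_succ, Matrix.mul_assoc, h, Matrix.mul_smul, ih, smul_smul, pow_succ']
  rw [aeval_eq_sum_range, eval_eq_sum_range, Matrix.sum_mul, Finset.sum_smul]
  refine Finset.sum_congr rfl fun i _ => ?_
  rw [Matrix.smul_mul, hpow, smul_smul]

/-- If `M` is the scalar `ν i` on the `i`-th block, the projections to the blocks are the Lagrange
interpolation polynomials in `M`. -/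
theorem IsBlockDecomposition.aeval_basis (h : IsBlockDecomposition M G) {ν : Fin l → ℂ}
    (hν : Function.Injective ν) (hM : ∀ i, M * G i = ν i • G i) (i : Fin l) :
    G i * (G i)ᴴ = aeval M (Lagrange.basis Finset.univ ν i) := by
  have h1 : ∀ j, aeval M (Lagrange.basis Finset.univ ν i) * G j =
      (if j = i then (1 : ℂ) else 0) • G j := by
    intro j
    rw [aeval_mul_eq_smul (hM j)]
    by_cases hij : j = i
    · subst hij
      rw [Lagrange.eval_basis_self hν.injOn (Finset.mem_univ _), if_pos rfl]
    · rw [Lagrange.eval_basis_of_ne (fun h => hij h.symm) (Finset.mem_univ _), if_neg hij]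
  calc G i * (G i)ᴴ = ∑ j, ((if j = i then (1 : ℂ) else 0) • G j) * (G j)ᴴ := by
        rw [Finset.sum_eq_single i]
        · simp
        · intro j _ hj; simp [hj]
        · simp
    _ = aeval M (Lagrange.basis Finset.univ ν i) * ∑ j, G j * (G j)ᴴ := by
        rw [Matrix.mul_sum]
        refine Finset.sum_congr rfl fun j _ => ?_
        rw [← h1, Matrix.mul_assoc]
    _ = _ := by rw [h.sum_eq_one, Matrix.mul_one]

end Blocks

section Curves

variable {t₀ : ℝ}

theorem ContinuousAt.matrix_mul_curve {a b c : ℕ} {X : ℝ → Matrix (Fin a) (Fin b) ℂ}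
    {Y : ℝ → Matrix (Fin b) (Fin c) ℂ} {t : ℝ} (hX : ContinuousAt X t) (hY : ContinuousAt Y t) :
    ContinuousAt (fun t => X t * Y t) t :=
  (continuous_fst.matrix_mul continuous_snd).continuousAt.comp (hX.prodMk hY)

theorem ContinuousAt.conjTranspose_curve {a b : ℕ} {X : ℝ → Matrix (Fin a) (Fin b) ℂ} {t : ℝ}
    (hX : ContinuousAt X t) : ContinuousAt (fun t => (X t)ᴴ) t :=
  (continuous_id.matrix_conjTranspose).continuousAt.comp hX

/-- Frames of the spectral subspaces for separated disks containing one eigenvalue of `A t₀` each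
decompose `A t` for `t` near `t₀`. -/
theorem eventually_isBlockDecomposition {n l : ℕ} {A : ℝ → Matrix (Fin n) (Fin n) ℂ} {ν : Fin l → ℂ}
    {ε : ℝ} {m : Fin l → ℕ} {F : (i : Fin l) → ℝ → Matrix (Fin n) (Fin (m i)) ℂ}
    (hA : ∀ᶠ t in 𝓝 t₀, A t * (A t)ᴴ = (A t)ᴴ * A t)
    (hν : Set.range ν = spectrum ℂ (A t₀)) (hε : 0 < ε)
    (hd : ∀ i j, i ≠ j → 2 * ε < dist (ν i) (ν j))
    (hFc : ∀ i, ContinuousAt (F i) t₀)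
    (hF : ∀ i, ∀ᶠ t in 𝓝 t₀, (F i t)ᴴ * F i t = 1 ∧
      LinearMap.range (Matrix.toLin' (F i t)) = spectralSubspace (A t) (ν i) ε) :
    (∀ i, A t₀ * F i t₀ = ν i • F i t₀) ∧
    ∀ᶠ t in 𝓝 t₀, IsBlockDecomposition (A t) (fun i => F i t) ∧
      ∀ i, spectrum ℂ ((F i t)ᴴ * A t * F i t) ⊆ Metric.ball (ν i) ε := by
  have hF' := eventually_all.2 hF
  obtain ⟨hsum, hscal⟩ := frames_of_spectrum_eq_range hA.self_of_nhds hν hε hd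
    (fun i => (hF'.self_of_nhds i).1) (fun i => (hF'.self_of_nhds i).2)
  refine ⟨hscal, ?_⟩
  -- the complementary projection is small near `t₀`, hence zero
  have hE : ContinuousAt (fun t => 1 - ∑ i, F i t * (F i t)ᴴ) t₀ := by
    refine continuousAt_const.sub ?_
    exact tendsto_finsetSum _ fun i _ =>
      ((hFc i).matrix_mul_curve (hFc i).conjTranspose_curve)
  have hsmall : ∀ᶠ t in 𝓝 t₀, ‖1 - ∑ i, F i t * (F i t)ᴴ‖ < 1 := by
    have := hE.norm.tendsto
    rw [hsum, sub_self, norm_zero] at this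
    exact this.eventually (gt_mem_nhds one_pos)
  filter_upwards [hA, hF', hsmall] with t h1 h2 h3
  have horth : ∀ i j, i ≠ j → (F i t)ᴴ * F j t = 0 := fun i j hij =>
    frame_orthogonal h1 (h2 i).2 (h2 j).2 (hd i j hij)
  have hP : (∑ i, F i t * (F i t)ᴴ) * ∑ i, F i t * (F i t)ᴴ = ∑ i, F i t * (F i t)ᴴ := by
    rw [Finset.sum_mul]
    refine Finset.sum_congr rfl fun i _ => ?_
    rw [Finset.mul_sum, Finset.sum_eq_single i]
    · rw [Matrix.mul_assoc, ← Matrix.mul_assoc (F i t)ᴴ, (h2 i).1, Matrix.one_mul]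
    · intro j _ hj
      rw [Matrix.mul_assoc, ← Matrix.mul_assoc (F i t)ᴴ, horth i j hj.symm, Matrix.zero_mul,
        Matrix.mul_zero]
    · simp
  have hone : ∑ i, F i t * (F i t)ᴴ = 1 := by
    refine (sub_eq_zero.1 (eq_zero_of_mul_self_of_norm_lt_one ?_ h3)).symm
    rw [sub_mul, one_mul, mul_sub, mul_one, hP, sub_self, sub_zero]
  refine ⟨⟨fun i => (h2 i).1, horth, hone, fun i => (mul_frame_of_normal h1 (h2 i).1 (h2 i).2).1,
    fun i => conjTranspose_frame_mul (mul_frame_of_normal h1 (h2 i).1 (h2 i).2).2⟩,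
    fun i => spectrum_restrict_subset_ball h1 (h2 i).1 (h2 i).2⟩

/-- The germ `A` can be diagonalized with a loss of `θ` derivatives of the eigenvectors: this is
required of every germ `A'` that is conjugate to `A` by a continuous curve of unitary matrices, so
that the property neither depends on the choice of frames nor on their regularity. -/
def LosslessDiagonalizable {n : ℕ} (t₀ : ℝ) (θ : ℕ) (A : ℝ → Matrix (Fin n) (Fin n) ℂ) : Prop :=
  ∀ (r : ℕ) (k : ℕ∞) (A' U : ℝ → Matrix (Fin n) (Fin n) ℂ),
    (∀ᶠ t in 𝓝 t₀, ContinuousAt U t) → (∀ᶠ t in 𝓝 t₀, (U t)ᴴ * U t = 1) →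
    (∀ᶠ t in 𝓝 t₀, A' t = (U t)ᴴ * A t * U t) → EulerContDiff t₀ (k + θ) r A' →
    ∃ (ev : Fin n → ℝ → ℂ) (V : ℝ → Matrix (Fin n) (Fin n) ℂ),
      (∀ i, EulerContDiff t₀ (k + θ) r (ev i)) ∧ EulerContDiff t₀ k r V ∧
      ∀ᶠ t in 𝓝 t₀, (V t)ᴴ * V t = 1 ∧ A' t * V t = V t * Matrix.diagonal fun i => ev i t

/-- Blocks that belong to distinct eigenvalues of `A t₀` can be diagonalized separately, because the
projections to them are as regular as the curve. -/
theorem LosslessDiagonalizable.of_blocks {n l : ℕ} {A : ℝ → Matrix (Fin n) (Fin n) ℂ}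
    {ν : Fin l → ℂ} {m : Fin l → ℕ} {F : (i : Fin l) → ℝ → Matrix (Fin n) (Fin (m i)) ℂ}
    {θ : ℕ} {τ : Fin l → ℕ} (hτ : ∀ i, τ i ≤ θ) (hν : Function.Injective ν)
    (hFc : ∀ i, ∀ᶠ t in 𝓝 t₀, ContinuousAt (F i) t)
    (hA : ∀ᶠ t in 𝓝 t₀, IsBlockDecomposition (A t) fun i => F i t)
    (hAν : ∀ i, A t₀ * F i t₀ = ν i • F i t₀)
    (hB : ∀ i, LosslessDiagonalizable t₀ (τ i) fun t => (F i t)ᴴ * A t * F i t) :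
    LosslessDiagonalizable t₀ θ A := by
  intro r k A' U hUc hU hA' hreg
  have hUU : ∀ᶠ t in 𝓝 t₀, U t * (U t)ᴴ = 1 := hU.mono fun t ht => mul_eq_one_comm.1 ht
  have hblock : ∀ᶠ t in 𝓝 t₀, IsBlockDecomposition (A' t) fun i => (U t)ᴴ * F i t := by
    filter_upwards [hA, hU, hA'] with t h1 h2 h3
    rw [h3]; exact h1.conj h2
  -- the orthogonal projections to the blocks of `A'`
  set P : Fin l → ℝ → Matrix (Fin n) (Fin n) ℂ :=
    fun i t => ((U t)ᴴ * F i t) * ((U t)ᴴ * F i t)ᴴ with hP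
  have hPreg : ∀ i, EulerContDiff t₀ (k + θ) r (P i) := by
    intro i
    have hc : ContinuousAt (fun t => (U t)ᴴ * F i t) t₀ :=
      hUc.self_of_nhds.conjTranspose_curve.matrix_mul_curve (hFc i).self_of_nhds
    refine hreg.of_idempotent (Lagrange.basis Finset.univ ν i)
      (hc.matrix_mul_curve hc.conjTranspose_curve) ?_ ?_ ?_
    · filter_upwards [hblock] with t ht
      simp only [hP]
      rw [Matrix.mul_assoc, ← Matrix.mul_assoc _ ((U t)ᴴ * F i t), ht.isometry i, Matrix.one_mul]
    · filter_upwards [hblock] with t ht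
      simp only [hP]
      rw [Matrix.mul_assoc, ht.frame_mul i, ← Matrix.mul_assoc, ← ht.mul_frame i, Matrix.mul_assoc]
    · refine hblock.self_of_nhds.aeval_basis hν ?_ i
      intro j
      rw [hA'.self_of_nhds, Matrix.mul_assoc, ← Matrix.mul_assoc (U t₀), hUU.self_of_nhds,
        Matrix.one_mul, Matrix.mul_assoc, hAν j, Matrix.mul_smul]
  have hframe : ∀ i, ∃ F' : ℝ → Matrix (Fin n) (Fin (m i)) ℂ, EulerContDiff t₀ (k + θ) r F' ∧
      ∀ᶠ t in 𝓝 t₀, (F' t)ᴴ * F' t = 1 ∧ P i t * F' t = F' t := by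
    intro i
    have hG := hblock.self_of_nhds.isometry i
    refine (hPreg i).exists_frame ?_ ?_ ((U t₀)ᴴ * F i t₀) hG ?_
    · filter_upwards [hblock] with t ht
      simp only [hP]
      rw [Matrix.mul_assoc, ← Matrix.mul_assoc _ ((U t)ᴴ * F i t), ht.isometry i, Matrix.one_mul]
    · refine Eventually.of_forall fun t => ?_
      simp only [hP]
      rw [Matrix.conjTranspose_mul, Matrix.conjTranspose_conjTranspose]
    · simp only [hP]
      rw [Matrix.mul_assoc, hG, Matrix.mul_one]
  choose F' hF'reg hF' using hframe
  -- the unitary matrices comparing the two frames of each block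
  set W : (i : Fin l) → ℝ → Matrix (Fin (m i)) (Fin (m i)) ℂ :=
    fun i t => (F i t)ᴴ * U t * F' i t with hW
  have hF'W : ∀ i, ∀ᶠ t in 𝓝 t₀, F' i t = (U t)ᴴ * F i t * W i t := by
    intro i
    filter_upwards [hF' i] with t ht
    conv_lhs => rw [← ht.2]
    simp only [hP, hW]
    rw [Matrix.conjTranspose_mul, Matrix.conjTranspose_conjTranspose]
    simp only [Matrix.mul_assoc]
  have hWW : ∀ i, ∀ᶠ t in 𝓝 t₀, (W i t)ᴴ * W i t = 1 := by
    intro i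
    filter_upwards [hF' i, hF'W i, hblock] with t h1 h2 h3
    have h4 := h1.1
    rw [h2, Matrix.conjTranspose_mul (_ * _), Matrix.mul_assoc, ← Matrix.mul_assoc _ _ (W i t),
      h3.isometry i, Matrix.one_mul] at h4
    exact h4
  have hB' : ∀ i, ∀ᶠ t in 𝓝 t₀, (F' i t)ᴴ * A' t * F' i t =
      (W i t)ᴴ * ((F i t)ᴴ * A t * F i t) * W i t := by
    intro i
    filter_upwards [hF'W i, hUU, hA'] with t h1 h2 h3
    have h5 : U t * F' i t = F i t * W i t := by
      rw [h1, Matrix.mul_assoc (U t)ᴴ, ← Matrix.mul_assoc (U t), h2, Matrix.one_mul]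
    calc (F' i t)ᴴ * A' t * F' i t = (U t * F' i t)ᴴ * A t * (U t * F' i t) := by
          rw [h3, Matrix.conjTranspose_mul]; simp only [Matrix.mul_assoc]
      _ = _ := by rw [h5, Matrix.conjTranspose_mul]; simp only [Matrix.mul_assoc]
  have hA'F' : ∀ i, ∀ᶠ t in 𝓝 t₀, A' t * F' i t = F' i t * ((F' i t)ᴴ * A' t * F' i t) := by
    intro i
    filter_upwards [hF'W i, hblock, hWW i] with t h1 h2 h3
    have h4 : W i t * (W i t)ᴴ = 1 := mul_eq_one_comm.1 h3
    have h5 := h2.mul_frame i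
    generalize (U t)ᴴ * F i t = G at h1 h5
    rw [h1, Matrix.conjTranspose_mul]
    calc A' t * (G * W i t) = (A' t * G) * W i t := by rw [Matrix.mul_assoc]
      _ = G * (1 * (Gᴴ * A' t * G * W i t)) := by rw [h5, Matrix.one_mul]; simp only [Matrix.mul_assoc]
      _ = _ := by rw [← h4]; simp only [Matrix.mul_assoc]
  have hdiag : ∀ i, ∃ (ev : Fin (m i) → ℝ → ℂ) (V : ℝ → Matrix (Fin (m i)) (Fin (m i)) ℂ),
      (∀ a, EulerContDiff t₀ (k + θ) r (ev a)) ∧ EulerContDiff t₀ k r V ∧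
      ∀ᶠ t in 𝓝 t₀, (V t)ᴴ * V t = 1 ∧
        ((F' i t)ᴴ * A' t * F' i t) * V t = V t * Matrix.diagonal fun a => ev a t := by
    intro i
    have hk : k + ((θ - τ i : ℕ) : ℕ∞) + (τ i : ℕ∞) = k + θ := by
      rw [add_assoc, ← Nat.cast_add, Nat.sub_add_cancel (hτ i)]
    have hWc : ∀ᶠ t in 𝓝 t₀, ContinuousAt (W i) t := by
      filter_upwards [hFc i, hUc, (hF'reg i).continuousAt] with t e1 e2 e3
      exact (e1.conjTranspose_curve.matrix_mul_curve e2).matrix_mul_curve e3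
    have hBreg : EulerContDiff t₀ (k + θ) r fun t => (F' i t)ᴴ * A' t * F' i t :=
      ((hF'reg i).conjTranspose.matrix_mul hreg).matrix_mul (hF'reg i)
    obtain ⟨ev, V, h1, h2, h3⟩ := hB i r (k + ((θ - τ i : ℕ) : ℕ∞)) _ (W i) hWc (hWW i) (hB' i)
      (hk.symm ▸ hBreg)
    exact ⟨ev, V, hk ▸ h1, h2.mono le_rfl le_self_add, h3⟩
  choose ev V hev hV hVev using hdiag
  have hcard : Fintype.card ((i : Fin l) × Fin (m i)) = Fintype.card (Fin n) := by
    simp [hA.self_of_nhds.sum_dim]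
  let e : ((i : Fin l) × Fin (m i)) ≃ Fin n := Fintype.equivOfCardEq hcard
  refine ⟨fun y => ev (e.symm y).1 (e.symm y).2,
    fun t => Matrix.of fun x y => (F' (e.symm y).1 t * V (e.symm y).1 t) x (e.symm y).2,
    fun y => hev _ _, ?_, ?_⟩
  · rw [eulerContDiff_matrix_iff]
    intro x y
    have := ((hF'reg (e.symm y).1).mono le_rfl le_self_add).matrix_mul (hV (e.symm y).1)
    exact eulerContDiff_matrix_iff.1 this x (e.symm y).2
  · filter_upwards [hblock, eventually_all.2 hF', eventually_all.2 hVev, eventually_all.2 hA'F',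
      eventually_all.2 hF'W] with t h1 h2 h3 h4 h5
    have hoff : ∀ i j, i ≠ j → (F' i t * V i t)ᴴ * (F' j t * V j t) = 0 := by
      intro i j hij
      have h0 : (F' i t)ᴴ * F' j t = 0 := by
        rw [h5 i, h5 j, Matrix.conjTranspose_mul (_ * _), Matrix.mul_assoc,
          ← Matrix.mul_assoc _ _ (W j t), h1.orthogonal i j hij, Matrix.zero_mul, Matrix.mul_zero]
      rw [Matrix.conjTranspose_mul, Matrix.mul_assoc, ← Matrix.mul_assoc _ (F' j t), h0,
        Matrix.zero_mul, Matrix.mul_zero]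
    have hon : ∀ i, (F' i t * V i t)ᴴ * (F' i t * V i t) = 1 := by
      intro i
      rw [Matrix.conjTranspose_mul, Matrix.mul_assoc, ← Matrix.mul_assoc _ (F' i t), (h2 i).1,
        Matrix.one_mul, (h3 i).1]
    constructor
    · ext y y'
      obtain ⟨⟨i, a⟩, rfl⟩ := e.surjective y
      obtain ⟨⟨j, b⟩, rfl⟩ := e.surjective y'
      have : ((Matrix.of fun x y => (F' (e.symm y).1 t * V (e.symm y).1 t) x (e.symm y).2)ᴴ *
          (Matrix.of fun x y => (F' (e.symm y).1 t * V (e.symm y).1 t) x (e.symm y).2))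
          (e ⟨i, a⟩) (e ⟨j, b⟩) = ((F' i t * V i t)ᴴ * (F' j t * V j t)) a b := by
        rw [Matrix.mul_apply, Matrix.mul_apply]
        refine Finset.sum_congr rfl fun x _ => ?_
        rw [Matrix.conjTranspose_apply, Matrix.conjTranspose_apply, Matrix.of_apply,
          Matrix.of_apply, Equiv.symm_apply_apply, Equiv.symm_apply_apply]
      rw [this]
      by_cases hij : i = j
      · subst hij
        rw [hon i, Matrix.one_apply, Matrix.one_apply]
        simp
      · rw [hoff i j hij, Matrix.one_apply, if_neg]
        · rfl
        · intro h
          exact hij (congrArg Sigma.fst (e.injective h))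
    · ext x y
      obtain ⟨⟨i, a⟩, rfl⟩ := e.surjective y
      have h6 : A' t * (F' i t * V i t) = (F' i t * V i t) * Matrix.diagonal fun a => ev i a t := by
        rw [← Matrix.mul_assoc, h4 i, Matrix.mul_assoc, (h3 i).2, Matrix.mul_assoc]
      have h7 := congrFun (congrFun h6 x) a
      rw [Matrix.mul_diagonal, Matrix.mul_apply] at h7
      rw [Matrix.mul_diagonal, Matrix.mul_apply]
      simp only [Matrix.of_apply]
      rw [Equiv.symm_apply_apply]
      exact h7

end Curves

/-! ### Resolution of the spectrum along the tree -/

/-- The germ `A` at `t₀` has `b` separated branches of eigenvalues: at least `b` distinct eigenvalues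
off `t₀`, any further ones being close to each other to infinite order. If there are no further
ones, `A` can be diagonalized with a loss of `θ` derivatives of the eigenvectors. -/
structure HasBranches {n : ℕ} (t₀ : ℝ) (θ : ℕ) (A : ℝ → Matrix (Fin n) (Fin n) ℂ) (b : ℕ) :
    Prop where
  le_ncard : ∀ᶠ t in 𝓝[≠] t₀, b ≤ (spectrum ℂ (A t)).ncard
  exists_close : ∀ N : ℕ, ∀ᶠ t in 𝓝[≠] t₀, ∀ S : Finset ℂ, (S : Set ℂ) ⊆ spectrum ℂ (A t) →
    b < S.card → ∃ x ∈ S, ∃ y ∈ S, x ≠ y ∧ ‖x - y‖ ≤ |t - t₀| ^ N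
  diagonalizable : (∀ᶠ t in 𝓝[≠] t₀, (spectrum ℂ (A t)).ncard ≤ b) → LosslessDiagonalizable t₀ θ A

section Counting

theorem Set.ncard_iUnion_of_pairwise_disjoint {ι α : Type*} [Fintype ι] {T : ι → Set α}
    (hT : ∀ i, (T i).Finite) (hd : Pairwise fun i j => Disjoint (T i) (T j)) :
    (⋃ i, T i).ncard = ∑ i, (T i).ncard := by
  classical
  have h1 : (⋃ i, T i) = ((Finset.univ.biUnion fun i => (hT i).toFinset : Finset α) : Set α) := by
    ext x; simp
  rw [h1, Set.ncard_coe_finset, Finset.card_biUnion]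
  · exact Finset.sum_congr rfl fun i _ => (Set.ncard_eq_toFinset_card _ (hT i)).symm
  · intro i _ j _ hij
    simpa [Set.Finite.disjoint_toFinset] using hd hij

theorem Finset.exists_lt_card_filter_of_subset_iUnion {ι α : Type*} [Fintype ι] {T : ι → Set α}
    {S : Finset α} {b : ι → ℕ} (hS : (S : Set α) ⊆ ⋃ i, T i) (hb : ∑ i, b i < S.card) :
    ∃ i, ∃ S' : Finset α, S' ⊆ S ∧ (S' : Set α) ⊆ T i ∧ b i < S'.card := by
  classical
  by_contra! h
  have h1 : S ⊆ Finset.univ.biUnion fun i => S.filter (· ∈ T i) := by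
    intro x hx
    obtain ⟨i, hi⟩ := Set.mem_iUnion.1 (hS hx)
    exact Finset.mem_biUnion.2 ⟨i, Finset.mem_univ _, Finset.mem_filter.2 ⟨hx, hi⟩⟩
  have h2 := (Finset.card_le_card h1).trans Finset.card_biUnion_le
  have h3 : ∑ i, (S.filter (· ∈ T i)).card ≤ ∑ i, b i :=
    Finset.sum_le_sum fun i _ => h i _ (Finset.filter_subset _ _)
      (fun x hx => (Finset.mem_filter.1 hx).2)
  omega

end Counting

section Tree

variable {n : ℕ} {t₀ : ℝ} {A : ℝ → Matrix (Fin n) (Fin n) ℂ}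

/-- The branches of blocks with separated spectra add up: more eigenvalues than there are branches give
an excess in one of the blocks. -/
theorem HasBranches.of_blocks {l : ℕ} {ν : Fin l → ℂ} {ε : ℝ} {m : Fin l → ℕ}
    {F : (i : Fin l) → ℝ → Matrix (Fin n) (Fin (m i)) ℂ}
    {θ : ℕ} {τ : Fin l → ℕ} (hτ : ∀ i, τ i ≤ θ)
    (hd : ∀ i j, i ≠ j → 2 * ε < dist (ν i) (ν j)) (hν : Function.Injective ν)
    (hFc : ∀ i, ∀ᶠ t in 𝓝 t₀, ContinuousAt (F i) t)
    (hA : ∀ᶠ t in 𝓝 t₀, IsBlockDecomposition (A t) (fun i => F i t) ∧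
      ∀ i, spectrum ℂ ((F i t)ᴴ * A t * F i t) ⊆ Metric.ball (ν i) ε)
    (hAν : ∀ i, A t₀ * F i t₀ = ν i • F i t₀) {b : Fin l → ℕ}
    (hB : ∀ i, HasBranches t₀ (τ i) (fun t => (F i t)ᴴ * A t * F i t) (b i)) :
    HasBranches t₀ θ A (∑ i, b i) := by
  have hncard : ∀ᶠ t in 𝓝 t₀, (spectrum ℂ (A t)).ncard =
      ∑ i, (spectrum ℂ ((F i t)ᴴ * A t * F i t)).ncard := by
    filter_upwards [hA] with t ht
    rw [ht.1.spectrum_eq]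
    refine Set.ncard_iUnion_of_pairwise_disjoint (fun i => Matrix.finite_spectrum _) ?_
    intro i j hij
    refine Set.disjoint_of_subset (ht.2 i) (ht.2 j) (Metric.ball_disjoint_ball ?_)
    linarith [hd i j hij]
  have hle := eventually_all.2 fun i => (hB i).le_ncard
  refine ⟨?_, fun N => ?_, fun hcount => ?_⟩
  · filter_upwards [nhdsWithin_le_nhds hncard, hle] with t h1 h2
    rw [h1]
    exact Finset.sum_le_sum fun i _ => h2 i
  · filter_upwards [nhdsWithin_le_nhds hA, eventually_all.2 fun i => (hB i).exists_close N]
      with t h1 h2 S hS hSb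
    rw [h1.1.spectrum_eq] at hS
    obtain ⟨i, S', hS'S, hS'T, hS'b⟩ := Finset.exists_lt_card_filter_of_subset_iUnion hS hSb
    obtain ⟨x, hx, y, hy, hxy⟩ := h2 i S' hS'T hS'b
    exact ⟨x, hS'S hx, y, hS'S hy, hxy⟩
  · refine LosslessDiagonalizable.of_blocks hτ hν hFc (hA.mono fun t ht => ht.1) hAν fun i =>
      (hB i).diagonalizable ?_
    filter_upwards [nhdsWithin_le_nhds hncard, hle, hcount] with t h1 h2 h3
    rw [h1] at h3
    exact ((Finset.sum_eq_sum_iff_of_le fun j _ => h2 j).1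
      (le_antisymm (Finset.sum_le_sum fun j _ => h2 j) h3) i (Finset.mem_univ _)).ge

theorem exists_eq_pow_mul_of_multiplicityAt_eq_top {f : ℝ → ℂ} (h : multiplicityAt t₀ f = ⊤)
    (N : ℕ) : ∃ g : ℝ → ℂ, ContinuousAt g t₀ ∧
      ∀ᶠ t in 𝓝 t₀, f t = ((t - t₀ : ℝ) : ℂ) ^ N * g t := by
  have h1 : (N : ℕ∞) < multiplicityAt t₀ f := by rw [h]; exact ENat.natCast_lt_top N
  simp only [multiplicityAt, lt_iSup_iff] at h1
  obtain ⟨k, ⟨g, hg1, hg2⟩, hk⟩ := h1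
  have hk' : N ≤ k := by exact_mod_cast hk.le
  refine ⟨fun t => ((t - t₀ : ℝ) : ℂ) ^ (k - N) * g t, ?_, ?_⟩
  · exact ContinuousAt.mul (by fun_prop) hg1.self_of_nhds
  · filter_upwards [hg2] with t ht
    rw [ht, ← mul_assoc, ← pow_add, Nat.add_sub_cancel' hk']

theorem traceFreePart_add (t : ℝ) :
    A t = traceFreePart A t + ((n : ℂ)⁻¹ * (A t).trace) • (1 : Matrix (Fin n) (Fin n) ℂ) := by
  simp [traceFreePart]

theorem mem_spectrum_traceFreePart {t : ℝ} {z : ℂ} :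
    z ∈ spectrum ℂ (A t) ↔
      z - (n : ℂ)⁻¹ * (A t).trace ∈ spectrum ℂ (traceFreePart A t) := by
  rw [mem_spectrum_iff_exists_mulVec, mem_spectrum_iff_exists_mulVec]
  refine exists_congr fun x => and_congr_right fun _ => ?_
  rw [traceFreePart, Matrix.sub_mulVec, Matrix.smul_mulVec, Matrix.one_mulVec, sub_smul,
    sub_left_inj]

theorem traceFreePart_trace (hn : n ≠ 0) (t : ℝ) : (traceFreePart A t).trace = 0 := by
  have : (n : ℂ) ≠ 0 := by exact_mod_cast hn
  rw [traceFreePart, Matrix.trace_sub, Matrix.trace_smul, Matrix.trace_one, Fintype.card_fin,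
    smul_eq_mul]
  field_simp
  ring

theorem eq_smul_one_of_ncard_spectrum_le_one (hn : n ≠ 0) {M : Matrix (Fin n) (Fin n) ℂ}
    (hM : M * Mᴴ = Mᴴ * M) (h : (spectrum ℂ M).ncard ≤ 1) :
    M = ((n : ℂ)⁻¹ * M.trace) • (1 : Matrix (Fin n) (Fin n) ℂ) := by
  obtain ⟨c, hc⟩ := spectrum_subset_singleton_of_ncard_le_one h
  have h1 := eq_smul_one_of_normal_of_spectrum_subset hM hc
  have : (n : ℂ) ≠ 0 := by exact_mod_cast hn
  have h2 : (n : ℂ)⁻¹ * M.trace = c := by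
    rw [h1, Matrix.trace_smul, Matrix.trace_one, Fintype.card_fin, smul_eq_mul]
    field_simp
  rw [h2, ← h1]

theorem trace_conj_unitary {M U : Matrix (Fin n) (Fin n) ℂ} (hU : Uᴴ * U = 1) :
    (Uᴴ * M * U).trace = M.trace := by
  rw [Matrix.trace_mul_comm, ← Matrix.mul_assoc, mul_eq_one_comm.1 hU, Matrix.one_mul]

theorem spectrum_nonempty_of_ne_zero (hn : n ≠ 0) (M : Matrix (Fin n) (Fin n) ℂ) :
    (spectrum ℂ M).Nonempty := by
  have : Nonempty (Fin n) := ⟨⟨0, Nat.pos_of_ne_zero hn⟩⟩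
  exact spectrum.nonempty_of_isAlgClosed_of_finiteDimensional ℂ M

/-- A germ that is scalar to infinite order has one branch; if there are no further eigenvalues, it is
scalar near `t₀`, so that there is nothing to diagonalize. -/
theorem HasBranches.of_flat {θ : ℕ} (hn : n ≠ 0)
    (hA : ∀ᶠ t in 𝓝 t₀, A t * (A t)ᴴ = (A t)ᴴ * A t)
    (h0 : (spectrum ℂ (A t₀)).Subsingleton) (htop : matrixOrder t₀ (traceFreePart A) = ⊤) :
    HasBranches t₀ θ A 1 := by
  refine ⟨Eventually.of_forall fun t => ?_, fun N => ?_, fun hcount => ?_⟩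
  · exact (Set.ncard_pos (Matrix.finite_spectrum _)).2 (spectrum_nonempty_of_ne_zero hn _)
  · simp only [matrixOrder, iInf_eq_top] at htop
    choose g hg1 hg2 using fun i j => exists_eq_pow_mul_of_multiplicityAt_eq_top (htop i j) (N + 1)
    have hgc : ContinuousAt (fun t => Matrix.of fun i j => g i j t) t₀ :=
      continuousAt_matrix_iff.2 hg1
    have hB : ∀ᶠ t in 𝓝 t₀, traceFreePart A t =
        ((t - t₀ : ℝ) : ℂ) ^ (N + 1) • Matrix.of fun i j => g i j t := by
      filter_upwards [eventually_all.2 fun i => eventually_all.2 (hg2 i)] with t ht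
      ext i j
      simpa using ht i j
    have hsmall : ∀ᶠ t in 𝓝 t₀, |t - t₀| * (2 * (‖Matrix.of fun i j => g i j t‖ *
        ‖(1 : Matrix (Fin n) (Fin n) ℂ)‖)) < 1 := by
      have h1 : ContinuousAt (fun t => |t - t₀| * (2 * (‖Matrix.of fun i j => g i j t‖ *
          ‖(1 : Matrix (Fin n) (Fin n) ℂ)‖))) t₀ :=
        ContinuousAt.mul (by fun_prop) ((hgc.norm.mul_const _).const_mul _)
      have h2 := h1.tendsto
      simp only [sub_self, abs_zero, zero_mul] at h2
      exact h2.eventually (gt_mem_nhds one_pos)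
    filter_upwards [nhdsWithin_le_nhds hB, nhdsWithin_le_nhds hsmall] with t h1 h2 S hS hcard
    obtain ⟨x, hx, y, hy, hxy⟩ := Finset.one_lt_card.1 hcard
    refine ⟨x, hx, y, hy, hxy, ?_⟩
    have hbd : ∀ z ∈ S, ‖z - (n : ℂ)⁻¹ * (A t).trace‖ ≤ |t - t₀| ^ (N + 1) *
        (‖Matrix.of fun i j => g i j t‖ * ‖(1 : Matrix (Fin n) (Fin n) ℂ)‖) := by
      intro z hz
      have := spectrum.norm_le_norm_mul_of_mem (mem_spectrum_traceFreePart.1 (hS hz))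
      rw [h1, norm_smul, norm_pow, Complex.norm_real, Real.norm_eq_abs, mul_assoc] at this
      exact this
    calc ‖x - y‖ = ‖(x - (n : ℂ)⁻¹ * (A t).trace) - (y - (n : ℂ)⁻¹ * (A t).trace)‖ := by
          congr 1; ring
      _ ≤ _ := norm_sub_le _ _
      _ ≤ _ := add_le_add (hbd x hx) (hbd y hy)
      _ = |t - t₀| ^ N * (|t - t₀| * (2 * (‖Matrix.of fun i j => g i j t‖ *
        ‖(1 : Matrix (Fin n) (Fin n) ℂ)‖))) := by ring
      _ ≤ |t - t₀| ^ N * 1 := by gcongr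
      _ = _ := mul_one _
  · intro r k A' U _ hU hA' hreg
    have hone : ∀ᶠ t in 𝓝 t₀, (spectrum ℂ (A t)).ncard ≤ 1 := by
      rw [eventually_nhdsWithin_iff] at hcount
      filter_upwards [hcount] with t ht
      by_cases h : t = t₀
      · rw [h]
        exact (Set.ncard_le_one (Matrix.finite_spectrum _)).2 fun a ha b hb => h0 ha hb
      · exact ht h
    refine ⟨fun _ t => (n : ℂ)⁻¹ * (A' t).trace, fun _ => 1, fun _ =>
      (EulerContDiff.const _ r).mul hreg.trace, EulerContDiff.const _ r, ?_⟩
    filter_upwards [hA, hone, hU, hA'] with t h1 h2 h3 h4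
    refine ⟨by simp, ?_⟩
    have h5 := eq_smul_one_of_ncard_spectrum_le_one hn h1 h2
    have h6 : A' t = ((n : ℂ)⁻¹ * (A' t).trace) • (1 : Matrix (Fin n) (Fin n) ℂ) := by
      have h7 : (A' t).trace = (A t).trace := by rw [h4, trace_conj_unitary h3]
      rw [h7, h4]
      conv_lhs => rw [h5]
      rw [Matrix.mul_smul, Matrix.smul_mul, Matrix.mul_one, h3]
    rw [Matrix.mul_one, Matrix.one_mul, ← Matrix.smul_one_eq_diagonal]
    exact h6

/-- Division of the trace-free part by `(t - t₀) ^ ρ` maps the eigenvalues affinely, trading `ρ`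
ordinary derivatives for Euler derivatives. -/
theorem HasBranches.of_quotientGerm {C : ℝ → Matrix (Fin n) (Fin n) ℂ} {ρ θ b : ℕ}
    (hC : IsQuotientGerm t₀ ρ (traceFreePart A) C) (hb : HasBranches t₀ θ C b) :
    HasBranches t₀ (ρ + θ) A b := by
  obtain ⟨hCc, hAC⟩ := hC
  have hpow : ∀ t, t ≠ t₀ → ((t - t₀ : ℝ) : ℂ) ^ ρ ≠ 0 := fun t ht =>
    pow_ne_zero _ (by exact_mod_cast sub_ne_zero.2 ht)
  -- the affine bijection between the spectra
  have hspec : ∀ᶠ t in 𝓝[≠] t₀, ∀ z, z ∈ spectrum ℂ (C t) ↔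
      (n : ℂ)⁻¹ * (A t).trace + ((t - t₀ : ℝ) : ℂ) ^ ρ * z ∈ spectrum ℂ (A t) := by
    filter_upwards [nhdsWithin_le_nhds hAC, self_mem_nhdsWithin] with t h1 h2 z
    rw [mem_spectrum_traceFreePart (A := A), add_sub_cancel_left, h1, mem_spectrum_iff_exists_mulVec,
      mem_spectrum_iff_exists_mulVec]
    refine exists_congr fun x => and_congr_right fun _ => ?_
    rw [Matrix.smul_mulVec, mul_smul]
    exact (smul_right_injective _ (hpow t h2)).eq_iff.symm
  have hncard : ∀ᶠ t in 𝓝[≠] t₀, (spectrum ℂ (A t)).ncard = (spectrum ℂ (C t)).ncard := by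
    filter_upwards [hspec, self_mem_nhdsWithin] with t h1 h2
    have hinj : Function.Injective fun z : ℂ =>
        (n : ℂ)⁻¹ * (A t).trace + ((t - t₀ : ℝ) : ℂ) ^ ρ * z :=
      (add_right_injective _).comp (mul_right_injective₀ (hpow t h2))
    rw [← Set.ncard_image_of_injective (spectrum ℂ (C t)) hinj]
    congr 1
    ext z
    constructor
    · intro hz
      refine ⟨(((t - t₀ : ℝ) : ℂ) ^ ρ)⁻¹ * (z - (n : ℂ)⁻¹ * (A t).trace), ?_, ?_⟩
      · rw [h1, mul_inv_cancel_left₀ (hpow t h2)]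
        simpa using hz
      · simp only
        rw [mul_inv_cancel_left₀ (hpow t h2)]
        ring
    · rintro ⟨w, hw, rfl⟩
      exact (h1 w).1 hw
  refine ⟨?_, fun N => ?_, fun hcount => ?_⟩
  · filter_upwards [hncard, hb.le_ncard] with t h1 h2
    rwa [h1]
  · have hone : ∀ᶠ t in 𝓝[≠] t₀, |t - t₀| < 1 := by
      refine nhdsWithin_le_nhds ?_
      have : Tendsto (fun t => |t - t₀|) (𝓝 t₀) (𝓝 |t₀ - t₀|) :=
        (by fun_prop : Continuous fun t => |t - t₀|).tendsto t₀
      rw [sub_self, abs_zero] at this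
      exact this.eventually (gt_mem_nhds one_pos)
    classical
    filter_upwards [hspec, hb.exists_close N, hone, self_mem_nhdsWithin] with t h1 h2 h3 h4 S hS hcard
    set φ : ℂ → ℂ := fun z => (((t - t₀ : ℝ) : ℂ) ^ ρ)⁻¹ * (z - (n : ℂ)⁻¹ * (A t).trace) with hφ
    have hφinj : Function.Injective φ :=
      (mul_right_injective₀ (inv_ne_zero (hpow t h4))).comp (sub_left_injective)
    obtain ⟨x', hx', y', hy', hne, hxy⟩ := h2 (S.image φ) (by
      intro w hw
      obtain ⟨z, hz, rfl⟩ := Finset.mem_image.1 (Finset.mem_coe.1 hw)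
      rw [h1, hφ]
      simp only
      rw [mul_inv_cancel_left₀ (hpow t h4)]
      simpa using hS hz) (by rwa [Finset.card_image_of_injective _ hφinj])
    obtain ⟨x, hx, rfl⟩ := Finset.mem_image.1 hx'
    obtain ⟨y, hy, rfl⟩ := Finset.mem_image.1 hy'
    refine ⟨x, hx, y, hy, fun h => hne (by rw [h]), ?_⟩
    have h5 : x - y = ((t - t₀ : ℝ) : ℂ) ^ ρ * (φ x - φ y) := by
      rw [hφ]
      simp only
      rw [← mul_sub, mul_inv_cancel_left₀ (hpow t h4)]
      ring
    calc ‖x - y‖ = |t - t₀| ^ ρ * ‖φ x - φ y‖ := by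
          rw [h5, norm_mul, norm_pow, Complex.norm_real, Real.norm_eq_abs]
      _ ≤ 1 * |t - t₀| ^ N := by
          gcongr
          exact pow_le_one₀ (abs_nonneg _) h3.le
      _ = _ := one_mul _
  · intro r k A' U hUc hU hA' hreg
    have hCd := hb.diagonalizable (by
      filter_upwards [hncard, hcount] with t h1 h2
      rwa [← h1])
    have hC'c : ∀ᶠ t in 𝓝 t₀, ContinuousAt (fun t => (U t)ᴴ * C t * U t) t := by
      filter_upwards [hUc, hCc] with t e1 e2
      exact (e1.conjTranspose_curve.matrix_mul_curve e2).matrix_mul_curve e1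
    have hA'C' : ∀ᶠ t in 𝓝 t₀, A' t = ((n : ℂ)⁻¹ * (A' t).trace) •
        (1 : Matrix (Fin n) (Fin n) ℂ) + (t - t₀) ^ ρ • ((U t)ᴴ * C t * U t) := by
      filter_upwards [hU, hA', hAC] with t h1 h2 h3
      have h7 : (A' t).trace = (A t).trace := by rw [h2, trace_conj_unitary h1]
      rw [h7, h2]
      conv_lhs => rw [traceFreePart_add (A := A) t, h3]
      rw [Matrix.mul_add, Matrix.add_mul, Matrix.mul_smul, Matrix.smul_mul, Matrix.mul_smul,
        Matrix.smul_mul, Matrix.mul_one, h1, add_comm, ← Complex.ofReal_pow, Complex.coe_smul]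
    have htr : EulerContDiff t₀ (k + (ρ + θ : ℕ)) r fun t => (n : ℂ)⁻¹ * (A' t).trace :=
      (EulerContDiff.const _ r).mul hreg.trace
    have hk : k + ((ρ + θ : ℕ) : ℕ∞) = k + θ + ρ := by push_cast; ring
    have hC'reg : EulerContDiff t₀ (k + θ) (r + ρ) fun t => (U t)ᴴ * C t * U t := by
      refine EulerContDiff.of_pow_smul_eulerContDiff hC'c ?_
      rw [← hk]
      have h1 : EulerContDiff t₀ (k + (ρ + θ : ℕ)) r
          fun t => ((n : ℂ)⁻¹ * (A' t).trace) • (1 : Matrix (Fin n) (Fin n) ℂ) := by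
        rw [eulerContDiff_matrix_iff]
        intro i j
        simp only [Matrix.smul_apply, smul_eq_mul]
        exact htr.mul (EulerContDiff.const _ r)
      refine (hreg.sub h1).congr ?_
      filter_upwards [hA'C'] with t ht
      exact eq_sub_of_add_eq' ht.symm
    obtain ⟨ev, V, h1, h2, h3⟩ := hCd (r + ρ) k _ U hUc hU (Eventually.of_forall fun _ => rfl) hC'reg
    refine ⟨fun i t => (n : ℂ)⁻¹ * (A' t).trace + (t - t₀) ^ ρ • ev i t, V, fun i => ?_,
      h2.mono (Nat.le_add_right _ _) le_rfl, ?_⟩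
    · refine htr.add ?_
      rw [hk]
      exact (h1 i).pow_smul
    · filter_upwards [h3, hA'C'] with t e1 e2
      refine ⟨e1.1, ?_⟩
      have e3 : Matrix.diagonal (fun i => (n : ℂ)⁻¹ * (A' t).trace + (t - t₀) ^ ρ • ev i t) =
          ((n : ℂ)⁻¹ * (A' t).trace) • (1 : Matrix (Fin n) (Fin n) ℂ) +
            (t - t₀) ^ ρ • Matrix.diagonal fun i => ev i t := by
        ext i j
        by_cases h : i = j
        · subst h; simp
        · simp [h]
      rw [e3, Matrix.mul_add, Matrix.mul_smul, Matrix.mul_one, Matrix.mul_smul, ← e1.2]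
      conv_lhs => rw [e2]
      rw [Matrix.add_mul, Matrix.smul_mul, Matrix.one_mul, Matrix.smul_mul]

theorem multiplicityAt_zero : multiplicityAt t₀ (fun _ => 0) = ⊤ := by
  refine ENat.eq_top_iff_forall_ge.2 fun k => ?_
  refine le_iSup₂_of_le k ⟨fun _ => 0, ?_, ?_⟩ le_rfl
  · exact Eventually.of_forall fun _ => continuousAt_const
  · exact Eventually.of_forall fun _ => by simp

theorem matrixOrder_traceFreePart_of_dim_one (A : ℝ → Matrix (Fin 1) (Fin 1) ℂ) :
    matrixOrder t₀ (traceFreePart A) = ⊤ := by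
  simp only [matrixOrder, iInf_eq_top]
  intro i j
  have : (fun t => traceFreePart A t i j) = fun _ => 0 := by
    ext t
    rw [Subsingleton.elim i 0, Subsingleton.elim j 0]
    simp [traceFreePart, Matrix.trace]
  rw [this, multiplicityAt_zero]

/-- The quotient germ in the division step is trace-free, so it is not scalar at `t₀` and has to
be split. -/
theorem quotientGerm_normal_and_trace {C : ℝ → Matrix (Fin n) (Fin n) ℂ} {ρ : ℕ} (hn : n ≠ 0)
    (hA : ∀ᶠ t in 𝓝 t₀, A t * (A t)ᴴ = (A t)ᴴ * A t)
    (hC : IsQuotientGerm t₀ ρ (traceFreePart A) C) :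
    (∀ᶠ t in 𝓝 t₀, C t * (C t)ᴴ = (C t)ᴴ * C t) ∧ (C t₀).trace = 0 := by
  obtain ⟨hCc, hAC⟩ := hC
  have hpow : ∀ t, t ≠ t₀ → ((t - t₀ : ℝ) : ℂ) ^ ρ ≠ 0 := fun t ht =>
    pow_ne_zero _ (by exact_mod_cast sub_ne_zero.2 ht)
  have hc := hCc.self_of_nhds
  have hinv : ∀ᶠ t in 𝓝[≠] t₀, C t = (((t - t₀ : ℝ) : ℂ) ^ ρ)⁻¹ • traceFreePart A t := by
    filter_upwards [nhdsWithin_le_nhds hAC, self_mem_nhdsWithin] with t h1 h2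
    rw [h1, smul_smul, inv_mul_cancel₀ (hpow t h2), one_smul]
  constructor
  · refine (ContinuousAt.eventuallyEq_nhds_iff_eventuallyEq_nhdsNE
      (hc.matrix_mul_curve hc.conjTranspose_curve) (hc.conjTranspose_curve.matrix_mul_curve hc)).1 ?_
    filter_upwards [nhdsWithin_le_nhds hA, hinv] with t h1 h2
    have h3 : traceFreePart A t * (traceFreePart A t)ᴴ =
        (traceFreePart A t)ᴴ * traceFreePart A t := by
      simp only [traceFreePart, Matrix.conjTranspose_sub, Matrix.conjTranspose_smul,
        Matrix.conjTranspose_one, sub_mul, mul_sub, h1, smul_mul_assoc, mul_smul_comm, one_mul,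
        mul_one, smul_sub]
      rw [smul_comm ((n : ℂ)⁻¹ * (A t).trace)]
      abel
    rw [h2, Matrix.conjTranspose_smul, Matrix.smul_mul, Matrix.mul_smul, h3, Matrix.smul_mul,
      Matrix.mul_smul, smul_comm]
  · have htr : ContinuousAt (fun t => (C t).trace) t₀ :=
      (continuous_id.matrix_trace).continuousAt.comp hc
    have := (ContinuousAt.eventuallyEq_nhds_iff_eventuallyEq_nhdsNE htr
      (continuousAt_const (y := (0 : ℂ)))).1 (by
        filter_upwards [hinv] with t ht
        rw [ht, Matrix.trace_smul, traceFreePart_trace hn, smul_zero])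
    exact this.self_of_nhds

theorem IsSpectralTree.two_le_of_not_subsingleton {q : ℕ∞} {T : LabeledTree}
    (h : IsSpectralTree t₀ q A T) (hs : ¬ (spectrum ℂ (A t₀)).Subsingleton) :
    ∃ d ρ l c, T = .node d ρ l c ∧ 2 ≤ l := by
  cases h with
  | split ν ε m F c hl _ _ _ _ _ _ => exact ⟨_, _, _, _, rfl, hl⟩
  | flat h => exact absurd h hs
  | terminate _ h => exact absurd h hs
  | divide _ _ h => exact absurd h hs

/-- An admissible tree resolves the spectrum of the germ. -/
theorem IsSpectralTree.exists_hasBranches {q : ℕ∞} {T : LabeledTree}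
    (h : IsSpectralTree t₀ q A T) (hT : T.Admissible)
    (hc : ∀ᶠ t in 𝓝 t₀, ContinuousAt A t)
    (hA : ∀ᶠ t in 𝓝 t₀, A t * (A t)ᴴ = (A t)ᴴ * A t) : ∃ b, HasBranches t₀ T.theta A b := by
  induction h with
  | @split n l q A ν ε m F c hl hν hspec hε hd hF hB ih =>
    have hFc : ∀ i, ∀ᶠ t in 𝓝 t₀, ContinuousAt (F i) t := fun i => by
      filter_upwards [hF i] with t ht
      exact continuousAt_matrix_iff.2 fun a b => (ht.1 a b).continuousAt
    obtain ⟨h1, h2⟩ := eventually_isBlockDecomposition hA hspec hε hd (fun i => (hFc i).self_of_nhds)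
      (fun i => (hF i).mono fun t ht => ht.2)
    have hex : ∀ i, ∃ b, HasBranches t₀ (c i).theta (fun t => (F i t)ᴴ * A t * F i t) b := by
      intro i
      refine ih i (hT.2 i) ?_ ?_
      · filter_upwards [hFc i, hc] with t e1 e2
        exact (e1.conjTranspose_curve.matrix_mul_curve e2).matrix_mul_curve e1
      · filter_upwards [h2, hA] with t e1 e2 using e1.1.normal e2 i
    choose b hb using hex
    refine ⟨_, HasBranches.of_blocks (τ := fun i => (c i).theta) (fun i => ?_) hd hν hFc h2 h1 hb⟩
    simp only [LabeledTree.theta, zero_add]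
    exact Finset.le_sup (f := fun i => (c i).theta) (Finset.mem_univ i)
  | @flat n q A h0 htop =>
    have hn : n ≠ 0 := by
      rintro rfl
      exact absurd (hT.1 rfl rfl) (by norm_num)
    exact ⟨1, HasBranches.of_flat hn hA h0 htop⟩
  | @terminate n r q A C _ hr _ _ =>
    obtain rfl : n = 1 := hT.1 rfl rfl
    rw [matrixOrder_traceFreePart_of_dim_one] at hr
    exact absurd hr (ENat.top_ne_natCast r)
  | @divide n r l q A C c h0 hr hC hrq hC0 htree ih =>
    have hn : n ≠ 0 := by
      rintro rfl
      exact hC0 (Subsingleton.elim _ _)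
    obtain ⟨hCn, hCtr⟩ := quotientGerm_normal_and_trace hn hA hC
    have hns : ¬ (spectrum ℂ (C t₀)).Subsingleton := by
      intro hs
      apply hC0
      have := eq_smul_one_of_ncard_spectrum_le_one hn hCn.self_of_nhds
        ((Set.ncard_le_one (Matrix.finite_spectrum _)).2 fun a ha b hb => hs ha hb)
      rw [this, hCtr]
      simp
    obtain ⟨d', ρ', l', c', heq, hl⟩ := htree.two_le_of_not_subsingleton hns
    have hl' : 2 ≤ l := by
      injection heq with _ _ e3 _
      omega
    obtain ⟨b, hb⟩ := ih ⟨fun h => by omega, hT.2⟩ hC.1 hCn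
    refine ⟨b, ?_⟩
    have := HasBranches.of_quotientGerm hC hb
    simpa [LabeledTree.theta] using this

end Tree

/-! ### Minors of the Bezoutiant and the number of distinct eigenvalues -/

section Bezoutiant

variable {n : ℕ}

theorem newtonSum_prod_X_sub_C (d : Fin n → ℂ) (i : ℕ) :
    newtonSum (∏ a, (X - C (d a))) i = ∑ a, d a ^ i := by
  have : (∏ a, (X - C (d a))).roots = Finset.univ.val.map d := by
    have := Polynomial.roots_multiset_prod_X_sub_C (Finset.univ.val.map d)
    rwa [Multiset.map_map] at this
  rw [newtonSum, this, Multiset.map_map]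
  rfl

theorem charpoly_eq_prod_of_diagonal {M W : Matrix (Fin n) (Fin n) ℂ} {d : Fin n → ℂ}
    (h1 : Wᴴ * W = 1) (h3 : M * W = W * Matrix.diagonal d) :
    M.charpoly = ∏ a, (X - C (d a)) := by
  have h2 := mul_eq_one_comm.1 h1
  have hM : M = W * Matrix.diagonal d * Wᴴ := by
    rw [← h3, Matrix.mul_assoc, h2, Matrix.mul_one]
  rw [hM, Matrix.mul_assoc, Matrix.charpoly_mul_comm, Matrix.mul_assoc, h1, Matrix.mul_one,
    Matrix.charpoly_diagonal]

theorem spectrum_eq_range_of_charpoly {M : Matrix (Fin n) (Fin n) ℂ} {d : Fin n → ℂ}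
    (h : M.charpoly = ∏ a, (X - C (d a))) : spectrum ℂ M = Set.range d := by
  ext z
  rw [Matrix.mem_spectrum_iff_isRoot_charpoly, h, Polynomial.IsRoot, Polynomial.eval_prod,
    Finset.prod_eq_zero_iff]
  simp [sub_eq_zero, eq_comm]

theorem newtonSum_charpoly_of_normal {M : Matrix (Fin n) (Fin n) ℂ} (hM : M * Mᴴ = Mᴴ * M) (i : ℕ) :
    newtonSum M.charpoly i = (M ^ i).trace := by
  obtain ⟨W, d, h1, h2, h3⟩ := exists_unitary_diagonal_of_normal hM
  rw [charpoly_eq_prod_of_diagonal h1 h3, newtonSum_prod_X_sub_C]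
  have hpow : M ^ i * W = W * Matrix.diagonal d ^ i := by
    induction i with
    | zero => simp
    | succ i ih => rw [pow_succ, Matrix.mul_assoc, h3, ← Matrix.mul_assoc, ih, Matrix.mul_assoc,
        ← pow_succ]
  have h4 : M ^ i = W * Matrix.diagonal d ^ i * Wᴴ := by
    rw [← hpow, Matrix.mul_assoc, h2, Matrix.mul_one]
  rw [h4, Matrix.trace_mul_comm, ← Matrix.mul_assoc, h1, Matrix.one_mul, Matrix.diagonal_pow,
    Matrix.trace_diagonal]
  rfl

/-- The minors as Gram determinants of the distinct roots. -/
theorem bezoutiantMinor_eq_det (d : Fin n → ℂ) (k : ℕ) {s : ℕ} (μ : Fin s → ℂ)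
    (hμ : Function.Injective μ) (hd : Set.range d = Set.range μ) :
    ∃ c : Fin s → ℂ, (∀ a, c a ≠ 0 ∧ ‖c a‖ ≤ n) ∧
      bezoutiantMinor k (∏ a, (X - C (d a))) =
        ((Matrix.of fun (i : Fin k) (a : Fin s) => μ a ^ (i : ℕ) * c a) *
          (Matrix.of fun (a : Fin s) (j : Fin k) => μ a ^ (j : ℕ))).det := by
  classical
  refine ⟨fun a => ((Finset.univ.filter fun x => d x = μ a).card : ℂ), fun a => ⟨?_, ?_⟩, ?_⟩
  · have : μ a ∈ Set.range d := hd ▸ ⟨a, rfl⟩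
    obtain ⟨x, hx⟩ := this
    have : (Finset.univ.filter fun x => d x = μ a).card ≠ 0 :=
      Finset.card_ne_zero_of_mem (a := x) (by simp [hx])
    exact Nat.cast_ne_zero.2 this
  · rw [Complex.norm_natCast]
    exact_mod_cast (Finset.card_le_univ _).trans (by simp)
  · rw [bezoutiantMinor]
    congr 1
    ext i j
    rw [Matrix.of_apply, newtonSum_prod_X_sub_C, Matrix.mul_apply]
    have hx : ∀ x, ∃ a, μ a = d x := fun x => by
      have : d x ∈ Set.range μ := hd ▸ ⟨x, rfl⟩
      exact this
    choose g hg using hx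
    have hfib : ∀ a, (Finset.univ.filter fun x => d x = μ a) = Finset.univ.filter fun x => g x = a := by
      intro a
      ext x
      simp [← hg x, hμ.eq_iff]
    rw [← Finset.sum_fiberwise (s := Finset.univ) (g := g)]
    refine Finset.sum_congr rfl fun a _ => ?_
    rw [Finset.sum_congr rfl (g := fun _ => μ a ^ ((i : ℕ) + (j : ℕ)))]
    · simp only [Finset.sum_const, hfib, nsmul_eq_mul, Matrix.of_apply, pow_add]
      ring
    · intro x hx
      rw [← hg x, (Finset.mem_filter.1 hx).2]

theorem exists_fin_enumeration {S : Set ℂ} (hS : S.Finite) :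
    ∃ μ : Fin S.ncard → ℂ, Function.Injective μ ∧ Set.range μ = S := by
  classical
  rw [Set.ncard_eq_toFinset_card S hS]
  refine ⟨fun a => (hS.toFinset.equivFin.symm a : ℂ), ?_, ?_⟩
  · exact Subtype.val_injective.comp (Equiv.injective _)
  · ext z
    constructor
    · rintro ⟨a, rfl⟩
      exact hS.mem_toFinset.1 (hS.toFinset.equivFin.symm a).2
    · intro hz
      exact ⟨hS.toFinset.equivFin ⟨z, hS.mem_toFinset.2 hz⟩, by simp⟩

theorem bezoutiantMinor_eq_zero {d : Fin n → ℂ} {k : ℕ} (hk : (Set.range d).ncard < k) :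
    bezoutiantMinor k (∏ a, (X - C (d a))) = 0 := by
  obtain ⟨μ, hμ, hr⟩ := exists_fin_enumeration (Set.finite_range d)
  obtain ⟨c, -, h⟩ := bezoutiantMinor_eq_det d k μ hμ hr.symm
  rw [h]
  by_contra hne
  have h1 := Matrix.rank_of_isUnit _ ((Matrix.isUnit_iff_isUnit_det _).2 (isUnit_iff_ne_zero.2 hne))
  rw [Fintype.card_fin] at h1
  have h2 := (Matrix.rank_mul_le_left (Matrix.of fun (i : Fin k) a => μ a ^ (i : ℕ) * c a)
    (Matrix.of fun a (j : Fin k) => μ a ^ (j : ℕ))).trans (Matrix.rank_le_card_width _)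
  rw [h1, Fintype.card_fin] at h2
  omega

theorem bezoutiantMinor_eq_vandermonde (d : Fin n → ℂ) {s : ℕ} (μ : Fin s → ℂ)
    (hμ : Function.Injective μ) (hd : Set.range d = Set.range μ) :
    ∃ c : Fin s → ℂ, (∀ a, c a ≠ 0 ∧ ‖c a‖ ≤ n) ∧
      bezoutiantMinor s (∏ a, (X - C (d a))) = (∏ a, c a) * (Matrix.vandermonde μ).det ^ 2 := by
  obtain ⟨c, hc, h⟩ := bezoutiantMinor_eq_det d s μ hμ hd
  refine ⟨c, hc, ?_⟩
  have h1 : (Matrix.of fun (i : Fin s) (a : Fin s) => μ a ^ (i : ℕ) * c a) =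
      (Matrix.vandermonde μ)ᵀ * Matrix.diagonal c := by
    ext i a
    simp [Matrix.mul_diagonal, Matrix.vandermonde_apply]
  have h2 : (Matrix.of fun (a : Fin s) (j : Fin s) => μ a ^ (j : ℕ)) = Matrix.vandermonde μ := by
    ext a j
    simp [Matrix.vandermonde_apply]
  rw [h, h1, h2, Matrix.det_mul, Matrix.det_mul, Matrix.det_transpose, Matrix.det_diagonal]
  ring

theorem bezoutiantMinor_ne_zero {d : Fin n → ℂ} :
    bezoutiantMinor (Set.range d).ncard (∏ a, (X - C (d a))) ≠ 0 := by
  obtain ⟨μ, hμ, hr⟩ := exists_fin_enumeration (Set.finite_range d)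
  obtain ⟨c, hc, h⟩ := bezoutiantMinor_eq_vandermonde d μ hμ hr.symm
  rw [h]
  exact mul_ne_zero (Finset.prod_ne_zero_iff.2 fun a _ => (hc a).1)
    (pow_ne_zero _ (Matrix.det_vandermonde_ne_zero_iff.2 hμ))

theorem norm_prod_le_of_exists_le {ι : Type*} (S : Finset ι) (f : ι → ℂ) {B δ : ℝ} (hB : 1 ≤ B)
    (hf : ∀ i ∈ S, ‖f i‖ ≤ B) (hδ : ∃ i ∈ S, ‖f i‖ ≤ δ) : ‖∏ i ∈ S, f i‖ ≤ δ * B ^ S.card := by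
  classical
  obtain ⟨i, hi, hiδ⟩ := hδ
  rw [← Finset.mul_prod_erase S f hi, norm_mul]
  have h1 : ‖∏ x ∈ S.erase i, f x‖ ≤ B ^ S.card := by
    rw [norm_prod]
    calc ∏ x ∈ S.erase i, ‖f x‖ ≤ ∏ x ∈ S.erase i, B :=
          Finset.prod_le_prod (fun _ _ => norm_nonneg _) fun x hx => hf x (Finset.mem_of_mem_erase hx)
      _ = B ^ (S.erase i).card := Finset.prod_const _
      _ ≤ B ^ S.card := pow_le_pow_right₀ hB (Finset.card_le_card (Finset.erase_subset _ _))
  exact mul_le_mul hiδ h1 (norm_nonneg _) ((norm_nonneg _).trans hiδ)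

/-- The minor `Δ_s`, for `s` the number of distinct roots, is small if two roots are close. -/
theorem norm_bezoutiantMinor_le (n s : ℕ) {R : ℝ} (hR : 0 ≤ R) : ∃ K : ℝ, ∀ d : Fin n → ℂ,
    (Set.range d).ncard = s → (∀ a, ‖d a‖ ≤ R) → ∀ δ ≤ 1, ∀ x ∈ Set.range d, ∀ y ∈ Set.range d,
      x ≠ y → ‖x - y‖ ≤ δ → ‖bezoutiantMinor s (∏ a, (X - C (d a)))‖ ≤ K * δ := by
  set B : ℝ := 2 * R + 1
  have hB : 1 ≤ B := by simp only [B]; linarith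
  set T : Finset ((_ : Fin s) × Fin s) := Finset.univ.sigma fun i => Finset.Ioi i
  refine ⟨(n : ℝ) ^ s * (B ^ T.card) ^ 2, fun d hs hd δ hδ1 x hx y hy hne hxy => ?_⟩
  obtain ⟨μ, hμ, hr⟩ : ∃ μ : Fin s → ℂ, Function.Injective μ ∧ Set.range μ = Set.range d := by
    rw [← hs]; exact exists_fin_enumeration (Set.finite_range d)
  obtain ⟨c, hc, h⟩ := bezoutiantMinor_eq_vandermonde d μ hμ hr.symm
  have hμR : ∀ a, ‖μ a‖ ≤ R := fun a => by
    obtain ⟨i, hi⟩ : μ a ∈ Set.range d := hr ▸ ⟨a, rfl⟩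
    rw [← hi]; exact hd i
  have hdet : ‖(Matrix.vandermonde μ).det‖ ≤ δ * B ^ T.card := by
    rw [Matrix.det_vandermonde, Finset.prod_sigma' Finset.univ (fun i => Finset.Ioi i)
      fun i j => μ j - μ i]
    refine norm_prod_le_of_exists_le _ _ hB ?_ ?_
    · intro p _
      refine (norm_sub_le _ _).trans ?_
      have := hμR p.1
      have := hμR p.2
      simp only [B]
      linarith
    · rw [← hr] at hx hy
      obtain ⟨a, rfl⟩ := hx
      obtain ⟨b, rfl⟩ := hy
      have hab : a ≠ b := fun h => hne (by rw [h])
      rcases lt_or_gt_of_ne hab with h | h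
      · exact ⟨⟨a, b⟩, by simp [h], by rwa [norm_sub_rev]⟩
      · exact ⟨⟨b, a⟩, by simpa using h, hxy⟩
  have hδ0 : 0 ≤ δ := (norm_nonneg _).trans hxy
  have hprod : ‖∏ a, c a‖ ≤ (n : ℝ) ^ s := by
    rw [norm_prod]
    calc ∏ a, ‖c a‖ ≤ ∏ _a : Fin s, (n : ℝ) :=
          Finset.prod_le_prod (fun _ _ => norm_nonneg _) fun a _ => (hc a).2
      _ = (n : ℝ) ^ s := by simp
  have hBT : 0 ≤ B ^ T.card := pow_nonneg (by linarith) _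
  rw [h, norm_mul, norm_pow]
  calc ‖∏ a, c a‖ * ‖(Matrix.vandermonde μ).det‖ ^ 2
      ≤ (n : ℝ) ^ s * (δ * B ^ T.card) ^ 2 := by gcongr
    _ = (n : ℝ) ^ s * (B ^ T.card) ^ 2 * (δ * δ) := by ring
    _ ≤ (n : ℝ) ^ s * (B ^ T.card) ^ 2 * (δ * 1) := by gcongr
    _ = _ := by rw [mul_one]

end Bezoutiant

/-! ### Exclusion of eigenvalues in infinite contact -/

section Contact

variable {n : ℕ} {t₀ : ℝ} {A : ℝ → Matrix (Fin n) (Fin n) ℂ}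

theorem multiplicityAt_eq_top_of_norm_le {f : ℝ → ℂ} (hf : ∀ᶠ t in 𝓝 t₀, ContinuousAt f t)
    (h : ∀ N : ℕ, ∃ K : ℝ, ∀ᶠ t in 𝓝[≠] t₀, ‖f t‖ ≤ K * |t - t₀| ^ N) :
    multiplicityAt t₀ f = ⊤ := by
  have hlim : ∀ K : ℝ, Tendsto (fun t => K * |t - t₀|) (𝓝[≠] t₀) (𝓝 0) := fun K => by
    have : Tendsto (fun t => K * |t - t₀|) (𝓝 t₀) (𝓝 (K * |t₀ - t₀|)) :=
      (by fun_prop : Continuous fun t => K * |t - t₀|).tendsto t₀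
    rw [sub_self, abs_zero, mul_zero] at this
    exact this.mono_left nhdsWithin_le_nhds
  have hf0 : f t₀ = 0 := by
    obtain ⟨K, hK⟩ := h 1
    refine tendsto_nhds_unique (hf.self_of_nhds.tendsto.mono_left nhdsWithin_le_nhds)
      (squeeze_zero_norm' ?_ (hlim K))
    filter_upwards [hK] with t ht using by simpa using ht
  refine ENat.eq_top_iff_forall_ge.2 fun N => ?_
  classical
  set g : ℝ → ℂ := fun t => if t = t₀ then 0 else (((t - t₀ : ℝ) : ℂ) ^ N)⁻¹ * f t with hg
  refine le_iSup₂_of_le N ⟨g, ?_, ?_⟩ le_rfl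
  · filter_upwards [hf] with t ht
    by_cases h0 : t = t₀
    · subst h0
      rw [continuousAt_iff_punctured_nhds]
      obtain ⟨K, hK⟩ := h (N + 1)
      have : g t = 0 := by simp [hg]
      rw [this]
      refine squeeze_zero_norm' ?_ (hlim K)
      filter_upwards [hK, self_mem_nhdsWithin] with u hu hne
      have hpos : 0 < |u - t| ^ N := pow_pos (abs_pos.2 (sub_ne_zero.2 hne)) _
      have hgu : g u = (((u - t : ℝ) : ℂ) ^ N)⁻¹ * f u := if_neg hne
      rw [hgu, norm_mul, norm_inv, norm_pow, Complex.norm_real, Real.norm_eq_abs,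
        inv_mul_le_iff₀ hpos]
      calc ‖f u‖ ≤ _ := hu
        _ = _ := by ring
    · have h1 : ContinuousAt (fun t => (((t - t₀ : ℝ) : ℂ) ^ N)⁻¹ * f t) t := by
        refine ContinuousAt.mul (ContinuousAt.inv₀ (by fun_prop) ?_) ht
        exact pow_ne_zero _ (by exact_mod_cast sub_ne_zero.2 h0)
      refine h1.congr ?_
      filter_upwards [isOpen_ne.mem_nhds h0] with u hu
      exact (if_neg hu).symm
  · refine Eventually.of_forall fun t => ?_
    by_cases h0 : t = t₀
    · simp [hg, h0, hf0]
    · simp only [hg, h0, if_false]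
      rw [mul_inv_cancel_left₀]
      exact pow_ne_zero _ (by exact_mod_cast sub_ne_zero.2 h0)

/-- At a point where the multiplicity of the leading minor is finite, there are no eigenvalues
besides the separated branches. -/
theorem HasBranches.ncard_le {θ b : ℕ} {I : Set ℝ} (hb : HasBranches t₀ θ A b)
    (hc : ∀ᶠ t in 𝓝 t₀, ContinuousAt A t)
    (hA : ∀ᶠ t in 𝓝 t₀, A t * (A t)ᴴ = (A t)ᴴ * A t) (ht₀ : t₀ ∈ I)
    (hE : t₀ ∉ infiniteContactSet (fun t => (A t).charpoly) I) :
    ∀ᶠ t in 𝓝 t₀, (spectrum ℂ (A t)).ncard ≤ b := by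
  classical
  have hdiag : ∀ᶠ t in 𝓝 t₀, ∃ d : Fin n → ℂ, (A t).charpoly = ∏ a, (X - C (d a)) ∧
      spectrum ℂ (A t) = Set.range d := by
    filter_upwards [hA] with t ht
    obtain ⟨W, d, h1, h2, h3⟩ := exists_unitary_diagonal_of_normal ht
    have := charpoly_eq_prod_of_diagonal h1 h3
    exact ⟨d, this, spectrum_eq_range_of_charpoly this⟩
  have hcard : ∀ d : Fin n → ℂ, (Set.range d).ncard ≤ n := fun d => by
    rw [← Set.image_univ]
    refine (Set.ncard_image_le).trans ?_
    simp
  set p : ℕ → Prop := fun k => ¬ ∀ᶠ t in 𝓝 t₀, bezoutiantMinor k (A t).charpoly = 0 with hp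
  have hp0 : p 0 := by
    intro h
    have := h.self_of_nhds
    simp [bezoutiantMinor] at this
  set s := Nat.findGreatest p n with hs
  have hps : p s := Nat.findGreatest_spec (Nat.zero_le n) hp0
  have hgt : ∀ k, s < k → ∀ᶠ t in 𝓝 t₀, bezoutiantMinor k (A t).charpoly = 0 := by
    intro k hk
    by_cases hkn : k ≤ n
    · exact not_not.1 (Nat.findGreatest_is_greatest hk hkn)
    · filter_upwards [hdiag] with t ⟨d, h1, h2⟩
      rw [h1]
      exact bezoutiantMinor_eq_zero ((hcard d).trans_lt (not_le.1 hkn))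
  have hle : ∀ᶠ t in 𝓝 t₀, (spectrum ℂ (A t)).ncard ≤ s := by
    have hall : ∀ᶠ t in 𝓝 t₀, ∀ k ∈ Finset.Ioc s n, bezoutiantMinor k (A t).charpoly = 0 :=
      (eventually_all_finset _).2 fun k hk => hgt k (Finset.mem_Ioc.1 hk).1
    filter_upwards [hdiag, hall] with t ⟨d, h1, h2⟩ h3
    by_contra! hlt
    rw [h2] at hlt
    have := h3 _ (Finset.mem_Ioc.2 ⟨hlt, hcard d⟩)
    rw [h1] at this
    exact bezoutiantMinor_ne_zero this
  -- if `s > b`, then `s` distinct eigenvalues contain two that are close to infinite order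
  suffices hsb : s ≤ b from hle.mono fun t ht => ht.trans hsb
  by_contra! hbs
  refine hE ⟨ht₀, s, hps, hgt, ?_⟩
  have hcont : ∀ᶠ t in 𝓝 t₀, ContinuousAt (fun u => bezoutiantMinor s (A u).charpoly) t := by
    filter_upwards [hc, hA.eventually_nhds] with t e1 e2
    have h1 : ContinuousAt (fun u => (Matrix.of fun i j : Fin s =>
        (A u ^ ((i : ℕ) + (j : ℕ))).trace).det) t := by
      refine (continuous_id.matrix_det).continuousAt.comp (continuousAt_matrix_iff.2 fun i j => ?_)
      exact (continuous_id.matrix_trace).continuousAt.comp (e1.pow _)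
    refine h1.congr ?_
    filter_upwards [e2] with u hu
    simp only [bezoutiantMinor, newtonSum_charpoly_of_normal hu]
  have hbdd : ∀ᶠ t in 𝓝 t₀, ‖A t‖ < ‖A t₀‖ + 1 :=
    hc.self_of_nhds.norm.tendsto.eventually (gt_mem_nhds (lt_add_one _))
  set R : ℝ := (‖A t₀‖ + 1) * ‖(1 : Matrix (Fin n) (Fin n) ℂ)‖ with hR
  obtain ⟨K, hK⟩ := norm_bezoutiantMinor_le n s (R := R) (by positivity)
  refine multiplicityAt_eq_top_of_norm_le hcont fun N => ⟨max K 0, ?_⟩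
  have hone : ∀ᶠ t in 𝓝 t₀, |t - t₀| < 1 := by
    have : Tendsto (fun t => |t - t₀|) (𝓝 t₀) (𝓝 |t₀ - t₀|) :=
      (by fun_prop : Continuous fun t => |t - t₀|).tendsto t₀
    rw [sub_self, abs_zero] at this
    exact this.eventually (gt_mem_nhds one_pos)
  filter_upwards [hb.exists_close N, nhdsWithin_le_nhds hdiag, nhdsWithin_le_nhds hbdd,
    nhdsWithin_le_nhds hone, nhdsWithin_le_nhds hle] with t h1 ⟨d, h2, h3⟩ h4 h5 h6
  rw [h3] at h6
  rcases h6.lt_or_eq with h7 | h7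
  · rw [h2, bezoutiantMinor_eq_zero h7, norm_zero]
    positivity
  · have hfin : (Set.range d).Finite := Set.finite_range d
    obtain ⟨x, hx, y, hy, hne, hxy⟩ := h1 hfin.toFinset (by simp [h3])
      (by rw [← Set.ncard_eq_toFinset_card _ hfin, h7]; exact hbs)
    rw [h2]
    refine (hK d h7 (fun a => ?_) _ (pow_le_one₀ (abs_nonneg _) h5.le) x (by simpa using hx) y
      (by simpa using hy) hne hxy).trans ?_
    · have : d a ∈ spectrum ℂ (A t) := h3 ▸ ⟨a, rfl⟩
      refine (spectrum.norm_le_norm_mul_of_mem this).trans ?_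
      rw [hR]
      gcongr
    · gcongr
      exact le_max_left _ _

end Contact

/-! ### Gluing local sections over an interval -/

section Gluing

variable {F : Type*}

/-- Over the point `τ`, two sections with the local property `Good` can be glued, on either side. -/
def CanGlueAt (Good : (ℝ → F) → ℝ → Prop) (τ : ℝ) : Prop :=
  ∀ s s', Good s τ → Good s' τ →
    (∃ s'', (∀ t ≤ τ, s'' t = s t) ∧ ∀ t, τ ≤ t → Good s' t → Good s'' t) ∧
    ∃ s'', (∀ t, τ ≤ t → s'' t = s t) ∧ ∀ t ≤ τ, Good s' t → Good s'' t

variable {Good : (ℝ → F) → ℝ → Prop} {I : Set ℝ}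

theorem exists_good_uIcc (hcongr : ∀ {s s' : ℝ → F} {t}, s' =ᶠ[𝓝 t] s → Good s t → Good s' t)
    (hopen : ∀ {s t}, Good s t → ∀ᶠ u in 𝓝 t, Good s u) (hI' : I.OrdConnected)
    (hlocal : ∀ t ∈ I, ∃ s, Good s t)
    (hglue : ∀ t ∈ I, ∀ᶠ τ in 𝓝[≠] t, CanGlueAt Good τ) {x y : ℝ} (hx : x ∈ I) (hy : y ∈ I) :
    ∃ s, ∀ t ∈ Set.uIcc x y, Good s t := by
  refine IsPreconnected.induction₂' hI'.isPreconnected (fun x y => ∃ s, ∀ t ∈ Set.uIcc x y, Good s t)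
    ?_ ?_ hx hy
  · intro x hx
    obtain ⟨s, hs⟩ := hlocal x hx
    obtain ⟨ε, hε, h⟩ := Metric.eventually_nhds_iff_ball.1 (hopen hs)
    filter_upwards [mem_nhdsWithin_of_mem_nhds (Metric.ball_mem_nhds x hε)] with y hy
    have hsub : Set.uIcc x y ⊆ Metric.ball x ε := by
      rw [Real.ball_eq_Ioo] at hy ⊢
      exact Set.OrdConnected.uIcc_subset inferInstance
        (show x ∈ Set.Ioo (x - ε) (x + ε) from ⟨by linarith, by linarith⟩) hy
    exact ⟨⟨s, fun t ht => h t (hsub ht)⟩, ⟨s, fun t ht => h t (hsub (Set.uIcc_comm x y ▸ ht))⟩⟩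
  · intro x y z hx hy hz hxy hyz
    wlog hxz : x ≤ z generalizing x z
    · have := this z x hz hx (by simpa [Set.uIcc_comm] using hyz)
        (by simpa [Set.uIcc_comm] using hxy) (le_of_not_ge hxz)
      simpa [Set.uIcc_comm] using this
    obtain ⟨s, hs⟩ := hxy
    obtain ⟨s', hs'⟩ := hyz
    rcases le_or_gt y x with h | hxy
    · refine ⟨s', fun t ht => hs' t ?_⟩
      rw [Set.uIcc_of_le hxz] at ht
      rw [Set.uIcc_of_le (h.trans hxz)]
      exact ⟨h.trans ht.1, ht.2⟩
    rcases le_or_gt z y with h | hyz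
    · refine ⟨s, fun t ht => hs t ?_⟩
      rw [Set.uIcc_of_le hxz] at ht
      rw [Set.uIcc_of_le (hxz.trans h)]
      exact ⟨ht.1, ht.2.trans h⟩
    rw [Set.uIcc_of_le hxy.le] at hs
    rw [Set.uIcc_of_le hyz.le] at hs'
    rw [Set.uIcc_of_le hxz]
    -- the gluing takes place at a point slightly to the right of `y`
    obtain ⟨ε, hε, hball⟩ := Metric.eventually_nhds_iff_ball.1 (hopen (hs y ⟨hxy.le, le_rfl⟩))
    have h1 : ∀ᶠ τ in 𝓝[>] y, CanGlueAt Good τ ∧ τ ∈ Set.Ioo y (min z (y + ε)) :=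
      ((hglue y hy).filter_mono (nhdsWithin_mono _ fun _ h => ne_of_gt h)).and
        (Ioo_mem_nhdsGT (lt_min hyz (by linarith)))
    obtain ⟨τ, hτ, hτ1, hτ2⟩ := h1.exists
    obtain ⟨hτz, hτε⟩ := lt_min_iff.1 hτ2
    have hsτ : ∀ t, x ≤ t → t ≤ τ → Good s t := fun t h1 h2 => by
      rcases le_or_gt t y with h | h
      · exact hs t ⟨h1, h⟩
      · refine hball t ?_
        rw [Real.ball_eq_Ioo]
        exact ⟨by linarith, by linarith⟩
    obtain ⟨⟨s'', h2, h3⟩, -⟩ := hτ s s' (hsτ τ (by linarith) le_rfl) (hs' τ ⟨hτ1.le, hτz.le⟩)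
    refine ⟨s'', fun t ht => ?_⟩
    rcases lt_or_ge t τ with h | h
    · exact hcongr (by filter_upwards [Iio_mem_nhds h] with u hu using h2 u (le_of_lt hu))
        (hsτ t ht.1 h.le)
    · exact h3 t h (hs' t ⟨by linarith, ht.2⟩)

theorem exists_canGlueAt_gt (hI : IsOpen I) (hglue : ∀ t ∈ I, ∀ᶠ τ in 𝓝[≠] t, CanGlueAt Good τ) :
    ∀ x ∈ I, ∃ τ ∈ I, x < τ ∧ CanGlueAt Good τ := fun x hx => by
  have h1 : ∀ᶠ τ in 𝓝[>] x, τ ∈ I ∧ CanGlueAt Good τ ∧ τ ∈ Set.Ioi x :=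
    ((hI.eventually_mem hx).filter_mono nhdsWithin_le_nhds).and
      (((hglue x hx).filter_mono (nhdsWithin_mono _ fun _ h => ne_of_gt h)).and
        self_mem_nhdsWithin)
  obtain ⟨τ, h1, h2, h3⟩ := h1.exists
  exact ⟨τ, h1, h3, h2⟩

/-- A section over a compact interval extends, unchanged, to one over a larger interval that contains a
prescribed point. -/
theorem exists_good_extension
    (hcongr : ∀ {s s' : ℝ → F} {t}, s' =ᶠ[𝓝 t] s → Good s t → Good s' t)
    (hI : IsOpen I) (hglue : ∀ t ∈ I, ∀ᶠ τ in 𝓝[≠] t, CanGlueAt Good τ)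
    (hIcc : ∀ {x y}, x ∈ I → y ∈ I → x ≤ y → ∃ s, ∀ t ∈ Set.Icc x y, Good s t)
    {a b q : ℝ} {s : ℝ → F} (ha : a ∈ I) (hb : b ∈ I) (hab : a < b) (hga : CanGlueAt Good a)
    (hgb : CanGlueAt Good b) (hs : ∀ t ∈ Set.Icc a b, Good s t) (hq : q ∈ I) :
    ∃ a' b' s', a' ∈ I ∧ b' ∈ I ∧ a' < a ∧ b < b' ∧ q ∈ Set.Icc a' b' ∧ CanGlueAt Good a' ∧
      CanGlueAt Good b' ∧ (∀ t ∈ Set.Icc a' b', Good s' t) ∧ ∀ t ∈ Set.Icc a b, s' t = s t := by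
  have hright := exists_canGlueAt_gt hI hglue
  have hleft : ∀ x ∈ I, ∃ a' ∈ I, a' < x ∧ CanGlueAt Good a' := fun x hx => by
    have h1 : ∀ᶠ τ in 𝓝[<] x, τ ∈ I ∧ CanGlueAt Good τ ∧ τ ∈ Set.Iio x :=
      ((hI.eventually_mem hx).filter_mono nhdsWithin_le_nhds).and
        (((hglue x hx).filter_mono (nhdsWithin_mono _ fun _ h => ne_of_lt h)).and
          self_mem_nhdsWithin)
    obtain ⟨τ, h1, h2, h3⟩ := h1.exists
    exact ⟨τ, h1, h3, h2⟩
  obtain ⟨b', hb', hlt', hgb'⟩ := hright (max b q) (by rcases max_choice b q with h | h <;> rwa [h])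
  obtain ⟨a', ha', hlt, hga'⟩ := hleft (min a q) (by rcases min_choice a q with h | h <;> rwa [h])
  obtain ⟨hbb', hqb'⟩ := max_lt_iff.1 hlt'
  obtain ⟨haa', hqa'⟩ := lt_min_iff.1 hlt
  obtain ⟨r, hr⟩ := hIcc hb hb' hbb'.le
  obtain ⟨l, hl⟩ := hIcc ha' ha haa'.le
  obtain ⟨⟨s₁, h1, h2⟩, -⟩ := hgb s r (hs b ⟨hab.le, le_rfl⟩) (hr b ⟨le_rfl, hbb'.le⟩)
  have hs₁ : ∀ t ∈ Set.Icc a b', Good s₁ t := fun t ht => by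
    rcases lt_or_ge t b with h | h
    · exact hcongr (by filter_upwards [Iio_mem_nhds h] with u hu using h1 u (le_of_lt hu))
        (hs t ⟨ht.1, h.le⟩)
    · exact h2 t h (hr t ⟨h, ht.2⟩)
  obtain ⟨-, s₂, h3, h4⟩ := hga s₁ l (hs₁ a ⟨le_rfl, (hab.trans hbb').le⟩) (hl a ⟨haa'.le, le_rfl⟩)
  refine ⟨a', b', s₂, ha', hb', haa', hbb', ⟨hqa'.le, hqb'.le⟩, hga', hgb', fun t ht => ?_,
    fun t ht => by rw [h3 t ht.1, h1 t ht.2]⟩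
  rcases lt_or_ge a t with h | h
  · exact hcongr (by filter_upwards [Ioi_mem_nhds h] with u hu using h3 u (le_of_lt hu))
      (hs₁ t ⟨h.le, ht.2⟩)
  · exact h4 t h (hl t ⟨ht.1, h⟩)

/-- If sections exist locally on an open interval and can be glued at all points of it except for a
discrete set, then there is a section on the whole interval. -/
theorem exists_good_of_local
    (hcongr : ∀ {s s' : ℝ → F} {t}, s' =ᶠ[𝓝 t] s → Good s t → Good s' t)
    (hopen : ∀ {s t}, Good s t → ∀ᶠ u in 𝓝 t, Good s u) (hI : IsOpen I) (hI' : I.OrdConnected)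
    (hne : I.Nonempty) (hlocal : ∀ t ∈ I, ∃ s, Good s t)
    (hglue : ∀ t ∈ I, ∀ᶠ τ in 𝓝[≠] t, CanGlueAt Good τ) : ∃ s, ∀ t ∈ I, Good s t := by
  have hIcc : ∀ {x y}, x ∈ I → y ∈ I → x ≤ y → ∃ s, ∀ t ∈ Set.Icc x y, Good s t :=
    fun {x y} hx hy hxy => by
      simpa only [Set.uIcc_of_le hxy] using exists_good_uIcc hcongr hopen hI' hlocal hglue hx hy
  have : Nonempty I := hne.to_subtype
  set q : ℕ → I := TopologicalSpace.denseSeq I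
  have hq : ∀ U : Set ℝ, IsOpen U → (I ∩ U).Nonempty → ∃ k, (q k : ℝ) ∈ U := fun U hU ⟨x, hx, hxU⟩ => by
    obtain ⟨_, hy, k, rfl⟩ := (TopologicalSpace.denseRange_denseSeq I).inter_open_nonempty _
      (hU.preimage continuous_subtype_val) ⟨⟨x, hx⟩, hxU⟩
    exact ⟨k, hy⟩
  let St := {x : ℝ × ℝ × (ℝ → F) // x.1 ∈ I ∧ x.2.1 ∈ I ∧ x.1 < x.2.1 ∧ CanGlueAt Good x.1 ∧
    CanGlueAt Good x.2.1 ∧ ∀ t ∈ Set.Icc x.1 x.2.1, Good x.2.2 t}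
  have hstep : ∀ (k : ℕ) (x : St), ∃ y : St, y.1.1 < x.1.1 ∧ x.1.2.1 < y.1.2.1 ∧
      (q k : ℝ) ∈ Set.Icc y.1.1 y.1.2.1 ∧ ∀ t ∈ Set.Icc x.1.1 x.1.2.1, y.1.2.2 t = x.1.2.2 t := by
    rintro k ⟨⟨a, b, s⟩, ha, hb, hab, hga, hgb, hs⟩
    obtain ⟨a', b', s', ha', hb', haa', hbb', hq, hga', hgb', hs', h⟩ :=
      exists_good_extension hcongr hI hglue hIcc ha hb hab hga hgb hs (q k).2
    exact ⟨⟨⟨a', b', s'⟩, ha', hb', haa'.trans (hab.trans hbb'), hga', hgb', hs'⟩, haa', hbb', hq, h⟩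
  have hpt := exists_canGlueAt_gt hI hglue
  obtain ⟨c, hc⟩ := hne
  obtain ⟨a, ha, -, hga⟩ := hpt c hc
  obtain ⟨b, hb, hab, hgb⟩ := hpt a ha
  obtain ⟨s₀, hs₀⟩ := hIcc ha hb hab.le
  choose step hstep1 hstep2 hstep3 hstep4 using hstep
  let x : ℕ → St := fun k => Nat.rec ⟨⟨a, b, s₀⟩, ha, hb, hab, hga, hgb, hs₀⟩ step k
  have hx : ∀ k, x (k + 1) = step k (x k) := fun k => rfl
  have hanti : ∀ {k l}, k ≤ l → (x l).1.1 ≤ (x k).1.1 := fun {k l} h =>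
    antitone_nat_of_succ_le (f := fun k => (x k).1.1) (fun k => hx k ▸ (hstep1 k (x k)).le) h
  have hmono : ∀ {k l}, k ≤ l → (x k).1.2.1 ≤ (x l).1.2.1 := fun {k l} h =>
    monotone_nat_of_le_succ (f := fun k => (x k).1.2.1) (fun k => hx k ▸ (hstep2 k (x k)).le) h
  have hagree : ∀ {k l}, k ≤ l → ∀ t ∈ Set.Icc (x k).1.1 (x k).1.2.1,
      (x l).1.2.2 t = (x k).1.2.2 t := fun {k l} h t ht => by
    induction l, h using Nat.le_induction with
    | base => rfl
    | succ l hl ih =>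
      rw [← ih, hx]
      exact hstep4 l (x l) t ⟨(hanti hl).trans ht.1, ht.2.trans (hmono hl)⟩
  have hcover : ∀ t ∈ I, ∃ k, t ∈ Set.Ioo (x k).1.1 (x k).1.2.1 := fun t ht => by
    obtain ⟨u, hu, htu, -⟩ := hpt t ht
    obtain ⟨k, hk⟩ := hq (Set.Ioi t) isOpen_Ioi ⟨u, hu, htu⟩
    obtain ⟨u', hu', htu'⟩ : ∃ u', u' ∈ I ∧ u' ∈ Set.Iio t :=
      (((hI.eventually_mem ht).filter_mono nhdsWithin_le_nhds).and
        (self_mem_nhdsWithin : Set.Iio t ∈ 𝓝[<] t)).exists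
    obtain ⟨l, hl⟩ := hq (Set.Iio t) isOpen_Iio ⟨u', hu', htu'⟩
    refine ⟨max k l + 1, ?_, ?_⟩
    · exact ((hanti (by omega : l + 1 ≤ max k l + 1)).trans (hstep3 l (x l)).1).trans_lt hl
    · exact lt_of_lt_of_le hk ((hstep3 k (x k)).2.trans (hmono (by omega : k + 1 ≤ max k l + 1)))
  classical
  refine ⟨fun t => if h : ∃ k, t ∈ Set.Ioo (x k).1.1 (x k).1.2.1 then (x (Nat.find h)).1.2.2 t
    else s₀ t, fun t ht => ?_⟩
  obtain ⟨k, hk⟩ := hcover t ht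
  refine hcongr ?_ ((x k).2.2.2.2.2.2 t ⟨hk.1.le, hk.2.le⟩)
  filter_upwards [isOpen_Ioo.mem_nhds hk] with u hu
  have h : ∃ k, u ∈ Set.Ioo (x k).1.1 (x k).1.2.1 := ⟨k, hu⟩
  rw [dif_pos h]
  exact (hagree (Nat.find_min' h hu) u (Set.Ioo_subset_Icc_self (Nat.find_spec h))).symm

end Gluing

/-! ### Comparison of diagonalizations where the number of eigenvalues is constant -/

section Diagonalization

variable {n : ℕ}

/-- The columns of the unitary matrix `x.2` are eigenvectors of `M`, for the eigenvalues `x.1`. -/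
def Diagonalizes (M : Matrix (Fin n) (Fin n) ℂ) (x : (Fin n → ℂ) × Matrix (Fin n) (Fin n) ℂ) :
    Prop :=
  x.2ᴴ * x.2 = 1 ∧ M * x.2 = x.2 * Matrix.diagonal x.1

theorem exists_perm_of_prod_X_sub_C_eq {d e : Fin n → ℂ}
    (h : ∏ a, (X - C (d a)) = ∏ a, (X - C (e a))) : ∃ σ : Equiv.Perm (Fin n), ∀ i, e (σ i) = d i := by
  classical
  have h1 : ∀ f : Fin n → ℂ, (∏ a, (X - C (f a))).roots = Finset.univ.val.map f := fun f => by
    have := Polynomial.roots_multiset_prod_X_sub_C (Finset.univ.val.map f)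
    rwa [Multiset.map_map] at this
  have h2 : Finset.univ.val.map d = Finset.univ.val.map e := by rw [← h1, ← h1, h]
  have h3 : ∀ z, Fintype.card {i // d i = z} = Fintype.card {i // e i = z} := fun z => by
    have h4 := congrArg (Multiset.count z) h2
    rw [Multiset.count_map, Multiset.count_map] at h4
    rw [Fintype.card_subtype, Fintype.card_subtype]
    simp only [eq_comm (a := z)] at h4
    exact h4
  exact ⟨Equiv.ofFiberEquiv fun z => Fintype.equivOfCardEq (h3 z), Equiv.ofFiberEquiv_map _⟩

theorem eq_of_eq_of_ncard_range_le {d e : Fin n → ℂ} (h : ∀ i j, d i = d j → e i = e j)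
    (hc : (Set.range d).ncard ≤ (Set.range e).ncard) {i j : Fin n} (hij : e i = e j) :
    d i = d j := by
  obtain ⟨φ, hφ⟩ : ∃ φ : ℂ → ℂ, ∀ i, φ (d i) = e i := by
    classical
    refine ⟨fun z => if hz : ∃ i, d i = z then e hz.choose else 0, fun i => ?_⟩
    have hz : ∃ j, d j = d i := ⟨i, rfl⟩
    simp only [dif_pos hz]
    exact h _ _ hz.choose_spec
  have h1 : Set.range e = φ '' Set.range d := by
    rw [← Set.range_comp]
    exact congrArg Set.range (funext fun i => (hφ i).symm)
  rw [h1] at hc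
  have h2 := Set.injOn_of_ncard_image_eq
    (le_antisymm (Set.ncard_image_le (Set.finite_range d)) hc) (Set.finite_range d)
  exact h2 ⟨i, rfl⟩ ⟨j, rfl⟩ (by rw [hφ, hφ, hij])

variable {A : ℝ → Matrix (Fin n) (Fin n) ℂ} {τ : ℝ}

/-- Where the number of distinct eigenvalues is constant, two continuous choices of the eigenvalues
differ by a permutation. -/
theorem exists_perm_eventually_eq {d e : ℝ → Fin n → ℂ} (hd : ContinuousAt d τ)
    (he : ContinuousAt e τ) (hAd : ∀ᶠ t in 𝓝 τ, (A t).charpoly = ∏ a, (X - C (d t a)))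
    (hAe : ∀ᶠ t in 𝓝 τ, (A t).charpoly = ∏ a, (X - C (e t a)))
    (hA : ∀ᶠ t in 𝓝 τ, (spectrum ℂ (A t)).ncard = (spectrum ℂ (A τ)).ncard) :
    ∃ σ : Equiv.Perm (Fin n), ∀ᶠ t in 𝓝 τ, ∀ i, e t (σ i) = d t i := by
  obtain ⟨σ, hσ⟩ := exists_perm_of_prod_X_sub_C_eq (hAd.self_of_nhds.symm.trans hAe.self_of_nhds)
  have hdi : ∀ i, ContinuousAt (fun t => d t i) τ := continuousAt_pi.1 hd
  have hei : ∀ i, ContinuousAt (fun t => e t i) τ := continuousAt_pi.1 he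
  have h1 : ∀ᶠ t in 𝓝 τ, ∀ i j, d t i = d t j → d τ i = d τ j := by
    refine eventually_all.2 fun i => eventually_all.2 fun j => ?_
    by_cases h : d τ i = d τ j
    · exact Eventually.of_forall fun _ _ => h
    · filter_upwards [((hdi i).ne_iff_eventually_ne (hdi j)).1 h] with t ht h' using absurd h' ht
  have h2 : ∀ᶠ t in 𝓝 τ, ∀ i j, e t (σ i) = d t j → d τ i = d τ j := by
    refine eventually_all.2 fun i => eventually_all.2 fun j => ?_
    by_cases h : d τ i = d τ j
    · exact Eventually.of_forall fun _ _ => h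
    · rw [← hσ i] at h
      filter_upwards [((hei (σ i)).ne_iff_eventually_ne (hdi j)).1 h] with t ht h' using absurd h' ht
  refine ⟨σ, ?_⟩
  filter_upwards [h1, h2, hAd, hAe, hA] with t h1 h2 h3 h4 h5 i
  have h6 := spectrum_eq_range_of_charpoly h3
  obtain ⟨j, hj⟩ : e t (σ i) ∈ Set.range (d t) := by
    rw [← h6, spectrum_eq_range_of_charpoly h4]
    exact ⟨_, rfl⟩
  rw [h6, spectrum_eq_range_of_charpoly hAd.self_of_nhds] at h5
  rw [← hj]
  exact eq_of_eq_of_ncard_range_le h1 h5.le (h2 i j hj.symm).symm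

theorem Diagonalizes.reindex {M : Matrix (Fin n) (Fin n) ℂ}
    {x : (Fin n → ℂ) × Matrix (Fin n) (Fin n) ℂ} (h : Diagonalizes M x) (σ : Equiv.Perm (Fin n))
    {c : ℂ} (hc : star c * c = 1) : Diagonalizes M (x.1 ∘ σ, c • x.2.submatrix id σ) := by
  obtain ⟨h1, h2⟩ := h
  refine ⟨?_, ?_⟩
  · have h3 : (x.2.submatrix id σ)ᴴ * x.2.submatrix id σ = 1 := by
      have := congrArg (fun N => N.submatrix σ σ) h1
      rwa [Matrix.submatrix_mul _ _ _ id _ Function.bijective_id, ← Matrix.conjTranspose_submatrix,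
        Matrix.submatrix_one _ σ.injective] at this
    change (c • x.2.submatrix id σ)ᴴ * (c • x.2.submatrix id σ) = 1
    rw [Matrix.conjTranspose_smul, Matrix.smul_mul, Matrix.mul_smul, smul_smul, hc, one_smul, h3]
  · have h3 := congrArg (fun N => N.submatrix id σ) h2
    have h4 : M * x.2.submatrix id σ = x.2.submatrix id σ * Matrix.diagonal (x.1 ∘ σ) := by
      rwa [Matrix.submatrix_mul _ _ _ id _ Function.bijective_id, Matrix.submatrix_id_id,
        Matrix.submatrix_mul _ _ _ σ _ σ.bijective, Matrix.submatrix_diagonal _ _ σ.injective] at h3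
    change M * (c • x.2.submatrix id σ) = (c • x.2.submatrix id σ) * Matrix.diagonal (x.1 ∘ σ)
    rw [Matrix.mul_smul, h4, Matrix.smul_mul]

theorem Diagonalizes.mul {M : Matrix (Fin n) (Fin n) ℂ} {d : Fin n → ℂ}
    {V B : Matrix (Fin n) (Fin n) ℂ} (h : Diagonalizes M (d, V)) (hB : Bᴴ * B = 1)
    (hd : B * Matrix.diagonal d = Matrix.diagonal d * B) : Diagonalizes M (d, V * B) := by
  obtain ⟨h1, h2⟩ := h
  refine ⟨?_, ?_⟩
  · calc (V * B)ᴴ * (V * B) = Bᴴ * (Vᴴ * V) * B := by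
          simp only [Matrix.conjTranspose_mul, Matrix.mul_assoc]
      _ = 1 := by rw [h1, Matrix.mul_one, hB]
  · change M * (V * B) = V * B * Matrix.diagonal d
    rw [← Matrix.mul_assoc, h2, Matrix.mul_assoc, ← hd, Matrix.mul_assoc]

theorem Diagonalizes.charpoly_eq {M : Matrix (Fin n) (Fin n) ℂ}
    {x : (Fin n → ℂ) × Matrix (Fin n) (Fin n) ℂ} (h : Diagonalizes M x) :
    M.charpoly = ∏ a, (X - C (x.1 a)) :=
  charpoly_eq_prod_of_diagonal h.1 h.2

/-- Two unitary diagonalizations with the same eigenvalues differ by a unitary matrix that commutes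
with the diagonal one. -/
theorem Diagonalizes.conjTranspose_mul {M : Matrix (Fin n) (Fin n) ℂ} {d : Fin n → ℂ}
    {V W : Matrix (Fin n) (Fin n) ℂ} (hV : Diagonalizes M (d, V)) (hW : Diagonalizes M (d, W)) :
    (Vᴴ * W)ᴴ * (Vᴴ * W) = 1 ∧
      Vᴴ * W * Matrix.diagonal d = Matrix.diagonal d * (Vᴴ * W) := by
  obtain ⟨h1, h2⟩ := hV
  obtain ⟨h3, h4⟩ := hW
  simp only at h1 h2 h3 h4
  have h5 := mul_eq_one_comm.1 h1
  refine ⟨?_, ?_⟩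
  · calc (Vᴴ * W)ᴴ * (Vᴴ * W) = Wᴴ * (V * Vᴴ) * W := by
          simp only [Matrix.conjTranspose_mul, Matrix.conjTranspose_conjTranspose, Matrix.mul_assoc]
      _ = 1 := by rw [h5, Matrix.mul_one, h3]
  · calc Vᴴ * W * Matrix.diagonal d = Vᴴ * M * (V * Vᴴ) * W := by
          rw [h5, Matrix.mul_one, Matrix.mul_assoc, ← h4, Matrix.mul_assoc]
      _ = Vᴴ * (M * V) * Vᴴ * W := by simp only [Matrix.mul_assoc]
      _ = (Vᴴ * V) * Matrix.diagonal d * (Vᴴ * W) := by rw [h2]; simp only [Matrix.mul_assoc]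
      _ = _ := by rw [h1, Matrix.one_mul]

end Diagonalization

/-! ### The Cayley transform -/

section Cayley

open scoped ComplexOrder

variable {n : ℕ} {Y : Matrix (Fin n) (Fin n) ℂ}

theorem isUnit_one_sub_of_conjTranspose_eq_neg (hY : Yᴴ = -Y) : IsUnit (1 - Y) := by
  have h1 : (1 + Yᴴ * Y).PosDef :=
    Matrix.PosDef.one.add_posSemidef (Matrix.posSemidef_conjTranspose_mul_self Y)
  have h2 : (1 + Y) * (1 - Y) = 1 + Yᴴ * Y := by rw [hY]; noncomm_ring
  have h3 := h1.isUnit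
  rw [← h2, Matrix.isUnit_iff_isUnit_det, Matrix.det_mul] at h3
  exact (Matrix.isUnit_iff_isUnit_det _).2 (isUnit_of_mul_isUnit_right h3)

/-- The Cayley transform, which maps skew-Hermitian matrices to unitary ones. -/
noncomputable def cayley (Y : Matrix (Fin n) (Fin n) ℂ) : Matrix (Fin n) (Fin n) ℂ :=
  (1 + Y) * Ring.inverse (1 - Y)

theorem cayley_zero : cayley (0 : Matrix (Fin n) (Fin n) ℂ) = 1 := by simp [cayley]

theorem Commute.matrix_ringInverse {M N : Matrix (Fin n) (Fin n) ℂ} (h : Commute M N)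
    (hN : IsUnit N) : Commute M (Ring.inverse N) := by
  obtain ⟨u, rfl⟩ := hN
  rw [Ring.inverse_unit]
  exact h.units_inv_right

theorem conjTranspose_cayley_mul (hY : Yᴴ = -Y) : (cayley Y)ᴴ * cayley Y = 1 := by
  have h1 := isUnit_one_sub_of_conjTranspose_eq_neg hY
  have h2 : IsUnit (1 + Y) := by
    have := isUnit_one_sub_of_conjTranspose_eq_neg (Y := -Y) (by simp [hY])
    rwa [sub_neg_eq_add] at this
  have h3 : (cayley Y)ᴴ = Ring.inverse (1 + Y) * (1 - Y) := by
    rw [cayley, Matrix.conjTranspose_mul, ← Matrix.star_eq_conjTranspose, ← Ring.inverse_star]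
    simp [Matrix.star_eq_conjTranspose, hY, sub_eq_add_neg]
  have h4 : (1 - Y) * (1 + Y) = (1 + Y) * (1 - Y) := by noncomm_ring
  calc (cayley Y)ᴴ * cayley Y = Ring.inverse (1 + Y) * ((1 - Y) * (1 + Y)) * Ring.inverse (1 - Y) := by
        rw [h3, cayley]; noncomm_ring
    _ = (Ring.inverse (1 + Y) * (1 + Y)) * ((1 - Y) * Ring.inverse (1 - Y)) := by
        rw [h4]; noncomm_ring
    _ = 1 := by rw [Ring.inverse_mul_cancel _ h2, Ring.mul_inverse_cancel _ h1, one_mul]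

theorem Commute.cayley {D : Matrix (Fin n) (Fin n) ℂ} (h : Commute D Y) (hY : Yᴴ = -Y) :
    Commute D (cayley Y) :=
  ((Commute.one_right D).add_right h).mul_right (Commute.matrix_ringInverse
    ((Commute.one_right D).sub_right h) (isUnit_one_sub_of_conjTranspose_eq_neg hY))

/-- Away from the exceptional value `z`, a unitary matrix is, up to a scalar, the Cayley transform of
`(h + z) (h - z)⁻¹`. -/
theorem cayley_inverse {h : Matrix (Fin n) (Fin n) ℂ} {z : ℂ} (hh : hᴴ * h = 1)
    (hz : star z * z = 1) (hu : IsUnit (h - z • 1)) :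
    ((h + z • 1) * Ring.inverse (h - z • 1))ᴴ = -((h + z • 1) * Ring.inverse (h - z • 1)) ∧
      cayley ((h + z • 1) * Ring.inverse (h - z • 1)) = -(star z) • h := by
  set S := Ring.inverse (h - z • 1) with hS
  have hS1 : (h - z • 1) * S = 1 := Ring.mul_inverse_cancel _ hu
  have hS2 : S * (h - z • 1) = 1 := Ring.inverse_mul_cancel _ hu
  set Y := (h + z • 1) * S with hYdef
  have hskew : Yᴴ = -Y := by
    -- multiply by `(h - z)ᴴ` from the left and by `h - z` from the right
    have h1 : (h - z • 1)ᴴ * (Yᴴ + Y) * (h - z • 1) = 0 := by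
      have h2 : Y * (h - z • 1) = h + z • 1 := by rw [hYdef, mul_assoc, hS2, mul_one]
      have h3 : (h - z • 1)ᴴ * Yᴴ = (h + z • 1)ᴴ := by rw [← Matrix.conjTranspose_mul, h2]
      rw [mul_add, add_mul, h3, mul_assoc _ Y, h2]
      simp only [Matrix.conjTranspose_add, Matrix.conjTranspose_sub, Matrix.conjTranspose_smul,
        Matrix.conjTranspose_one, add_mul, mul_add, sub_mul, mul_sub, hh, smul_mul_assoc,
        mul_smul_comm, one_mul, mul_one, smul_add, smul_sub, smul_smul, mul_comm z, hz, one_smul]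
      abel
    have h4 : Sᴴ * (h - z • 1)ᴴ = 1 := by rw [← Matrix.conjTranspose_mul, hS1, Matrix.conjTranspose_one]
    have h5 : Yᴴ + Y = 0 := by
      calc Yᴴ + Y = (Sᴴ * (h - z • 1)ᴴ) * (Yᴴ + Y) * ((h - z • 1) * S) := by
            rw [h4, hS1, one_mul, mul_one]
        _ = Sᴴ * ((h - z • 1)ᴴ * (Yᴴ + Y) * (h - z • 1)) * S := by noncomm_ring
        _ = 0 := by rw [h1]; simp
    exact eq_neg_of_add_eq_zero_left h5
  refine ⟨hskew, ?_⟩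
  have hu' := isUnit_one_sub_of_conjTranspose_eq_neg hskew
  have h6 : 1 + Y = (-(star z) • h) * (1 - Y) := by
    have e1 : 1 + Y = (2 : ℂ) • (h * S) := by
      rw [hYdef]
      nth_rewrite 1 [← hS1]
      rw [← add_mul, ← smul_mul_assoc]
      congr 1
      rw [two_smul]; abel
    have e2 : 1 - Y = (-2 * z) • S := by
      rw [hYdef]
      nth_rewrite 1 [← hS1]
      rw [← sub_mul]
      have : h - z • (1 : Matrix (Fin n) (Fin n) ℂ) - (h + z • 1) = (-2 * z) • 1 := by
        rw [mul_smul, neg_smul, two_smul]; abel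
      rw [this, smul_mul_assoc, one_mul]
    rw [e1, e2, smul_mul_smul_comm]
    congr 1
    linear_combination (-2 : ℂ) * hz
  rw [cayley, h6, mul_assoc, Ring.mul_inverse_cancel _ hu', mul_one]

theorem contDiffAt_cayley {Y : Matrix (Fin n) (Fin n) ℂ} (hY : Yᴴ = -Y) :
    ContDiffAt ℝ ω (cayley : Matrix (Fin n) (Fin n) ℂ → Matrix (Fin n) (Fin n) ℂ) Y := by
  obtain ⟨w, hw⟩ := isUnit_one_sub_of_conjTranspose_eq_neg hY
  have h1 : ContDiffAt ℝ ω Ring.inverse (1 - Y) := hw ▸ contDiffAt_ringInverse ℝ w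
  have h2 : ContDiffAt ℝ ω (fun X : Matrix (Fin n) (Fin n) ℂ => Ring.inverse (1 - X)) Y :=
    h1.comp Y (contDiffAt_const.sub contDiffAt_id)
  exact (contDiffAt_const.add contDiffAt_id).mul h2

theorem exists_unimodular_isUnit_sub (h : Matrix (Fin n) (Fin n) ℂ) :
    ∃ z : ℂ, star z * z = 1 ∧ IsUnit (h - z • 1) := by
  have h1 : (Metric.sphere (0 : ℂ) 1).Infinite := by
    refine IsPreconnected.infinite_of_nontrivial
      (isPreconnected_sphere (by simp [Complex.rank_real_complex]) 0 1) ⟨1, by simp, -1, by simp, ?_⟩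
    norm_num [Complex.ext_iff]
  obtain ⟨z, hz, hz'⟩ := (h1.sdiff (Matrix.finite_spectrum h)).nonempty
  refine ⟨z, ?_, ?_⟩
  · rw [mem_sphere_zero_iff_norm] at hz
    rw [Complex.star_def, Complex.conj_mul', hz]
    simp
  · rw [spectrum.notMem_iff, IsUnit.sub_iff, Algebra.algebraMap_eq_smul_one] at hz'
    exact hz'

end Cayley

/-! ### The diagonalization over the interval -/

section Sections

variable {n : ℕ} {A : ℝ → Matrix (Fin n) (Fin n) ℂ} {K p : ℕ∞}

/-- Near `t`, the map `s` diagonalizes the matrices `A u`, with eigenvalues of class `C^K` and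
eigenvectors of class `C^p`. -/
def IsDiagonalizationNear (A : ℝ → Matrix (Fin n) (Fin n) ℂ) (K p : ℕ∞)
    (s : ℝ → (Fin n → ℂ) × Matrix (Fin n) (Fin n) ℂ) (t : ℝ) : Prop :=
  ∀ᶠ u in 𝓝 t, ContDiffAt ℝ K (fun v => (s v).1) u ∧ ContDiffAt ℝ p (fun v => (s v).2) u ∧
    Diagonalizes (A u) (s u)

variable {s s' : ℝ → (Fin n → ℂ) × Matrix (Fin n) (Fin n) ℂ} {t τ : ℝ}

theorem IsDiagonalizationNear.congr (h : s' =ᶠ[𝓝 t] s) (hs : IsDiagonalizationNear A K p s t) :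
    IsDiagonalizationNear A K p s' t := by
  filter_upwards [hs, h.eventually_nhds] with u hu hss
  have hss : s' =ᶠ[𝓝 u] s := hss
  refine ⟨hu.1.congr_of_eventuallyEq (hss.fun_comp Prod.fst),
    hu.2.1.congr_of_eventuallyEq (hss.fun_comp Prod.snd), ?_⟩
  rw [hss.eq_of_nhds]
  exact hu.2.2

theorem IsDiagonalizationNear.reindex (hs : IsDiagonalizationNear A K p s t)
    (σ : Equiv.Perm (Fin n)) {c : ℂ} (hc : star c * c = 1) :
    IsDiagonalizationNear A K p (fun u => ((s u).1 ∘ σ, c • (s u).2.submatrix id σ)) t := by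
  filter_upwards [hs] with u hu
  refine ⟨contDiffAt_pi.2 fun i => contDiffAt_pi.1 hu.1 (σ i), ?_, hu.2.2.reindex σ hc⟩
  exact (((Matrix.reindexLinearEquiv ℝ ℂ (Equiv.refl _) σ.symm).toLinearMap.toContinuousLinearMap
    ).contDiff.contDiffAt.comp u hu.2.1).const_smul c

/-- Where the number of distinct eigenvalues is constant, two diagonalizations can be joined: up to a
permutation and a scalar, the second one is `V * cayley Y` with eigenvector matrix `V` of the first
one and a skew-Hermitian `Y` that commutes with the matrix of eigenvalues, and
`V * cayley (χ • Y)` joins the two. -/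
theorem IsDiagonalizationNear.exists_join (hs : IsDiagonalizationNear A K p s τ)
    (hs' : IsDiagonalizationNear A K p s' τ)
    (hA : ∀ᶠ t in 𝓝 τ, (spectrum ℂ (A t)).ncard = (spectrum ℂ (A τ)).ncard) :
    ∃ N ∈ 𝓝 τ, ∃ g : (Fin n → ℂ) × Matrix (Fin n) (Fin n) ℂ → (Fin n → ℂ) × Matrix (Fin n) (Fin n) ℂ,
      (∀ t, IsDiagonalizationNear A K p s' t → IsDiagonalizationNear A K p (g ∘ s') t) ∧
      ∀ χ : ℝ → ℝ, ContDiff ℝ p χ → ∃ s'', (∀ t ∈ N, IsDiagonalizationNear A K p s'' t) ∧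
        (∀ t, χ t = 0 → s'' t = s t) ∧ ∀ t, χ t = 1 → s'' t = g (s' t) := by
  obtain ⟨σ, hσ⟩ := exists_perm_eventually_eq hs.self_of_nhds.1.continuousAt
    hs'.self_of_nhds.1.continuousAt (hs.mono fun u hu => hu.2.2.charpoly_eq)
    (hs'.mono fun u hu => hu.2.2.charpoly_eq) hA
  have hW := hs'.reindex σ (c := 1) (by simp)
  simp only [one_smul] at hW
  set d : ℝ → Fin n → ℂ := fun u => (s u).1
  set V : ℝ → Matrix (Fin n) (Fin n) ℂ := fun u => (s u).2
  set W : ℝ → Matrix (Fin n) (Fin n) ℂ := fun u => (s' u).2.submatrix id σ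
  set h : ℝ → Matrix (Fin n) (Fin n) ℂ := fun u => (V u)ᴴ * W u
  have hh : ContDiffNear τ p h := by
    have h1 : EulerContDiff τ p 0 V := hs.mono fun u hu => hu.2.1
    have h2 : EulerContDiff τ p 0 W := hW.mono fun u hu => hu.2.1
    exact h1.conjTranspose.matrix_mul h2
  obtain ⟨z, hz, hzu⟩ := exists_unimodular_isUnit_sub (h τ)
  have hu : ∀ᶠ u in 𝓝 τ, IsUnit (h u - z • 1) := by
    have h1 : ContinuousAt (fun u => h u - z • 1) τ :=
      hh.continuousAt.self_of_nhds.sub continuousAt_const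
    exact h1.eventually (Units.isOpen.mem_nhds hzu)
  set Y : ℝ → Matrix (Fin n) (Fin n) ℂ := fun u => (h u + z • 1) * Ring.inverse (h u - z • 1)
  let Q : ℝ → Prop := fun u => ContDiffAt ℝ K d u ∧ ContDiffAt ℝ p V u ∧ ContDiffAt ℝ p Y u ∧
    Diagonalizes (A u) (d u, V u) ∧ (Y u)ᴴ = -Y u ∧ Commute (Matrix.diagonal (d u)) (Y u) ∧
    cayley (Y u) = -(star z) • h u ∧ V u * h u = W u ∧ (s' u).1 ∘ σ = d u
  have hQ : ∀ᶠ u in 𝓝 τ, Q u := by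
    filter_upwards [hs, hW, hh, hu, hσ] with u h1 h2 h3 h4 h5
    have h6 : (s' u).1 ∘ σ = d u := funext h5
    have h7 : Diagonalizes (A u) (d u, W u) := h6 ▸ h2.2.2
    obtain ⟨h8, h9⟩ := Diagonalizes.conjTranspose_mul h1.2.2 h7
    obtain ⟨h10, h11⟩ := cayley_inverse h8 hz h4
    have hYu : ContDiffAt ℝ p Y u := by
      obtain ⟨w, hw⟩ := h4
      have e1 : ContDiffAt ℝ p Ring.inverse (h u - z • 1) := hw ▸ contDiffAt_ringInverse ℝ w
      have e2 : ContDiffAt ℝ p (fun u => Ring.inverse (h u - z • 1)) u :=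
        ContDiffAt.comp (g := Ring.inverse) u e1 (h3.sub contDiffAt_const)
      exact (h3.add contDiffAt_const).mul e2
    refine ⟨h1.1, h1.2.1, hYu, h1.2.2, h10, ?_, h11, ?_, h6⟩
    · have e1 : Commute (Matrix.diagonal (d u)) (h u) := h9.symm
      have e2 : Commute (Matrix.diagonal (d u)) (z • (1 : Matrix (Fin n) (Fin n) ℂ)) :=
        (Commute.one_right _).smul_right z
      exact (e1.add_right e2).mul_right ((e1.sub_right e2).matrix_ringInverse h4)
    · change V u * ((V u)ᴴ * W u) = W u
      rw [← Matrix.mul_assoc, mul_eq_one_comm.1 h1.2.2.1, Matrix.one_mul]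
  refine ⟨{u | ∀ᶠ v in 𝓝 u, Q v}, eventually_eventually_nhds.2 hQ,
    fun x => (x.1 ∘ σ, -(star z) • x.2.submatrix id σ),
    fun t ht => ht.reindex σ (by simpa [mul_comm] using hz), fun χ hχ => ?_⟩
  classical
  let s'' : ℝ → (Fin n → ℂ) × Matrix (Fin n) (Fin n) ℂ := fun u =>
    if χ u = 0 then s u else if χ u = 1 then ((s' u).1 ∘ σ, -(star z) • W u)
    else (d u, V u * cayley (χ u • Y u))
  have hform : ∀ u, Q u → s'' u = (d u, V u * cayley (χ u • Y u)) := fun u hu => by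
    obtain ⟨-, -, -, -, -, -, h1, h2, h3⟩ := hu
    simp only [s'']
    split_ifs with h0 h0'
    · rw [h0, zero_smul, cayley_zero, mul_one]
    · rw [h0', one_smul, h1, Matrix.mul_smul, h2, h3]
    · rfl
  refine ⟨s'', fun t ht => ?_, fun t h0 => if_pos h0, fun t h1 => ?_⟩
  · refine IsDiagonalizationNear.congr (s := fun u => (d u, V u * cayley (χ u • Y u)))
      (Eventually.mono ht hform) ?_
    filter_upwards [ht] with u hu
    obtain ⟨h1, h2, h3, h4, h5, h6, -⟩ := hu
    have hsk : (χ u • Y u)ᴴ = -(χ u • Y u) := by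
      rw [Matrix.conjTranspose_smul, h5, star_trivial, smul_neg]
    refine ⟨h1, ?_, ?_⟩
    · have e1 : ContDiffAt ℝ p (fun v => χ v • Y v) u := hχ.contDiffAt.smul h3
      have e2 : ContDiffAt ℝ p (fun v => cayley (χ v • Y v)) u :=
        ContDiffAt.comp (g := cayley) u ((contDiffAt_cayley hsk).of_le le_top) e1
      exact h2.mul e2
    · exact h4.mul (conjTranspose_cayley_mul hsk) ((h6.smul_right (χ u)).cayley hsk).symm
  · simp only [s'', h1, one_ne_zero, if_false, if_true]
    rfl

theorem canGlueAt_isDiagonalizationNear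
    (hA : ∀ᶠ t in 𝓝 τ, (spectrum ℂ (A t)).ncard = (spectrum ℂ (A τ)).ncard) :
    CanGlueAt (IsDiagonalizationNear A K p) τ := by
  intro s s' hs hs'
  obtain ⟨N, hN, g, hg, hχ⟩ := hs.exists_join hs' hA
  obtain ⟨δ, hδ, hball⟩ := Metric.nhds_basis_closedBall.mem_iff.1 hN
  rw [Real.closedBall_eq_Icc] at hball
  constructor
  · obtain ⟨s'', h1, h2, h3⟩ := hχ (fun u => Real.smoothTransition ((u - τ) / δ))
      (Real.smoothTransition.contDiff.comp (by fun_prop))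
    refine ⟨s'', fun t ht => h2 t (Real.smoothTransition.zero_of_nonpos
      (div_nonpos_of_nonpos_of_nonneg (by linarith) hδ.le)), fun t ht hgood => ?_⟩
    rcases le_or_gt t (τ + δ) with h | h
    · exact h1 t (hball ⟨by linarith, h⟩)
    · refine (hg t hgood).congr ?_
      filter_upwards [Ioi_mem_nhds h] with u hu
      have hu : τ + δ < u := hu
      exact h3 u (Real.smoothTransition.one_of_one_le ((one_le_div hδ).2 (by linarith)))
  · obtain ⟨s'', h1, h2, h3⟩ := hχ (fun u => Real.smoothTransition ((τ - u) / δ))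
      (Real.smoothTransition.contDiff.comp (by fun_prop))
    refine ⟨s'', fun t ht => h2 t (Real.smoothTransition.zero_of_nonpos
      (div_nonpos_of_nonpos_of_nonneg (by linarith) hδ.le)), fun t ht hgood => ?_⟩
    rcases le_or_gt (τ - δ) t with h | h
    · exact h1 t (hball ⟨h, by linarith⟩)
    · refine (hg t hgood).congr ?_
      filter_upwards [Iio_mem_nhds h] with u hu
      have hu : u < τ - δ := hu
      exact h3 u (Real.smoothTransition.one_of_one_le ((one_le_div hδ).2 (by linarith)))

/-- The local diagonalizations of a curve of normal matrices, with the loss of derivatives given by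
the trees. -/
theorem exists_isDiagonalizationNear {I : Set ℝ} {q : ℕ∞} (hI : IsOpen I)
    (hA : IsNormalCurve (p + thetaSup q A I) A I) (hadm : ∀ t ∈ I, AdmissibleAt q A t)
    (hE : infiniteContactSet (fun t => (A t).charpoly) I = ∅) {t₀ : ℝ} (ht₀ : t₀ ∈ I) :
    (∃ s, IsDiagonalizationNear A (p + thetaSup q A I) p s t₀) ∧
      ∃ b, ∀ᶠ t in 𝓝[≠] t₀, (spectrum ℂ (A t)).ncard = b := by
  obtain ⟨T, hT, hTa⟩ := hadm t₀ ht₀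
  have hnormal : ∀ᶠ t in 𝓝 t₀, A t * (A t)ᴴ = (A t)ᴴ * A t := by
    filter_upwards [hI.mem_nhds ht₀] with t ht using hA.2 t ht
  have hsmooth : EulerContDiff t₀ (p + thetaSup q A I) 0 A := by
    refine eulerContDiff_matrix_iff.2 fun i j => ?_
    change ∀ᶠ t in 𝓝 t₀, _
    filter_upwards [hI.mem_nhds ht₀] with t ht using (hA.1 i j).contDiffAt (hI.mem_nhds ht)
  have hcont : ∀ᶠ t in 𝓝 t₀, ContinuousAt A t := ContDiffNear.continuousAt hsmooth
  obtain ⟨b, hb⟩ := hT.exists_hasBranches hTa hcont hnormal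
  have hle := hb.ncard_le hcont hnormal ht₀ (hE ▸ Set.notMem_empty t₀)
  refine ⟨?_, b, ?_⟩
  · have hθ : (T.theta : ℕ∞) ≤ thetaSup q A I :=
      (le_iSup (fun _ : IsSpectralTree t₀ q A T => (T.theta : ℕ∞)) hT).trans <|
        (le_iSup (fun T => ⨆ _ : IsSpectralTree t₀ q A T, (T.theta : ℕ∞)) T).trans <|
          (le_iSup (fun _ : t₀ ∈ I => ⨆ T, ⨆ _ : IsSpectralTree t₀ q A T, (T.theta : ℕ∞)) ht₀).trans <|
            le_iSup (fun t => ⨆ _ : t ∈ I, ⨆ T, ⨆ _ : IsSpectralTree t q A T, (T.theta : ℕ∞)) t₀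
    -- derivatives in excess of those that the tree at `t₀` costs are kept
    obtain ⟨k, hk⟩ := exists_add_of_le hθ
    have hk' : p + thetaSup q A I = (p + k) + T.theta := by rw [hk, add_assoc, add_comm k]
    rw [hk'] at hsmooth ⊢
    obtain ⟨ev, V, h1, h2, h3⟩ := hb.diagonalizable (hle.filter_mono nhdsWithin_le_nhds) 0 (p + k) A
      (fun _ => 1) (Eventually.of_forall fun _ => continuousAt_const) (by simp) (by simp) hsmooth
    have h1' : ∀ i, ∀ᶠ t in 𝓝 t₀, ContDiffAt ℝ ((p + k + T.theta : ℕ∞) : WithTop ℕ∞) (ev i) t := h1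
    have h2' : ∀ᶠ t in 𝓝 t₀, ContDiffAt ℝ ((p + k : ℕ∞) : WithTop ℕ∞) V t := h2
    refine ⟨fun t => (fun i => ev i t, V t), ?_⟩
    filter_upwards [eventually_all.2 h1', h2', h3] with t h1 h2 h3
    exact ⟨contDiffAt_pi.2 h1, h2.of_le (by exact_mod_cast le_self_add), h3⟩
  · filter_upwards [hb.le_ncard, hle.filter_mono nhdsWithin_le_nhds] with t h1 h2
    exact le_antisymm h2 h1

end Sections

/-- Eigenvalues and eigenvectors of a curve of normal matrices with admissible trees. The trees are
those of `A` as a `C^q`-curve; the choice `q = p + Θ(A)` is allowed. -/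
theorem theorem7p2 {n : ℕ} (I : Set ℝ) (hI : IsOpen I) (hI' : I.OrdConnected)
    (A : ℝ → Matrix (Fin n) (Fin n) ℂ) (q p : ℕ∞)
    (hq : IsNormalCurve q A I)
    (hA : IsNormalCurve (p + thetaSup q A I) A I)
    (hadm : ∀ t ∈ I, AdmissibleAt q A t)
    (hE : infiniteContactSet (fun t => (A t).charpoly) I = ∅) :
    ∃ ev : Fin n → ℝ → ℂ,
      ParameterizesEigenvalues (p + thetaSup q A I) A I ev ∧
      (∀ t₀ ∈ I, ∃ U : Set ℝ, IsOpen U ∧ t₀ ∈ U ∧ U ⊆ I ∧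
        ∃ v : Fin n → ℝ → EuclideanSpace ℂ (Fin n), ParameterizesEigenvectors p A U ev v) ∧
      (1 ≤ p → ∃ v : Fin n → ℝ → EuclideanSpace ℂ (Fin n),
        ParameterizesEigenvectors p A I ev v) := by
  suffices h : ∃ ev : Fin n → ℝ → ℂ, ParameterizesEigenvalues (p + thetaSup q A I) A I ev ∧
      ∃ v : Fin n → ℝ → EuclideanSpace ℂ (Fin n), ParameterizesEigenvectors p A I ev v by
    obtain ⟨ev, h1, h2⟩ := h
    exact ⟨ev, h1, fun t₀ ht₀ => ⟨I, hI, ht₀, subset_rfl, h2⟩, fun _ => h2⟩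
  have hglue : ∀ t ∈ I, ∀ᶠ τ in 𝓝[≠] t,
      CanGlueAt (IsDiagonalizationNear A (p + thetaSup q A I) p) τ := fun t ht => by
    obtain ⟨-, b, hb⟩ := exists_isDiagonalizationNear hI hA hadm hE ht
    filter_upwards [eventually_eventually_nhdsWithin.2 hb, self_mem_nhdsWithin] with τ h1 hτ
    rw [IsOpen.nhdsWithin_eq isOpen_compl_singleton hτ] at h1
    refine canGlueAt_isDiagonalizationNear ?_
    rw [h1.self_of_nhds]
    exact h1
  obtain ⟨s, hs⟩ : ∃ s, ∀ t ∈ I, IsDiagonalizationNear A (p + thetaSup q A I) p s t := by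
    rcases I.eq_empty_or_nonempty with rfl | hne
    · exact ⟨fun _ => (0, 0), fun t ht => ht.elim⟩
    · exact exists_good_of_local IsDiagonalizationNear.congr (fun h => eventually_eventually_nhds.2 h)
        hI hI' hne (fun t ht => (exists_isDiagonalizationNear hI hA hadm hE ht).1) hglue
  refine ⟨fun i t => (s t).1 i, ⟨fun i t ht => ?_, fun t ht => ?_⟩,
    fun i t => WithLp.toLp 2 fun j => (s t).2 j i, fun i t ht => ?_, fun t ht => ⟨?_, fun i => ?_⟩⟩
  · exact (contDiffAt_pi.1 (hs t ht).self_of_nhds.1 i).contDiffWithinAt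
  · exact (hs t ht).self_of_nhds.2.2.charpoly_eq
  · have h1 := (hs t ht).self_of_nhds.2.1
    refine ContDiffAt.contDiffWithinAt ((PiLp.continuousLinearEquiv 2 ℝ
      (fun _ : Fin n => ℂ)).symm.contDiff.contDiffAt.comp t (contDiffAt_pi.2 fun j => ?_))
    exact (LinearMap.toContinuousLinearMap (Matrix.entryLinearMap ℝ ℂ j i)).contDiff.contDiffAt.comp
      t h1
  · rw [orthonormal_iff_ite]
    intro i j
    have h1 := congrFun₂ (hs t ht).self_of_nhds.2.2.1 i j
    rw [Matrix.mul_apply, Matrix.one_apply] at h1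
    rw [← h1, EuclideanSpace.inner_eq_star_dotProduct, dotProduct]
    exact Finset.sum_congr rfl fun k _ => mul_comm _ _
  · have h1 := (hs t ht).self_of_nhds.2.2.2
    ext j
    have h2 := congrFun₂ h1 j i
    rw [Matrix.mul_diagonal, mul_comm] at h2
    exact h2
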